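/- Consider a discrete memoryless half-duplex compound multiple access channel with a relay: two sources $S_1,S_2$, a relay $R$ and two destinations $D_1,D_2$, with finite alphabets. A block of $l=n+m$ channel uses has a first slot of length $n$, in which $S_i$ sends $X_{i1}$, the relay receives $Y_R$ and $D_k$ receives $Y_{k1}$ according to $p(y_R,y_{11},y_{21}\mid x_{11},x_{21})$, and a second slot of length $m$, in which $S_i$ sends $X_{i2}$, the relay sends $X_R$ and $D_k$ receives $Y_{k2}$ according to $p(y_{12},y_{22}\mid x_{12},x_{22},x_R)$; both slots are memoryless. A code consists of encoding functions of source $i$ mapping a message $W_i$ from a set of $\lceil 2^{lR_i}\rceil$ messages to $X_{i1}^n(W_i)$ and $X_{i2}^m(W_i)$, a relay function mapping $Y_R^n$ to $X_R^m$, and, for each $D_k$, a function that decodes both messages from $(Y_{k1}^n,Y_{k2}^m)$. The messages are independent and uniform, and an error occurs if some destination gets some message wrong. Let $0<\beta<1$. A pair $(R_1,R_2)$ with $R_1,R_2\ge 0$ is achievable with listening fraction $\beta$ if, for all slot lengths $n=n_l$, $m=m_l$ with $n_l+m_l=l$ and $n_l/l\to\beta$, there are codes whose error probability tends to $0$ as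 $l\to\infty$. In the GQF (generalized quantize-and-forward) scheme for an input distribution $p(x_{11})p(x_{21})p(x_{12})p(x_{22})p(x_R)p(\hat y_R\mid y_R)$, with quantization rate $R_U\ge0$ and parameters $0<\varepsilon'<\varepsilon<1$, there are codewords $x_{i1}^n(w_i)$, $x_{i2}^m(w_i)$ for the messages $w_i$ and codewords $\hat y_R^n(u)$, $x_R^m(u)$ for $\lceil 2^{lR_U}\rceil$ indices $u$. After slot one the relay chooses, uniformly at random, an index $u$ such that $(y_R^n,\hat y_R^n(u))$ is $\varepsilon'$-strongly typical (any index, uniformly at random, if there is none) and sends $x_R^m(u)$ in slot two, without binning. Destination $D_k$ looks for the unique pair $(\hat w_1,\hat w_2)$ such that for some $u$ both $(x_{11}^n(\hat w_1),x_{21}^n(\hat w_2),y_{k1}^n,\hat y_R^n(u))$ and $(x_{12}^m(\hat w_1),x_{22}^m(\hat w_2),x_R^m(u),y_{k2}^m)$ are jointly $\varepsilon$-strongly typical, and an error is declared if there is no unique such pair. Here $\varepsilon$-strongly typical means that the relative frequency of every symbol $a$ differs from its probability $p(a)$ by at most $\varepsilon p(a)$. Theorem. For every input distribution as above, let, for $k\in\{1,2\}$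 and $\{i,j\}=\{1,2\}$, with mutual information in bits under the joint law given by the input distribution and the channel, $$a_k(i)=\beta I(X_{i1};X_{j1},Y_{k1},\hat Y_R)+(1-\beta)I(X_{i2};X_{j2},X_R,Y_{k2}),$$ $$b_k(i)=\beta\,[I(X_{i1};X_{j1},Y_{k1})-I(\hat Y_R;Y_R\mid X_{i1},X_{j1},Y_{k1})]+(1-\beta)I(X_{i2},X_R;X_{j2},Y_{k2}),$$ $$c_k=\beta I(X_{11},X_{21};Y_{k1},\hat Y_R)+(1-\beta)I(X_{12},X_{22};X_R,Y_{k2}),$$ $$d_k=\beta\,[I(X_{11},X_{21},\hat Y_R;Y_{k1})+I(X_{11},X_{21};\hat Y_R)-I(Y_R;\hat Y_R)]+(1-\beta)I(X_{12},X_{22},X_R;Y_{k2}),$$ and $a(i)=\min_k a_k(i)$, $b(i)=\min_k b_k(i)$, $c=\min_k c_k$, $d=\min_k d_k$. If $R_1,R_2\ge0$, $R_i<\min\{a(i),b(i)\}$ for $i=1,2$ and $R_1+R_2<\min\{c,d\}$, then $(R_1,R_2)$ is achieved by the GQF scheme: there are $R_U\ge0$ and $0<\varepsilon'<\varepsilon<1$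 such that, for all slot lengths with $n_l+m_l=l$ and $n_l/l\to\beta$, there are GQF codebooks whose error probability tends to $0$ as $l\to\infty$. In particular $(R_1,R_2)$ is achievable with listening fraction $\beta$. -/

import Mathlib

open Filter Topology

noncomputable section

namespace HDcMACr

/-! ### Information measures of finite-valued random variables (in bits)

`P : Ω → ℝ` is a probability mass function on a finite sample space and random
variables are functions on `Ω`. -/

section Information

variable {Ω α γ δ : Type*} [Fintype Ω] [Fintype α] [Fintype γ] [Fintype δ]

open Classical in
/-- The probability mass function of the random variable `X`. -/
def law {Ω α : Type*} [Fintype Ω] (P : Ω → ℝ) (X : Ω → α) (a : α) : ℝ :=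
  ∑ ω, if X ω = a then P ω else 0

/-- `I(X; Y) = ∑ p(x,y) log₂ (p(x,y) / (p(x) p(y)))`. -/
def mutualInfo (P : Ω → ℝ) (X : Ω → α) (Y : Ω → γ) : ℝ :=
  ∑ x, ∑ y, law P (fun ω => (X ω, Y ω)) (x, y) *
    Real.logb 2 (law P (fun ω => (X ω, Y ω)) (x, y) / (law P X x * law P Y y))

/-- `I(X; Y | Z) = ∑ p(x,y,z) log₂ (p(x,y,z) p(z) / (p(x,z) p(y,z)))`. -/
def condMutualInfo (P : Ω → ℝ) (X : Ω → α) (Y : Ω → γ) (Z : Ω → δ) : ℝ :=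
  ∑ x, ∑ y, ∑ z, law P (fun ω => (X ω, Y ω, Z ω)) (x, y, z) *
    Real.logb 2 (law P (fun ω => (X ω, Y ω, Z ω)) (x, y, z) * law P Z z /
      (law P (fun ω => (X ω, Z ω)) (x, z) * law P (fun ω => (Y ω, Z ω)) (y, z)))

open Classical in
/-- `s ∈ T_ε^n(p)`: the relative frequency `π(a | s)` of each symbol `a` satisfies
`|π(a | s) - p(a)| ≤ ε p(a)`; both sides are multiplied by the length `n`. -/
def IsTypical {α : Type*} (ε : ℝ) (p : α → ℝ) {n : ℕ} (s : Fin n → α) : Prop :=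
  ∀ a, |((Finset.univ.filter fun t => s t = a).card : ℝ) - n * p a| ≤ ε * (n * p a)

end Information

/-! ### The channel and its codes

Sources `i` and destinations `k` are indexed by `Fin 2`. In slot one source `i` sends
letters of `X1 i`, the relay receives letters of `YR` and destination `k` letters of `Y1 k`;
in slot two source `i` sends letters of `X2 i`, the relay sends letters of `XR` and
destination `k` receives letters of `Y2 k`. `YH` is the alphabet of the quantized relay
observation. -/

/-- A discrete memoryless half-duplex compound multiple access channel with a relay:
`slot1 x` is `p(y_R, y_11, y_21 | x_11, x_21)` and `slot2 x x_R` is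
`p(y_12, y_22 | x_12, x_22, x_R)`. -/
structure Channel (X1 X2 : Fin 2 → Type*) (XR YR : Type*) (Y1 Y2 : Fin 2 → Type*) where
  slot1 : (∀ i, X1 i) → PMF (YR × (∀ k, Y1 k))
  slot2 : (∀ i, X2 i) → XR → PMF (∀ k, Y2 k)

/-- An input distribution `p(x_11) p(x_21) p(x_12) p(x_22) p(x_R) p(ŷ_R | y_R)`. -/
structure InputDist (X1 X2 : Fin 2 → Type*) (XR YR YH : Type*) where
  p1 : ∀ i, PMF (X1 i)
  p2 : ∀ i, PMF (X2 i)
  pR : PMF XR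
  quant : YR → PMF YH

/-- Codebooks, a relay with local randomness, and decoders; a decoder may return `none`
(a declared failure). `M i` is the number of messages of source `i`; `n` and `m` are the
lengths of the two slots. -/
structure RandCode (X1 X2 : Fin 2 → Type*) (XR YR : Type*) (Y1 Y2 : Fin 2 → Type*)
    (M : Fin 2 → ℕ) (n m : ℕ) where
  enc1 : ∀ i, Fin (M i) → Fin n → X1 i
  enc2 : ∀ i, Fin (M i) → Fin m → X2 i
  relay : (Fin n → YR) → PMF (Fin m → XR)
  dec : ∀ k, (Fin n → Y1 k) → (Fin m → Y2 k) → Option (∀ i, Fin (M i))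

/-- A code whose encoders, relay and decoders are all functions. -/
structure Code (X1 X2 : Fin 2 → Type*) (XR YR : Type*) (Y1 Y2 : Fin 2 → Type*)
    (M : Fin 2 → ℕ) (n m : ℕ) where
  enc1 : ∀ i, Fin (M i) → Fin n → X1 i
  enc2 : ∀ i, Fin (M i) → Fin m → X2 i
  relay : (Fin n → YR) → Fin m → XR
  dec : ∀ k, (Fin n → Y1 k) → (Fin m → Y2 k) → ∀ i, Fin (M i)

/-- Codebooks of the generalized quantize-and-forward scheme: source codewords for both
slots, and for each of the `MU` quantization indices `u` a quantization codeword `ŷ_R^n(u)`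
and a relay codeword `x_R^m(u)`. -/
structure GQFCodebook (X1 X2 : Fin 2 → Type*) (XR YH : Type*)
    (M : Fin 2 → ℕ) (MU n m : ℕ) where
  cw1 : ∀ i, Fin (M i) → Fin n → X1 i
  cw2 : ∀ i, Fin (M i) → Fin m → X2 i
  cwQ : Fin MU → Fin n → YH
  cwR : Fin MU → Fin m → XR

section Defs

variable {X1 X2 : Fin 2 → Type*} {XR YR YH : Type*} {Y1 Y2 : Fin 2 → Type*}

/-- A code without randomization at the relay is a special case of a code with it. -/
def Code.toRandCode {M : Fin 2 → ℕ} {n m : ℕ} (c : Code X1 X2 XR YR Y1 Y2 M n m) :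
    RandCode X1 X2 XR YR Y1 Y2 M n m where
  enc1 := c.enc1
  enc2 := c.enc2
  relay y := PMF.pure (c.relay y)
  dec k y z := some (c.dec k y z)

open Classical in
/-- The probability, for independent messages `w i` uniform on `Fin (M i)` and memoryless
use of the channel in both slots, that some destination does not decode both messages
correctly. -/
def errorProb [Fintype XR] [Fintype YR] [∀ k, Fintype (Y1 k)] [∀ k, Fintype (Y2 k)]
    (ch : Channel X1 X2 XR YR Y1 Y2) {M : Fin 2 → ℕ} {n m : ℕ}
    (c : RandCode X1 X2 XR YR Y1 Y2 M n m) : ℝ :=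
  ∑ w : (∀ i, Fin (M i)), (∏ i, (M i : ℝ)⁻¹) *
    ∑ yR : Fin n → YR, ∑ y1 : (∀ k, Fin n → Y1 k),
      (∏ t, (ch.slot1 (fun i => c.enc1 i (w i) t) (yR t, fun k => y1 k t)).toReal) *
      ∑ xR : Fin m → XR, (c.relay yR xR).toReal *
        ∑ y2 : (∀ k, Fin m → Y2 k),
          (∏ t, (ch.slot2 (fun i => c.enc2 i (w i) t) (xR t) (fun k => y2 k t)).toReal) *
          (if ∃ k, c.dec k (y1 k) (y2 k) ≠ some w then 1 else 0)

/-! ### Joint distributions of the two slots -/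

/-- Sample space of slot one: `((X_11, X_21), Y_R, (Y_11, Y_21), Ŷ_R)`. -/
abbrev Slot1 (X1 : Fin 2 → Type*) (YR : Type*) (Y1 : Fin 2 → Type*) (YH : Type*) :=
  (∀ i, X1 i) × YR × (∀ k, Y1 k) × YH

/-- Sample space of slot two: `((X_12, X_22), X_R, (Y_12, Y_22))`. -/
abbrev Slot2 (X2 : Fin 2 → Type*) (XR : Type*) (Y2 : Fin 2 → Type*) :=
  (∀ i, X2 i) × XR × (∀ k, Y2 k)

/-- `p(x_11) p(x_21) p(y_R, y_11, y_21 | x_11, x_21) p(ŷ_R | y_R)`. -/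
def joint1 (ch : Channel X1 X2 XR YR Y1 Y2) (d : InputDist X1 X2 XR YR YH) :
    Slot1 X1 YR Y1 YH → ℝ :=
  fun ⟨x, yR, y, yh⟩ =>
    (∏ i, (d.p1 i (x i)).toReal) * (ch.slot1 x (yR, y)).toReal * (d.quant yR yh).toReal

/-- `p(x_12) p(x_22) p(x_R) p(y_12, y_22 | x_12, x_22, x_R)`. -/
def joint2 (ch : Channel X1 X2 XR YR Y1 Y2) (d : InputDist X1 X2 XR YR YH) :
    Slot2 X2 XR Y2 → ℝ :=
  fun ⟨x, xR, y⟩ =>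
    (∏ i, (d.p2 i (x i)).toReal) * (d.pR xR).toReal * (ch.slot2 x xR y).toReal

section Finite

variable [∀ i, Fintype (X1 i)] [∀ i, Fintype (X2 i)] [Fintype XR] [Fintype YR] [Fintype YH]
  [∀ k, Fintype (Y1 k)] [∀ k, Fintype (Y2 k)]

/-! ### The generalized quantize-and-forward scheme -/

/-- Joint typicality, with parameter `ε`, of a relay observation with the quantization
codeword number `u`. -/
def IsQuantization (ch : Channel X1 X2 XR YR Y1 Y2) (d : InputDist X1 X2 XR YR YH) (ε : ℝ)
    {M : Fin 2 → ℕ} {MU n m : ℕ} (cb : GQFCodebook X1 X2 XR YH M MU n m)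
    (yR : Fin n → YR) (u : Fin MU) : Prop :=
  IsTypical ε (law (joint1 ch d) fun ω => (ω.2.1, ω.2.2.2)) fun t => (yR t, cb.cwQ u t)

/-- The message pair `w` is a candidate at destination `k` that received `y1` and `y2`:
for some quantization index `u`,
`(x_11(w_1), x_21(w_2), y_k1, ŷ_R(u))` and `(x_12(w_1), x_22(w_2), x_R(u), y_k2)` are
jointly typical. -/
def IsCandidate (ch : Channel X1 X2 XR YR Y1 Y2) (d : InputDist X1 X2 XR YR YH) (ε : ℝ)
    {M : Fin 2 → ℕ} {MU n m : ℕ} (cb : GQFCodebook X1 X2 XR YH M MU n m)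
    (k : Fin 2) (y1 : Fin n → Y1 k) (y2 : Fin m → Y2 k) (w : ∀ i, Fin (M i)) : Prop :=
  ∃ u : Fin MU,
    IsTypical ε (law (joint1 ch d) fun ω => (ω.1, ω.2.2.1 k, ω.2.2.2))
      (fun t => ((fun i => cb.cw1 i (w i) t), y1 t, cb.cwQ u t)) ∧
    IsTypical ε (law (joint2 ch d) fun ω => (ω.1, ω.2.1, ω.2.2 k))
      (fun t => ((fun i => cb.cw2 i (w i) t), cb.cwR u t, y2 t))

open Classical in
/-- The relay's choice of an index: uniform among those that quantize its observation, and
uniform among all indices if there is none. -/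
def relayIndex (ch : Channel X1 X2 XR YR Y1 Y2) (d : InputDist X1 X2 XR YR YH) (ε : ℝ)
    {M : Fin 2 → ℕ} {MU n m : ℕ} [NeZero MU] (cb : GQFCodebook X1 X2 XR YH M MU n m)
    (yR : Fin n → YR) : PMF (Fin MU) :=
  if h : (Finset.univ.filter (IsQuantization ch d ε cb yR)).Nonempty then
    PMF.uniformOfFinset _ h
  else PMF.uniformOfFintype (Fin MU)

open Classical in
/-- The scheme: the relay sends `x_R(u)` for its index `u` itself (there is no binning), and
each destination jointly decodes the unique candidate pair (and fails if there is none). -/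
def GQFCodebook.toRandCode (ch : Channel X1 X2 XR YR Y1 Y2) (d : InputDist X1 X2 XR YR YH)
    (ε' ε : ℝ) {M : Fin 2 → ℕ} {MU n m : ℕ} [NeZero MU]
    (cb : GQFCodebook X1 X2 XR YH M MU n m) : RandCode X1 X2 XR YR Y1 Y2 M n m where
  enc1 := cb.cw1
  enc2 := cb.cw2
  relay yR := (relayIndex ch d ε' cb yR).map cb.cwR
  dec k y1 y2 :=
    if h : ∃! w, IsCandidate ch d ε cb k y1 y2 w then some h.choose else none

/-! ### Achievability -/

/-- Number of indices at rate `r` for block length `l`: `2 ^ (l r)`, rounded up. -/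
def size (r : ℝ) (l : ℕ) : ℕ := ⌈(2 : ℝ) ^ ((l : ℝ) * r)⌉₊

instance size_neZero (r : ℝ) (l : ℕ) : NeZero (size r l) :=
  ⟨(Nat.ceil_pos.2 (Real.rpow_pos_of_pos two_pos _)).ne'⟩

/-- Lengths `n l` and `m l` of the two slots of a block of `l` channel uses, with listening
fraction `β`. -/
def IsSlotSplit (β : ℝ) (n m : ℕ → ℕ) : Prop :=
  (∀ l, n l + m l = l) ∧ Tendsto (fun l => (n l : ℝ) / l) atTop (𝓝 β)

/-- `(R_1, R_2)` is achievable with listening fraction `β`. -/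
def Achievable (ch : Channel X1 X2 XR YR Y1 Y2) (β : ℝ) (R : Fin 2 → ℝ) : Prop :=
  ∀ n m : ℕ → ℕ, IsSlotSplit β n m →
    ∃ c : ∀ l, Code X1 X2 XR YR Y1 Y2 (fun i => size (R i) l) (n l) (m l),
      Tendsto (fun l => errorProb ch (c l).toRandCode) atTop (𝓝 0)

/-- `(R_1, R_2)` is achieved, with listening fraction `β`, by the generalized
quantize-and-forward scheme for the input distribution `d`, for some quantization rate `RU`
and typicality parameters `0 < ε' < ε < 1`. -/
def AchievableByGQF (ch : Channel X1 X2 XR YR Y1 Y2) (d : InputDist X1 X2 XR YR YH)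
    (β : ℝ) (R : Fin 2 → ℝ) : Prop :=
  ∃ RU ε' ε : ℝ, 0 ≤ RU ∧ 0 < ε' ∧ ε' < ε ∧ ε < 1 ∧
    ∀ n m : ℕ → ℕ, IsSlotSplit β n m →
      ∃ cb : ∀ l, GQFCodebook X1 X2 XR YH (fun i => size (R i) l) (size RU l) (n l) (m l),
        Tendsto (fun l => errorProb ch ((cb l).toRandCode ch d ε' ε)) atTop (𝓝 0)

/-! ### The bounds of the rate region -/

/-- `a_k(i) = β I(X_i1; X_j1, Y_k1, Ŷ_R) + (1 - β) I(X_i2; X_j2, X_R, Y_k2)`,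
where `j` is the other source. -/
def boundA (ch : Channel X1 X2 XR YR Y1 Y2) (d : InputDist X1 X2 XR YR YH) (β : ℝ)
    (k i j : Fin 2) : ℝ :=
  β * mutualInfo (joint1 ch d) (fun ω => ω.1 i) (fun ω => (ω.1 j, ω.2.2.1 k, ω.2.2.2)) +
  (1 - β) * mutualInfo (joint2 ch d) (fun ω => ω.1 i) (fun ω => (ω.1 j, ω.2.1, ω.2.2 k))

/-- `b_k(i) = β [I(X_i1; X_j1, Y_k1) - I(Ŷ_R; Y_R | X_i1, X_j1, Y_k1)]
+ (1 - β) I(X_i2, X_R; X_j2, Y_k2)`, where `j` is the other source. -/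
def boundB (ch : Channel X1 X2 XR YR Y1 Y2) (d : InputDist X1 X2 XR YR YH) (β : ℝ)
    (k i j : Fin 2) : ℝ :=
  β * (mutualInfo (joint1 ch d) (fun ω => ω.1 i) (fun ω => (ω.1 j, ω.2.2.1 k)) -
    condMutualInfo (joint1 ch d) (fun ω => ω.2.2.2) (fun ω => ω.2.1)
      (fun ω => (ω.1 i, ω.1 j, ω.2.2.1 k))) +
  (1 - β) * mutualInfo (joint2 ch d) (fun ω => (ω.1 i, ω.2.1)) (fun ω => (ω.1 j, ω.2.2 k))

/-- `c_k = β I(X_11, X_21; Y_k1, Ŷ_R) + (1 - β) I(X_12, X_22; X_R, Y_k2)`. -/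
def boundC (ch : Channel X1 X2 XR YR Y1 Y2) (d : InputDist X1 X2 XR YR YH) (β : ℝ)
    (k : Fin 2) : ℝ :=
  β * mutualInfo (joint1 ch d) (fun ω => (ω.1 0, ω.1 1)) (fun ω => (ω.2.2.1 k, ω.2.2.2)) +
  (1 - β) * mutualInfo (joint2 ch d) (fun ω => (ω.1 0, ω.1 1)) (fun ω => (ω.2.1, ω.2.2 k))

/-- `d_k = β [I(X_11, X_21, Ŷ_R; Y_k1) + I(X_11, X_21; Ŷ_R) - I(Y_R; Ŷ_R)]
+ (1 - β) I(X_12, X_22, X_R; Y_k2)`. -/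
def boundD (ch : Channel X1 X2 XR YR Y1 Y2) (d : InputDist X1 X2 XR YR YH) (β : ℝ)
    (k : Fin 2) : ℝ :=
  β * (mutualInfo (joint1 ch d) (fun ω => (ω.1 0, ω.1 1, ω.2.2.2)) (fun ω => ω.2.2.1 k) +
    mutualInfo (joint1 ch d) (fun ω => (ω.1 0, ω.1 1)) (fun ω => ω.2.2.2) -
    mutualInfo (joint1 ch d) (fun ω => ω.2.1) (fun ω => ω.2.2.2)) +
  (1 - β) * mutualInfo (joint2 ch d) (fun ω => (ω.1 0, ω.1 1, ω.2.1)) (fun ω => ω.2.2 k)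

end Finite

end Defs

end HDcMACr

end

set_option linter.unusedSectionVars false

noncomputable section

namespace HDcMACr

/-! The proof is a random coding argument. All codewords are drawn independently, the quantization
codewords from the marginal law of the quantized observation, and the error probability is averaged
over the codebook for fixed messages `w`. Let `u` be the index chosen by the relay. A destination
errs only if the transmitted codewords with index `u` fail a test, or some wrong tuple `v` passes
both tests, either with `u` itself or with another index `u'`. That `w` also passes with a wrong
index is harmless, since the index need not be decoded.

The transmitted codewords pass slot two by the law of large numbers, because the index depends on
slot one alone. In slot one, a quantization rate above `β I(Y_R; Ŷ_R)` makes it likely that some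
codeword is typical with the relay observation (`le_coverProb`, `E_not_covered_le`). Given that
observation, the inputs and the destination outputs are independent of the codebook and hence of the
chosen index, so joint typicality extends to them (`E_backward_not_typical_le`). This is the Markov
lemma, with `ε' < ε` leaving room for the fluctuations.

Wrong tuples are handled by likelihood ratios (`E_typical_le`): fresh letters look typical with
probability about `2 ^ (-n D)`, where `D` is the divergence of the true joint law from the product
of the law of the fresh letters and that of the side information. With the index `u` these exponents
are the bounds `a` and `c`. With another index they are `b` and `d` increased by `β I(Y_R; Ŷ_R)`
(`divergence_wrong_index_single`, `divergence_wrong_index_both`), which pays for the union bound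
over indices when the quantization rate is `β I(Y_R; Ŷ_R) + δ`.

The delicate point is that the relay's choice depends on every quantization codeword, so an unchosen
codeword is not independent of the outputs. By `select_le`, the probability of choosing `u ≠ u'` is
at most that under a selection which ignores `u'`. After this domination the codeword with index
`u'` can be redrawn (`E_wrong_messages_index_le`). Averages over codebooks and over the randomness
of the relay are finally replaced by their best realizations. -/

open Classical in
/-- The indicator of a proposition, as a real number. -/
def ind (p : Prop) : ℝ := if p then 1 else 0

lemma ind_nonneg (p : Prop) : 0 ≤ ind p := by unfold ind; split_ifs <;> norm_num

lemma ind_le_one (p : Prop) : ind p ≤ 1 := by unfold ind; split_ifs <;> norm_num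

lemma ind_of {p : Prop} (h : p) : ind p = 1 := if_pos h

lemma ind_of_not {p : Prop} (h : ¬p) : ind p = 0 := if_neg h

lemma ind_le_of {p : Prop} {x : ℝ} (hx : 0 ≤ x) (h : p → 1 ≤ x) : ind p ≤ x := by
  by_cases hp : p
  · rw [ind_of hp]; exact h hp
  · rwa [ind_of_not hp]

lemma ind_forall {ι : Type*} [Fintype ι] (p : ι → Prop) : ind (∀ i, p i) = ∏ i, ind (p i) := by
  classical
  by_cases h : ∀ i, p i
  · rw [ind_of h, Finset.prod_eq_one fun i _ => ind_of (h i)]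
  · rw [ind_of_not h]
    push Not at h
    obtain ⟨i, hi⟩ := h
    exact (Finset.prod_eq_zero (Finset.mem_univ i) (ind_of_not hi)).symm

/-- A probability mass function, with real weights, on a finite type. -/
@[ext] structure FinProb (Ω : Type*) [Fintype Ω] where
  w : Ω → ℝ
  nonneg : ∀ ω, 0 ≤ w ω
  sum_one : ∑ ω, w ω = 1

namespace FinProb

/-! ### Expectations on finite probability spaces -/

section Expectation

variable {Ω Ω' : Type*} [Fintype Ω] [Fintype Ω']

/-- The expectation of `f`. -/
def E (P : FinProb Ω) (f : Ω → ℝ) : ℝ := ∑ ω, P.w ω * f ω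

lemma E_mono (P : FinProb Ω) {f g : Ω → ℝ} (h : ∀ ω, f ω ≤ g ω) : P.E f ≤ P.E g :=
  Finset.sum_le_sum fun ω _ => mul_le_mul_of_nonneg_left (h ω) (P.nonneg ω)

lemma E_nonneg (P : FinProb Ω) {f : Ω → ℝ} (h : ∀ ω, 0 ≤ f ω) : 0 ≤ P.E f :=
  Finset.sum_nonneg fun ω _ => mul_nonneg (P.nonneg ω) (h ω)

@[simp] lemma E_const (P : FinProb Ω) (c : ℝ) : P.E (fun _ => c) = c := by
  rw [E, ← Finset.sum_mul, P.sum_one, one_mul]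

lemma E_le_const (P : FinProb Ω) {f : Ω → ℝ} {c : ℝ} (h : ∀ ω, f ω ≤ c) : P.E f ≤ c :=
  (P.E_mono h).trans_eq (P.E_const c)

lemma E_add (P : FinProb Ω) (f g : Ω → ℝ) : P.E (fun ω => f ω + g ω) = P.E f + P.E g := by
  simp only [E, mul_add, Finset.sum_add_distrib]

lemma E_sum {ι : Type*} (P : FinProb Ω) (s : Finset ι) (f : ι → Ω → ℝ) :
    P.E (fun ω => ∑ i ∈ s, f i ω) = ∑ i ∈ s, P.E (f i) := by
  simp only [E, Finset.mul_sum]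
  exact Finset.sum_comm

lemma E_const_mul (P : FinProb Ω) (c : ℝ) (f : Ω → ℝ) : P.E (fun ω => c * f ω) = c * P.E f := by
  simp only [E, Finset.mul_sum]
  exact Finset.sum_congr rfl fun ω _ => by ring

lemma E_mul_const (P : FinProb Ω) (c : ℝ) (f : Ω → ℝ) : P.E (fun ω => f ω * c) = P.E f * c := by
  simp only [mul_comm _ c, E_const_mul]

lemma E_comm (P : FinProb Ω) (Q : FinProb Ω') (f : Ω → Ω' → ℝ) :
    P.E (fun a => Q.E fun b => f a b) = Q.E fun b => P.E fun a => f a b := by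
  simp only [E, Finset.mul_sum]
  rw [Finset.sum_comm]
  exact Finset.sum_congr rfl fun b _ => Finset.sum_congr rfl fun a _ => by ring

lemma exists_le_E (P : FinProb Ω) (f : Ω → ℝ) : ∃ ω, f ω ≤ P.E f := by
  by_contra! h
  have h1 : ∀ ω ∈ Finset.univ, P.w ω * P.E f ≤ P.w ω * f ω := fun ω _ =>
    mul_le_mul_of_nonneg_left (h ω).le (P.nonneg ω)
  have h2 : ∑ ω, P.w ω * P.E f = ∑ ω, P.w ω * f ω := by
    rw [← Finset.sum_mul, P.sum_one, one_mul, E]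
  have h3 := (Finset.sum_eq_sum_iff_of_le h1).1 h2
  have h4 : ∀ ω, P.w ω = 0 := fun ω => by
    have := h3 ω (Finset.mem_univ _)
    by_contra h0
    exact (h ω).ne (mul_left_cancel₀ h0 this)
  have := P.sum_one
  simp [h4] at this

lemma E_ind_not (P : FinProb Ω) (p : Ω → Prop) :
    P.E (fun ω => ind (¬p ω)) = 1 - P.E fun ω => ind (p ω) := by
  have h : (fun ω => ind (¬p ω) + ind (p ω)) = fun _ => (1 : ℝ) := by
    funext ω
    by_cases h : p ω <;> simp [ind, h]
  have := P.E_add (fun ω => ind (¬p ω)) (fun ω => ind (p ω))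
  rw [h, E_const] at this
  linarith

lemma w_eq_E (P : FinProb Ω) (a : Ω) : P.w a = P.E fun ω => ind (ω = a) := by
  classical
  simp [E, ind]

/-- The mass function of a `PMF`. -/
def ofPMF (p : PMF Ω) : FinProb Ω where
  w ω := (p ω).toReal
  nonneg _ := ENNReal.toReal_nonneg
  sum_one := by
    rw [← ENNReal.toReal_sum fun ω _ => p.apply_ne_top ω]
    have := p.tsum_coe
    rw [tsum_fintype] at this
    simp [this]

end Expectation

/-! ### Kernels, products and images of laws -/

section Constructions

variable {Ω Ω' : Type*} [Fintype Ω] [Fintype Ω']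

/-- The joint law of `a ∼ P` and `b ∼ κ a`. -/
def compProd (P : FinProb Ω) (κ : Ω → FinProb Ω') : FinProb (Ω × Ω') where
  w x := P.w x.1 * (κ x.1).w x.2
  nonneg x := mul_nonneg (P.nonneg _) ((κ _).nonneg _)
  sum_one := by
    rw [Fintype.sum_prod_type]
    simp only [← Finset.mul_sum, (κ _).sum_one, mul_one, P.sum_one]

lemma E_compProd (P : FinProb Ω) (κ : Ω → FinProb Ω') (f : Ω × Ω' → ℝ) :
    (P.compProd κ).E f = P.E fun a => (κ a).E fun b => f (a, b) := by
  simp only [E, compProd, Fintype.sum_prod_type, Finset.mul_sum, mul_assoc]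

/-- The product law. -/
abbrev prod (P : FinProb Ω) (Q : FinProb Ω') : FinProb (Ω × Ω') := P.compProd fun _ => Q

lemma E_prod_mul (P : FinProb Ω) (Q : FinProb Ω') (f : Ω → ℝ) (g : Ω' → ℝ) :
    (P.prod Q).E (fun x => f x.1 * g x.2) = P.E f * Q.E g := by
  simp only [E_compProd, E_const_mul, E_mul_const]

open Classical in
/-- The law of `f` under `P`. -/
def map (P : FinProb Ω) (f : Ω → Ω') : FinProb Ω' where
  w := law P.w f
  nonneg b := Finset.sum_nonneg fun ω _ => by split_ifs <;> simp [P.nonneg]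
  sum_one := by
    unfold law
    rw [Finset.sum_comm]
    simp [P.sum_one]

lemma E_map (P : FinProb Ω) (f : Ω → Ω') (g : Ω' → ℝ) :
    (P.map f).E g = P.E fun ω => g (f ω) := by
  classical
  simp only [E, map, law, Finset.sum_mul]
  rw [Finset.sum_comm]
  simp [ite_mul]

lemma ext_E {P Q : FinProb Ω} (h : ∀ f, P.E f = Q.E f) : P = Q := by
  ext ω
  rw [w_eq_E, w_eq_E, h]

end Constructions

/-! ### Families of independent random elements -/

section Pi

variable {ι κ : Type*} [Fintype ι] [Fintype κ] [DecidableEq ι] [DecidableEq κ] {α β : ι → Type*}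
  [∀ i, Fintype (α i)] [∀ i, Fintype (β i)]

/-- The law of a family of independent random elements. -/
def pi (p : ∀ i, FinProb (α i)) : FinProb (∀ i, α i) where
  w x := ∏ i, (p i).w (x i)
  nonneg x := Finset.prod_nonneg fun i _ => (p i).nonneg _
  sum_one := by
    rw [← Fintype.prod_sum]
    simp [(p _).sum_one]

lemma E_pi_prod (p : ∀ i, FinProb (α i)) (f : ∀ i, α i → ℝ) :
    (pi p).E (fun x => ∏ i, f i (x i)) = ∏ i, (p i).E (f i) := by
  simp only [E, pi, ← Finset.prod_mul_distrib]
  rw [Fintype.prod_sum]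

/-- Maps of the components preserve independence. -/
lemma map_pi (p : ∀ i, FinProb (α i)) (f : ∀ i, α i → β i) :
    (pi p).map (fun x i => f i (x i)) = pi fun i => (p i).map (f i) := by
  ext y
  rw [w_eq_E, E_map]
  simp only [funext_iff, ind_forall]
  rw [E_pi_prod p fun i a => ind (f i a = y i)]
  change _ = ∏ i, ((p i).map (f i)).w (y i)
  exact Finset.prod_congr rfl fun i _ => by rw [w_eq_E, E_map]

lemma E_pi_eval (p : ∀ i, FinProb (α i)) (j : ι) (g : α j → ℝ) :
    (pi p).E (fun x => g (x j)) = (p j).E g := by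
  have : (pi p).map (fun x => x j) = p j := by
    ext a
    rw [w_eq_E, E_map]
    -- The implication from `i = j` carries the transport between dependent types and makes all
    -- factors other than the one at `j` equal to one, so the expectation factorizes.
    have h : ∀ x : ∀ i, α i, ind (x j = a) =
        ∏ i, (fun i (b : α i) => ind (∀ h : i = j, h ▸ b = a)) i (x i) := fun x => by
      rw [Finset.prod_eq_single j]
      · congr 1; simp
      · intro i _ hi
        exact ind_of fun h => absurd h hi
      · simp
    simp only [h]
    rw [E_pi_prod p fun i b => ind (∀ h : i = j, h ▸ b = a), Finset.prod_eq_single j]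
    · rw [w_eq_E]
      congr 1; funext b; congr 1; simp
    · intro i _ hi
      have : ∀ b : α i, ind (∀ h : i = j, h ▸ b = a) = 1 := fun b => ind_of fun h => absurd h hi
      simp [this]
    · simp
  rw [← this, E_map]

/-- Each user's codebook is an independent family, so reading it at one message gives a codeword
with its original law, independently over the users. -/
lemma E_pi_eval_pi {M : ι → Type*} [∀ i, Fintype (M i)] [∀ i, DecidableEq (M i)]
    (p : ∀ i, FinProb (α i)) (w : ∀ i, M i)
    (g : (∀ i, α i) → ℝ) :
    (pi fun i => pi fun _ : M i => p i).E (fun c => g fun i => c i (w i)) = (pi p).E g := by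
  have h := E_map (pi fun i => pi fun _ : M i => p i) (fun c i => c i (w i)) g
  rw [← h, map_pi (fun i => pi fun _ : M i => p i) fun i c => c (w i)]
  congr 2
  funext i
  refine ext_E fun f => ?_
  rw [E_map, E_pi_eval (fun _ : M i => p i)]

/-- Two stages of independent components are independent pairs. -/
lemma E_pi_compProd (p : ∀ i, FinProb (α i)) (κ : ∀ i, α i → FinProb (β i))
    (f : (∀ i, α i × β i) → ℝ) :
    (pi p).E (fun a => (pi fun i => κ i (a i)).E fun b => f fun i => (a i, b i)) =
      (pi fun i => (p i).compProd (κ i)).E f := by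
  let e : (∀ i, α i × β i) ≃ (∀ i, α i) × (∀ i, β i) :=
    ⟨fun x => (fun i => (x i).1, fun i => (x i).2), fun x i => (x.1 i, x.2 i),
      fun _ => rfl, fun _ => rfl⟩
  rw [E, E, ← e.symm.sum_comp, Fintype.sum_prod_type]
  refine Finset.sum_congr rfl fun a _ => ?_
  rw [E, Finset.mul_sum]
  refine Finset.sum_congr rfl fun b _ => ?_
  simp only [e, pi, compProd, Equiv.coe_fn_symm_mk, Finset.prod_mul_distrib, mul_assoc]

/-- Codebooks are indexed by user and then by time, the memoryless channel by time first; both are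
the same product of independent letters. -/
lemma E_pi_comm {γ : ι → κ → Type*} [∀ i t, Fintype (γ i t)] (p : ∀ i t, FinProb (γ i t))
    (f : (∀ t i, γ i t) → ℝ) :
    (pi fun i => pi fun t => p i t).E (fun x => f fun t i => x i t) =
      (pi fun t => pi fun i => p i t).E f := by
  rw [E, E, ← (Equiv.piComm γ).sum_comp]
  refine Finset.sum_congr rfl fun x _ => ?_
  simp only [pi, Equiv.piComm_apply]
  rw [Finset.prod_comm]
  rfl

end Pi

/-! ### Redrawing part of a random object -/

section Resampling

variable {Ω Ω' : Type*} [Fintype Ω] [Fintype Ω']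

/-- `r x x'` has law `P` when `x` and `x'` are independent with law `P`. -/
def IsResampling (P : FinProb Ω) (r : Ω → Ω → Ω) : Prop :=
  ∀ f : Ω → ℝ, P.E (fun x => P.E fun x' => f (r x x')) = P.E f

lemma isResampling_fst (P : FinProb Ω) : P.IsResampling fun x _ => x := fun f => by simp

lemma isResampling_snd (P : FinProb Ω) : P.IsResampling fun _ x' => x' := fun f => by simp

lemma isResampling_ite (P : FinProb Ω) (p : Prop) [Decidable p] :
    P.IsResampling fun x x' => if p then x' else x := by
  by_cases h : p
  · simpa [h] using P.isResampling_snd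
  · simpa [h] using P.isResampling_fst

lemma IsResampling.prod {P : FinProb Ω} {Q : FinProb Ω'} {r : Ω → Ω → Ω} {s : Ω' → Ω' → Ω'}
    (hr : P.IsResampling r) (hs : Q.IsResampling s) :
    (P.prod Q).IsResampling fun x x' => (r x.1 x'.1, s x.2 x'.2) := fun f => by
  simp only [E_compProd]
  have : ∀ a, (Q.E fun b => P.E fun a' => Q.E fun b' => f (r a a', s b b')) =
      P.E fun a' => Q.E fun b => f (r a a', b) := fun a => by
    rw [E_comm]
    congr 1; funext a'
    exact hs fun b => f (r a a', b)
  simp only [this]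
  exact hr fun a => Q.E fun b => f (a, b)

lemma IsResampling.pi {ι : Type*} [Fintype ι] [DecidableEq ι] {α : ι → Type*} [∀ i, Fintype (α i)]
    {p : ∀ i, FinProb (α i)} {r : ∀ i, α i → α i → α i} (h : ∀ i, (p i).IsResampling (r i)) :
    (FinProb.pi p).IsResampling fun x x' i => r i (x i) (x' i) := fun f => by
  have := E_pi_compProd p (fun i _ => p i) fun y => f fun i => r i (y i).1 (y i).2
  rw [this, ← E_map (FinProb.pi fun i => (p i).compProd fun _ => p i)
    (fun y i => r i (y i).1 (y i).2), map_pi (fun i => (p i).compProd fun _ => p i)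
    (fun i z => r i z.1 z.2)]
  congr 2
  funext i
  refine ext_E fun g => ?_
  rw [E_map, E_compProd]
  exact h i g

end Resampling

end FinProb

/-! ### Typical sequences and likelihood ratios -/

section Typicality

variable {Γ : Type*} [Fintype Γ] {n : ℕ}

lemma isTypical_iff {ε : ℝ} {p : Γ → ℝ} {s : Fin n → Γ} :
    IsTypical ε p s ↔ ∀ a, |∑ t, ind (s t = a) - n * p a| ≤ ε * (n * p a) := by
  simp [IsTypical, ind]

/-- The tolerance is proportional to `p a`, so a symbol of probability zero does not occur at all.
This keeps likelihood ratios positive along typical sequences. -/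
lemma IsTypical.ne_zero {ε : ℝ} {p : Γ → ℝ} {s : Fin n → Γ} (h : IsTypical ε p s) (t : Fin n) :
    p (s t) ≠ 0 := fun h0 => by
  have h1 := isTypical_iff.1 h (s t)
  rw [h0, mul_zero, mul_zero, sub_zero] at h1
  have h2 : (1 : ℝ) ≤ ∑ t', ind (s t' = s t) := by
    rw [← ind_of (rfl : s t = s t)]
    exact Finset.single_le_sum (f := fun t' => ind (s t' = s t)) (fun _ _ => ind_nonneg _)
      (Finset.mem_univ t)
  linarith [le_abs_self (∑ t', ind (s t' = s t))]

lemma sum_comp_eq_sum_count (s : Fin n → Γ) (f : Γ → ℝ) :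
    ∑ t, f (s t) = ∑ a, (∑ t, ind (s t = a)) * f a := by
  classical
  simp only [Finset.sum_mul]
  rw [Finset.sum_comm]
  simp [ind]

/-- Averages along a typical sequence are close to expectations. -/
lemma IsTypical.abs_sum_sub_le {ε : ℝ} {p : Γ → ℝ} {s : Fin n → Γ} (h : IsTypical ε p s)
    (f : Γ → ℝ) : |∑ t, f (s t) - n * ∑ a, p a * f a| ≤ ε * (n * ∑ a, p a * |f a|) := by
  rw [sum_comp_eq_sum_count, Finset.mul_sum, ← Finset.sum_sub_distrib, Finset.mul_sum,
    Finset.mul_sum]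
  refine (Finset.abs_sum_le_sum_abs _ _).trans (Finset.sum_le_sum fun a _ => ?_)
  have := mul_le_mul_of_nonneg_right (isTypical_iff.1 h a) (abs_nonneg (f a))
  rw [← abs_mul] at this
  calc _ = |(∑ t, ind (s t = a) - n * p a) * f a| := by congr 1; ring
    _ ≤ _ := this
    _ = _ := by ring

/-- Products along a typical sequence. -/
lemma IsTypical.prod_eq_rpow {ε : ℝ} {p : Γ → ℝ} {s : Fin n → Γ} (h : IsTypical ε p s)
    {g : Γ → ℝ} (hg : ∀ γ, p γ ≠ 0 → 0 < g γ) :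
    ∏ t, g (s t) = (2 : ℝ) ^ (∑ t, Real.logb 2 (g (s t))) := by
  rw [Real.rpow_sum_of_pos two_pos]
  exact Finset.prod_congr rfl fun t _ =>
    (Real.rpow_logb two_pos (by norm_num) (hg _ (h.ne_zero t))).symm

/-- A sequence of independent fresh letters is unlikely to look jointly typical with given side
information. -/
lemma E_typical_le {A : Type*} [Fintype A] (q : FinProb A) (p g : Γ → ℝ) (ε : ℝ)
    (φ : Fin n → A → Γ) (hg0 : ∀ γ, 0 ≤ g γ) (hg : ∀ γ, p γ ≠ 0 → 0 < g γ)
    (hE : ∀ t, q.E (fun a => g (φ t a)) ≤ 1) :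
    (FinProb.pi fun _ : Fin n => q).E (fun a => ind (IsTypical ε p fun t => φ t (a t))) ≤
      (2 : ℝ) ^ (-(n * (∑ γ, p γ * Real.logb 2 (g γ) - ε * ∑ γ, p γ * |Real.logb 2 (g γ)|))) := by
  set K := n * (∑ γ, p γ * Real.logb 2 (g γ) - ε * ∑ γ, p γ * |Real.logb 2 (g γ)|) with hK
  -- On typical sequences the product of the `g` is at least `2 ^ K`. Hence the indicator is
  -- dominated by a multiple of this product, whose expectation factorizes over time.
  have h1 : ∀ a : Fin n → A, ind (IsTypical ε p fun t => φ t (a t)) ≤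
      2 ^ (-K) * ∏ t, g (φ t (a t)) := fun a => by
    refine ind_le_of (mul_nonneg (by positivity) (Finset.prod_nonneg fun t _ => hg0 _))
      fun h => ?_
    rw [h.prod_eq_rpow hg, ← Real.rpow_add two_pos]
    refine Real.one_le_rpow one_le_two ?_
    have := (abs_le.1 (h.abs_sum_sub_le fun γ => Real.logb 2 (g γ))).1
    rw [hK]
    linarith
  refine (FinProb.E_mono _ h1).trans ?_
  rw [FinProb.E_const_mul, FinProb.E_pi_prod (fun _ => q) fun t a => g (φ t a)]
  refine mul_le_of_le_one_right (by positivity) (Finset.prod_le_one (fun t _ => ?_) fun t _ => hE t)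
  exact FinProb.E_nonneg _ fun a => hg0 _

/-- Change of measure on typical sequences. -/
lemma E_typical_le_mul {A : Type*} [Fintype A] (q : FinProb A) (κ : Fin n → FinProb A)
    (p g : Γ → ℝ) (ε : ℝ) (φ : Fin n → A → Γ) (hg : ∀ γ, p γ ≠ 0 → 0 < g γ)
    (hκ : ∀ t a, p (φ t a) ≠ 0 → (κ t).w a = g (φ t a) * q.w a) :
    (FinProb.pi κ).E (fun a => ind (IsTypical ε p fun t => φ t (a t))) ≤
      (2 : ℝ) ^ (n * (∑ γ, p γ * Real.logb 2 (g γ) + ε * ∑ γ, p γ * |Real.logb 2 (g γ)|)) *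
        (FinProb.pi fun _ : Fin n => q).E
          (fun a => ind (IsTypical ε p fun t => φ t (a t))) := by
  rw [FinProb.E, FinProb.E, Finset.mul_sum]
  refine Finset.sum_le_sum fun a _ => ?_
  by_cases h : IsTypical ε p fun t => φ t (a t)
  · simp only [ind_of h, mul_one, FinProb.pi]
    -- Only letters of positive probability occur in a typical sequence, so `hκ` applies at every
    -- time.
    have h1 : ∏ t, (κ t).w (a t) = (∏ t, g (φ t (a t))) * ∏ t, q.w (a t) := by
      rw [← Finset.prod_mul_distrib]
      exact Finset.prod_congr rfl fun t _ => hκ t _ (h.ne_zero t)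
    rw [h1, h.prod_eq_rpow hg]
    refine mul_le_mul_of_nonneg_right ?_ (Finset.prod_nonneg fun t _ => q.nonneg _)
    refine Real.rpow_le_rpow_of_exponent_le one_le_two ?_
    have := (abs_le.1 (h.abs_sum_sub_le fun γ => Real.logb 2 (g γ))).2
    linarith
  · simp [ind_of_not h]

end Typicality

/-! ### Chebyshev's inequality for letter counts -/

section Concentration

variable {Γ : Type*} [Fintype Γ]

/-- The product of the two functions is a product over all coordinates, with factor one away from
`s` and `t`. -/
lemma FinProb.E_pi_mul {ι : Type*} [Fintype ι] [DecidableEq ι] (ν : ι → FinProb Γ) (f g : Γ → ℝ)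
    {s t : ι} (h : s ≠ t) :
    (pi ν).E (fun x => f (x s) * g (x t)) = (ν s).E f * (ν t).E g := by
  have h1 : ∀ x : ι → Γ, f (x s) * g (x t) =
      ∏ i, ((if i = s then f (x i) else 1) * if i = t then g (x i) else 1) := fun x => by
    rw [Finset.prod_mul_distrib]
    simp
  have h2 : ∀ i, (ν i).E (fun a => (if i = s then f a else 1) * if i = t then g a else 1) =
      (if i = s then (ν i).E f else 1) * if i = t then (ν i).E g else 1 := fun i => by
    by_cases hs : i = s
    · simp [hs, h]
    · by_cases ht : i = t
      · simp [ht, h.symm]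
      · simp [hs, ht]
  simp only [h1]
  rw [E_pi_prod ν fun i a => (if i = s then f a else 1) * if i = t then g a else 1]
  simp only [h2]
  rw [Finset.prod_mul_distrib]
  simp

lemma FinProb.E_pi_sum_sq {ι : Type*} [Fintype ι] [DecidableEq ι] (ν : ι → FinProb Γ)
    (Z : ι → Γ → ℝ) (hZ : ∀ i, (ν i).E (Z i) = 0) :
    (pi ν).E (fun x => (∑ i, Z i (x i)) ^ 2) = ∑ i, (ν i).E fun a => Z i a ^ 2 := by
  simp only [sq, Finset.sum_mul_sum]
  rw [E_sum]
  refine Finset.sum_congr rfl fun s _ => ?_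
  rw [E_sum, Finset.sum_eq_single s]
  · exact E_pi_eval ν s fun a => Z s a * Z s a
  · intro t _ hts
    rw [E_pi_mul ν (Z s) (Z t) hts.symm, hZ, zero_mul]
  · simp

/-- Variances of independent indicators add up, and each is at most the corresponding mean. -/
lemma FinProb.E_count_sub_sq_le {ι : Type*} [Fintype ι] [DecidableEq ι] (ν : ι → FinProb Γ)
    (γ : Γ) :
    (pi ν).E (fun x => (∑ i, ind (x i = γ) - ∑ i, (ν i).w γ) ^ 2) ≤ ∑ i, (ν i).w γ := by
  simp only [← Finset.sum_sub_distrib]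
  have h0 : ∀ i, (ν i).E (fun a => ind (a = γ)) = (ν i).w γ := fun i => ((ν i).w_eq_E γ).symm
  have h1 : ∀ i c, (ν i).E (fun a => ind (a = γ) + c) = (ν i).w γ + c := fun i c => by
    rw [E_add, h0, E_const]
  rw [E_pi_sum_sq ν (fun i a => ind (a = γ) - (ν i).w γ) fun i => by
    simp only [sub_eq_add_neg, h1, add_neg_cancel]]
  refine Finset.sum_le_sum fun i _ => ?_
  have h2 : ∀ a, (ind (a = γ) - (ν i).w γ) ^ 2 =
      (1 - 2 * (ν i).w γ) * ind (a = γ) + (ν i).w γ ^ 2 := fun a => by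
    by_cases h : a = γ
    · rw [ind_of h]; ring
    · rw [ind_of_not h]; ring
  simp only [h2]
  rw [E_add, E_const_mul, h0, E_const]
  nlinarith [sq_nonneg ((ν i).w γ)]

/-- Independent letters whose expected counts are close to those of `p` form a typical sequence
with high probability. -/
lemma E_not_typical_le {n : ℕ} (hn : 0 < n) (ν : Fin n → FinProb Γ) {p : Γ → ℝ}
    (hp : ∀ γ, 0 ≤ p γ) {ε' ε : ℝ} (h1 : ε' ≤ 1) (hε : ε' < ε)
    (hν : ∀ γ, |∑ t, (ν t).w γ - n * p γ| ≤ ε' * (n * p γ)) :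
    (FinProb.pi ν).E (fun x => ind (¬IsTypical ε p x)) ≤
      (∑ γ, 2 / ((ε - ε') ^ 2 * p γ)) / n := by
  have hn' : (0 : ℝ) < n := by exact_mod_cast hn
  have key : ∀ γ, (FinProb.pi ν).E
      (fun x => ind (¬|∑ t, ind (x t = γ) - n * p γ| ≤ ε * (n * p γ))) ≤
        2 / ((ε - ε') ^ 2 * p γ) / n := fun γ => by
    have hμ := abs_le.1 (hν γ)
    rcases (hp γ).eq_or_lt with h0 | h0
    -- A symbol with `p γ = 0` has expected count zero by `hν`, so it almost surely does not occur;
    -- its term in the bound is zero by the convention for division by zero.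
    · rw [← h0] at hμ ⊢
      simp only [mul_zero, sub_zero, div_zero, zero_div, neg_zero] at hμ ⊢
      have hle : ∀ x : Fin n → Γ, ind (¬|∑ t, ind (x t = γ)| ≤ 0) ≤ ∑ t, ind (x t = γ) :=
        fun x => by
          refine ind_le_of (Finset.sum_nonneg fun _ _ => ind_nonneg _) fun h => ?_
          have : ∃ t, x t = γ := by
            by_contra! hx
            exact h (by simp [ind_of_not (hx _)])
          obtain ⟨t, ht⟩ := this
          rw [← ind_of ht]
          exact Finset.single_le_sum (f := fun t => ind (x t = γ)) (fun _ _ => ind_nonneg _)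
            (Finset.mem_univ t)
      refine (FinProb.E_mono _ hle).trans ?_
      rw [FinProb.E_sum]
      refine le_of_eq_of_le (Finset.sum_congr rfl fun t _ => ?_) hμ.2
      rw [FinProb.E_pi_eval ν t fun a => ind (a = γ), FinProb.w_eq_E]
    · have hd : 0 < (ε - ε') * (n * p γ) := by
        have := sub_pos.2 hε
        positivity
      have hle : ∀ x : Fin n → Γ, ind (¬|∑ t, ind (x t = γ) - n * p γ| ≤ ε * (n * p γ)) ≤
          (((ε - ε') * (n * p γ)) ^ 2)⁻¹ * (∑ t, ind (x t = γ) - ∑ t, (ν t).w γ) ^ 2 :=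
        fun x => by
          refine ind_le_of (by positivity) fun h => ?_
          -- The mean count is within `ε' n p γ` of `n p γ`, so an atypical count deviates from its
          -- mean by at least `(ε - ε') n p γ`.
          rw [inv_mul_eq_div, one_le_div (by positivity), sq_le_sq, abs_of_pos hd]
          have := abs_sub_abs_le_abs_sub (∑ t, ind (x t = γ) - n * p γ)
            (∑ t, (ν t).w γ - n * p γ)
          have h3 := hν γ
          rw [sub_sub_sub_cancel_right] at this
          push Not at h
          linarith
      refine (FinProb.E_mono _ hle).trans ?_
      rw [FinProb.E_const_mul]
      have h2 := FinProb.E_count_sub_sq_le ν γ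
      -- The factor two comes from `1 + ε' ≤ 2`.
      have h3 : ∑ t, (ν t).w γ ≤ 2 * (n * p γ) := by
        have : ε' * (n * p γ) ≤ 1 * (n * p γ) := mul_le_mul_of_nonneg_right h1 (by positivity)
        linarith [hμ.2]
      calc _ ≤ (((ε - ε') * (n * p γ)) ^ 2)⁻¹ * (2 * (n * p γ)) :=
            mul_le_mul_of_nonneg_left (h2.trans h3) (by positivity)
        _ = _ := by
          have := (sub_pos.2 hε).ne'
          field_simp
  have hle : ∀ x : Fin n → Γ, ind (¬IsTypical ε p x) ≤
      ∑ γ, ind (¬|∑ t, ind (x t = γ) - n * p γ| ≤ ε * (n * p γ)) := fun x => by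
    refine ind_le_of (Finset.sum_nonneg fun _ _ => ind_nonneg _) fun h => ?_
    rw [isTypical_iff] at h
    push Not at h
    obtain ⟨γ, hγ⟩ := h
    rw [← ind_of (not_le.2 hγ)]
    exact Finset.single_le_sum
      (f := fun γ => ind (¬|∑ t, ind (x t = γ) - n * p γ| ≤ ε * (n * p γ)))
      (fun _ _ => ind_nonneg _) (Finset.mem_univ γ)
  refine (FinProb.E_mono _ hle).trans ?_
  rw [FinProb.E_sum, Finset.sum_div]
  exact Finset.sum_le_sum fun γ _ => key γ

end Concentration

/-! ### The relay's random choice of an index -/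

section Selection

variable {U : Type*} [Fintype U]

open Classical in
/-- The uniform distribution on a nonempty finite set. -/
def FinProb.uniformOn (s : Finset U) (hs : s.Nonempty) : FinProb U where
  w u := if u ∈ s then (s.card : ℝ)⁻¹ else 0
  nonneg u := by split_ifs <;> positivity
  sum_one := by
    have := hs.card_pos.ne'
    simp [this]

variable [Nonempty U]

open Classical in
/-- Uniform choice among the elements that satisfy `G`, and among all elements if there are
none. -/
def select (G : U → Prop) : FinProb U :=
  if h : (Finset.univ.filter G).Nonempty then FinProb.uniformOn _ h
  else FinProb.uniformOn Finset.univ Finset.univ_nonempty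

lemma select_eq_zero {G : U → Prop} {u : U} (hu : ¬G u) (h : ∃ v, G v) : (select G).w u = 0 := by
  classical
  obtain ⟨v, hv⟩ := h
  have : (Finset.univ.filter G).Nonempty := ⟨v, by simpa⟩
  rw [select, dif_pos this]
  simp [FinProb.uniformOn, hu]

/-- The choice of `u` is dominated by a choice that ignores the index `u'`. -/
lemma select_le {G G' : U → Prop} {u u' : U} (h : u ≠ u') (hG : ∀ v, G' v ↔ G v ∧ v ≠ u') :
    (select G).w u ≤ (select G').w u := by
  classical
  have hsub : Finset.univ.filter G' ⊆ Finset.univ.filter G :=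
    Finset.monotone_filter_right _ fun v _ hv => ((hG v).1 hv).1
  -- If `u` is a candidate, dropping `u'` shrinks the candidate set and raises the weight of `u`. If
  -- only other indices are candidates, `u` has weight zero under `G`. If there are none, both
  -- choices are uniform over all indices.
  by_cases h1 : (Finset.univ.filter G).Nonempty
  · by_cases hu : G u
    · have hu' : G' u := (hG u).2 ⟨hu, h⟩
      have h2 : (Finset.univ.filter G').Nonempty := ⟨u, by simp [hu']⟩
      rw [select, select, dif_pos h1, dif_pos h2]
      simp only [FinProb.uniformOn, Finset.mem_filter, Finset.mem_univ, true_and, hu, hu', if_true]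
      exact inv_anti₀ (by exact_mod_cast h2.card_pos) (by exact_mod_cast Finset.card_le_card hsub)
    · obtain ⟨v, hv⟩ := h1
      rw [select_eq_zero hu ⟨v, by simpa using hv⟩]
      exact FinProb.nonneg _ _
  · have h2 : ¬(Finset.univ.filter G').Nonempty := fun h2 => h1 (h2.mono hsub)
    rw [select, select, dif_neg h1, dif_neg h2]

end Selection

/-! ### Random codebooks -/

section Codebook

variable {ι : Type*} [Fintype ι] [DecidableEq ι] {Msg : ι → Type*} [∀ i, Fintype (Msg i)]
  [∀ i, DecidableEq (Msg i)] {U : Type*} [Fintype U] [DecidableEq U]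
  {C : ι → Type*} [∀ i, Fintype (C i)] {Q : Type*} [Fintype Q]

/-- Source codewords and relay codewords for one slot. -/
abbrev Book (Msg : ι → Type*) (U : Type*) (C : ι → Type*) (Q : Type*) :=
  (∀ i, Msg i → C i) × (U → Q)

/-- All codewords are drawn independently. -/
def bookLaw (Msg : ι → Type*) [∀ i, Fintype (Msg i)] [∀ i, DecidableEq (Msg i)] (U : Type*)
    [Fintype U] [DecidableEq U] (P : ∀ i, FinProb (C i)) (PQ : FinProb Q) :
    FinProb (Book Msg U C Q) :=
  (FinProb.pi fun i => FinProb.pi fun _ : Msg i => P i).prod (FinProb.pi fun _ : U => PQ)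

/-- The codewords of the message tuple `w`. -/
def Book.word (b : Book Msg U C Q) (w : ∀ i, Msg i) : ∀ i, C i := fun i => b.1 i (w i)

/-- The users on which two message tuples differ. -/
def diff (w v : ∀ i, Msg i) : Finset ι := Finset.univ.filter fun i => v i ≠ w i

open Classical in
/-- Replace the codewords of `v` that are not codewords of `w`, and the relay codewords with
index in `B`, by those of another codebook. -/
def refresh (w v : ∀ i, Msg i) (B : U → Prop) (b b' : Book Msg U C Q) : Book Msg U C Q :=
  (fun i x => if x = v i ∧ v i ≠ w i then b'.1 i x else b.1 i x,
    fun u => if B u then b'.2 u else b.2 u)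

lemma isResampling_refresh (P : ∀ i, FinProb (C i)) (PQ : FinProb Q) (w v : ∀ i, Msg i)
    (B : U → Prop) : (bookLaw Msg U P PQ).IsResampling (refresh w v B) := by
  classical
  have h1 : ∀ i, (FinProb.pi fun _ : Msg i => P i).IsResampling
      fun c c' x => if x = v i ∧ v i ≠ w i then c' x else c x := fun i =>
    FinProb.IsResampling.pi (p := fun _ : Msg i => P i)
      (r := fun x a a' => if x = v i ∧ v i ≠ w i then a' else a)
      fun x => (P i).isResampling_ite (x = v i ∧ v i ≠ w i)
  have h2 : (FinProb.pi fun _ : U => PQ).IsResampling fun q q' u => if B u then q' u else q u :=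
    FinProb.IsResampling.pi (p := fun _ : U => PQ)
      (r := fun u a a' => if B u then a' else a) fun u => PQ.isResampling_ite (B u)
  have h3 := (FinProb.IsResampling.pi h1).prod h2
  intro f
  rw [bookLaw, ← h3 f]
  rfl

lemma word_refresh_self (w v : ∀ i, Msg i) (B : U → Prop) (b b' : Book Msg U C Q) :
    (refresh w v B b b').word w = b.word w := by
  funext i
  simp only [refresh, Book.word]
  exact if_neg fun h => h.2 h.1.symm

lemma word_refresh (w v : ∀ i, Msg i) (B : U → Prop) (b b' : Book Msg U C Q) :
    (refresh w v B b b').word v = (diff w v).piecewise (b'.word v) (b.word w) := by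
  funext i
  by_cases h : v i = w i <;> simp [refresh, Book.word, Finset.piecewise, diff, h]

lemma refresh_false_snd (w v : ∀ i, Msg i) (b b' : Book Msg U C Q) :
    (refresh w v (fun _ => False) b b').2 = b.2 := by
  funext u
  simp [refresh]

lemma E_bookLaw_word (P : ∀ i, FinProb (C i)) (PQ : FinProb Q) (w : ∀ i, Msg i)
    (f : (∀ i, C i) → (U → Q) → ℝ) :
    (bookLaw Msg U P PQ).E (fun b => f (b.word w) b.2) =
      (FinProb.pi P).E fun c => (FinProb.pi fun _ : U => PQ).E fun q => f c q := by
  rw [bookLaw, FinProb.E_compProd]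
  exact FinProb.E_pi_eval_pi P w fun c => (FinProb.pi fun _ : U => PQ).E fun q => f c q

lemma E_bookLaw_word_relay (P : ∀ i, FinProb (C i)) (PQ : FinProb Q) (w : ∀ i, Msg i) (u : U)
    (f : (∀ i, C i) → Q → ℝ) :
    (bookLaw Msg U P PQ).E (fun b => f (b.word w) (b.2 u)) =
      (FinProb.pi P).E fun c => PQ.E fun q => f c q := by
  rw [E_bookLaw_word P PQ w fun c q => f c (q u)]
  congr 1; funext c
  exact FinProb.E_pi_eval (fun _ : U => PQ) u (f c)

/-- The number of message tuples that differ from `w` exactly on `I` is at most the number of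
messages of the users in `I`. -/
lemma sum_diff_le (w : ∀ i, Msg i) (F : Finset ι → ℝ) (hF : ∀ I, 0 ≤ F I) :
    ∑ v ∈ Finset.univ.erase w, F (diff w v) ≤
      ∑ I ∈ Finset.univ.erase ∅, (∏ i ∈ I, (Fintype.card (Msg i) : ℝ)) * F I := by
  rw [← Finset.sum_fiberwise_of_maps_to (s := Finset.univ.erase w)
    (t := Finset.univ.erase (∅ : Finset ι)) (g := diff w) (f := fun v => F (diff w v))]
  · refine Finset.sum_le_sum fun I _ => ?_
    rw [Finset.sum_congr rfl fun v hv => by rw [(Finset.mem_filter.1 hv).2], Finset.sum_const,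
      nsmul_eq_mul]
    refine mul_le_mul_of_nonneg_right ?_ (hF I)
    -- Such a tuple is free on `I` and agrees with `w` off `I`, so it lies in a box whose size is
    -- the required product.
    have h1 : (Finset.univ.erase w).filter (fun v => diff w v = I) ⊆
        Fintype.piFinset fun i => if i ∈ I then Finset.univ else {w i} := fun v hv => by
      rw [Fintype.mem_piFinset]
      intro i
      have h := (Finset.mem_filter.1 hv).2
      by_cases hi : i ∈ I
      · simp [hi]
      · rw [if_neg hi, Finset.mem_singleton]
        by_contra hne
        exact hi (h ▸ by simp [diff, hne])
    have h2 := Finset.card_le_card h1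
    rw [Fintype.card_piFinset] at h2
    have h3 : ∀ i, (if i ∈ I then (Finset.univ : Finset (Msg i)) else {w i}).card =
        if i ∈ I then Fintype.card (Msg i) else 1 := fun i => by
      split_ifs <;> simp
    simp only [h3] at h2
    rw [Finset.prod_ite_mem, Finset.univ_inter] at h2
    exact_mod_cast h2
  · intro v hv
    simp only [Finset.mem_erase, Finset.mem_univ, and_true] at hv ⊢
    contrapose! hv
    funext i
    by_contra hne
    have : i ∈ diff w v := by simp [diff, hne]
    simp [hv] at this

end Codebook

/-! ### Averaging over the codebook for fixed messages -/

section Scheme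

/-- The dominating law `Θ' b` of the outcome does not involve the fresh copy `b'`. Hence `b'` can be
averaged first, with `b` and the outcome `ζ` fixed, and only a bound for fresh codewords against
arbitrary side information is needed. -/
lemma FinProb.E_E_le_of_resampling {Ω Z : Type*} [Fintype Ω] [Fintype Z] (P : FinProb Ω)
    {r : Ω → Ω → Ω} (hr : P.IsResampling r) (Θ Θ' : Ω → FinProb Z) (Φ : Ω → Z → ℝ)
    (Ψ : Ω → Ω → Z → ℝ) (B : ℝ)
    (h : ∀ b b' ζ, (Θ (r b b')).w ζ * Φ (r b b') ζ ≤ (Θ' b).w ζ * Ψ b b' ζ)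
    (hB : ∀ b ζ, P.E (fun b' => Ψ b b' ζ) ≤ B) :
    P.E (fun b => (Θ b).E (Φ b)) ≤ B := by
  rw [← hr]
  calc _ ≤ P.E fun b => P.E fun b' => (Θ' b).E (Ψ b b') :=
        P.E_mono fun b => P.E_mono fun b' => Finset.sum_le_sum fun ζ _ => h b b' ζ
    _ = P.E fun b => (Θ' b).E fun ζ => P.E fun b' => Ψ b b' ζ := by simp only [E_comm P (Θ' _)]
    _ ≤ B := P.E_le_const fun b => (Θ' b).E_le_const (hB b)

variable {ι : Type*} [Fintype ι] [DecidableEq ι] {Msg : ι → Type*} [∀ i, Fintype (Msg i)]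
  [∀ i, DecidableEq (Msg i)] {U : Type*} [Fintype U] [DecidableEq U] [Nonempty U]
  {C1 C2 : ι → Type*} [∀ i, Fintype (C1 i)] [∀ i, Fintype (C2 i)] {Q1 Q2 Z1 Z2 : Type*}
  [Fintype Q1] [Fintype Q2] [Fintype Z1] [Fintype Z2]

/-- The outputs of the two slots and the relay index, for the messages `w`: the relay selects an
index `u` such that `G z (q u)`, where `z` is the output of slot one and `q u` its codeword. -/
def run (V : (∀ i, C1 i) → FinProb Z1) (G : Z1 → Q1 → Prop) (W : (∀ i, C2 i) → Q2 → FinProb Z2)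
    (w : ∀ i, Msg i) (b : Book Msg U C1 Q1 × Book Msg U C2 Q2) : FinProb (Z1 × U × Z2) :=
  (V (b.1.word w)).compProd fun z => (select fun u => G z (b.1.2 u)).compProd fun u =>
    W (b.2.word w) (b.2.2 u)

lemma E_run (V : (∀ i, C1 i) → FinProb Z1) (G : Z1 → Q1 → Prop)
    (W : (∀ i, C2 i) → Q2 → FinProb Z2) (w : ∀ i, Msg i)
    (b : Book Msg U C1 Q1 × Book Msg U C2 Q2) (f : Z1 → U → Z2 → ℝ) :
    (run V G W w b).E (fun ζ => f ζ.1 ζ.2.1 ζ.2.2) =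
      (V (b.1.word w)).E fun z => (select fun u => G z (b.1.2 u)).E fun u =>
        (W (b.2.word w) (b.2.2 u)).E fun z2 => f z u z2 := by
  simp only [run, FinProb.E_compProd]

variable (P1 : ∀ i, FinProb (C1 i)) (P2 : ∀ i, FinProb (C2 i)) (PQ : FinProb Q1)
  (PR : FinProb Q2) (V : (∀ i, C1 i) → FinProb Z1) (G : Z1 → Q1 → Prop)
  (W : (∀ i, C2 i) → Q2 → FinProb Z2) (w v : ∀ i, Msg i)
  (T1 : (∀ i, C1 i) → Z1 → Q1 → Prop) (T2 : (∀ i, C2 i) → Z2 → Q2 → Prop)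

/-- Wrong messages with the index chosen by the relay. -/
lemma E_wrong_messages_le {A1 A2 : ℝ} (hA1 : 0 ≤ A1)
    (h1 : ∀ c z q, (FinProb.pi P1).E (fun c' => ind (T1 ((diff w v).piecewise c' c) z q)) ≤ A1)
    (h2 : ∀ c z q, (FinProb.pi P2).E (fun c' => ind (T2 ((diff w v).piecewise c' c) z q)) ≤ A2) :
    ((bookLaw Msg U P1 PQ).prod (bookLaw Msg U P2 PR)).E (fun b => (run V G W w b).E fun ζ =>
      ind (T1 (b.1.word v) ζ.1 (b.1.2 ζ.2.1)) * ind (T2 (b.2.word v) ζ.2.2 (b.2.2 ζ.2.1))) ≤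
      A1 * A2 := by
  -- Only codewords of `v` that are not codewords of `w` are redrawn. The run does not use them, so
  -- its law is unchanged and serves as its own dominating law.
  refine FinProb.E_E_le_of_resampling _
    ((isResampling_refresh P1 PQ w v fun _ => False).prod
      (isResampling_refresh P2 PR w v fun _ => False)) (run V G W w) (run V G W w) _
    (fun b b' ζ =>
      ind (T1 ((diff w v).piecewise (b'.1.word v) (b.1.word w)) ζ.1 (b.1.2 ζ.2.1)) *
      ind (T2 ((diff w v).piecewise (b'.2.word v) (b.2.word w)) ζ.2.2 (b.2.2 ζ.2.1)))
    _ (fun b b' ζ => ?_) fun b ζ => ?_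
  · simp only [run, word_refresh_self, word_refresh, refresh_false_snd, le_refl]
  · rw [FinProb.E_prod_mul (bookLaw Msg U P1 PQ) (bookLaw Msg U P2 PR)
      (fun x => ind (T1 ((diff w v).piecewise (x.word v) (b.1.word w)) ζ.1 (b.1.2 ζ.2.1)))
      (fun x => ind (T2 ((diff w v).piecewise (x.word v) (b.2.word w)) ζ.2.2 (b.2.2 ζ.2.1))),
      E_bookLaw_word P1 PQ v fun c _ =>
        ind (T1 ((diff w v).piecewise c (b.1.word w)) ζ.1 (b.1.2 ζ.2.1)),
      E_bookLaw_word P2 PR v fun c _ =>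
        ind (T2 ((diff w v).piecewise c (b.2.word w)) ζ.2.2 (b.2.2 ζ.2.1))]
    simp only [FinProb.E_const]
    exact mul_le_mul (h1 _ _ _) (h2 _ _ _) (FinProb.E_nonneg _ fun _ => ind_nonneg _) hA1

/-- Wrong messages with an index `u'` that the relay has not chosen. -/
lemma E_wrong_messages_index_le {B1 B2 : ℝ} (hB1 : 0 ≤ B1) (u' : U)
    (h1 : ∀ c z, (FinProb.pi P1).E (fun c' => PQ.E fun q =>
      ind (T1 ((diff w v).piecewise c' c) z q)) ≤ B1)
    (h2 : ∀ c z, (FinProb.pi P2).E (fun c' => PR.E fun q =>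
      ind (T2 ((diff w v).piecewise c' c) z q)) ≤ B2) :
    ((bookLaw Msg U P1 PQ).prod (bookLaw Msg U P2 PR)).E (fun b => (run V G W w b).E fun ζ =>
      ind (ζ.2.1 ≠ u') *
        (ind (T1 (b.1.word v) ζ.1 (b.1.2 u')) * ind (T2 (b.2.word v) ζ.2.2 (b.2.2 u')))) ≤
      B1 * B2 := by
  -- Both codewords with index `u'` are redrawn as well. The dominating law selects among indices
  -- other than `u'`, so it is unaffected by the redrawing. Its fallback may pick `u'`, which does
  -- no harm because the indicator of `ζ.2.1 ≠ u'` vanishes there.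
  refine FinProb.E_E_le_of_resampling _
    ((isResampling_refresh P1 PQ w v fun u => u = u').prod
      (isResampling_refresh P2 PR w v fun u => u = u')) (run V G W w)
    (fun b => (V (b.1.word w)).compProd fun z =>
      (select fun u => G z (b.1.2 u) ∧ u ≠ u').compProd fun u => W (b.2.word w) (b.2.2 u)) _
    (fun b b' ζ =>
      ind (T1 ((diff w v).piecewise (b'.1.word v) (b.1.word w)) ζ.1 (b'.1.2 u')) *
      ind (T2 ((diff w v).piecewise (b'.2.word v) (b.2.word w)) ζ.2.2 (b'.2.2 u')))
    _ (fun b b' ζ => ?_) fun b ζ => ?_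
  · by_cases hu : ζ.2.1 = u'
    · rw [ind_of_not (not_not.2 hu), zero_mul, mul_zero]
      exact mul_nonneg (FinProb.nonneg _ _) (mul_nonneg (ind_nonneg _) (ind_nonneg _))
    · rw [ind_of hu, one_mul]
      have e1 : (refresh w v (fun u => u = u') b.1 b'.1).2 u' = b'.1.2 u' := by simp [refresh]
      have e2 : (refresh w v (fun u => u = u') b.2 b'.2).2 u' = b'.2.2 u' := by simp [refresh]
      have e3 : (refresh w v (fun u => u = u') b.2 b'.2).2 ζ.2.1 = b.2.2 ζ.2.1 := by
        simp [refresh, hu]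
      have e4 : (select fun u => G ζ.1 ((refresh w v (fun u => u = u') b.1 b'.1).2 u)).w ζ.2.1 ≤
          (select fun u => G ζ.1 (b.1.2 u) ∧ u ≠ u').w ζ.2.1 := by
        refine select_le hu fun u => ?_
        by_cases h : u = u' <;> simp [refresh, h]
      simp only [run, FinProb.compProd, word_refresh_self, word_refresh, e1, e2, e3]
      refine mul_le_mul_of_nonneg_right ?_ (mul_nonneg (ind_nonneg _) (ind_nonneg _))
      exact mul_le_mul_of_nonneg_left
        (mul_le_mul_of_nonneg_right e4 (FinProb.nonneg _ _)) (FinProb.nonneg _ _)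
  · rw [FinProb.E_prod_mul (bookLaw Msg U P1 PQ) (bookLaw Msg U P2 PR)
      (fun x => ind (T1 ((diff w v).piecewise (x.word v) (b.1.word w)) ζ.1 (x.2 u')))
      (fun x => ind (T2 ((diff w v).piecewise (x.word v) (b.2.word w)) ζ.2.2 (x.2 u'))),
      E_bookLaw_word_relay P1 PQ v u' fun c q =>
        ind (T1 ((diff w v).piecewise c (b.1.word w)) ζ.1 q),
      E_bookLaw_word_relay P2 PR v u' fun c q =>
        ind (T2 ((diff w v).piecewise c (b.2.word w)) ζ.2.2 q)]
    exact mul_le_mul (h1 _ _) (h2 _ _)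
      (FinProb.E_nonneg _ fun _ => FinProb.E_nonneg _ fun _ => ind_nonneg _) hB1

/-- The event concerns slot one and the chosen index only, so the slot-two codebook and outputs
integrate out. -/
lemma E_true_slot1 :
    ((bookLaw Msg U P1 PQ).prod (bookLaw Msg U P2 PR)).E (fun b => (run V G W w b).E fun ζ =>
      ind (¬T1 (b.1.word w) ζ.1 (b.1.2 ζ.2.1))) =
    (FinProb.pi P1).E fun c => (FinProb.pi fun _ : U => PQ).E fun q => (V c).E fun z =>
      (select fun u => G z (q u)).E fun u => ind (¬T1 c z (q u)) := by
  rw [FinProb.E_compProd]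
  simp only [run, FinProb.E_compProd, FinProb.E_const]
  exact E_bookLaw_word P1 PQ w fun c q => (V c).E fun z =>
      (select fun u => G z (q u)).E fun u => ind (¬T1 c z (q u))

/-- The index is determined by slot one and the relay's randomness, independently of the slot-two
codebook. For each index the relay codeword has law `PR`, so the selection law drops out. -/
lemma E_true_slot2 :
    ((bookLaw Msg U P1 PQ).prod (bookLaw Msg U P2 PR)).E (fun b => (run V G W w b).E fun ζ =>
      ind (¬T2 (b.2.word w) ζ.2.2 (b.2.2 ζ.2.1))) =
    (FinProb.pi P2).E fun c => PR.E fun r => (W c r).E fun z => ind (¬T2 c z r) := by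
  rw [FinProb.E_compProd]
  simp only [run, FinProb.E_compProd]
  have h : ∀ b1 : Book Msg U C1 Q1, ((bookLaw Msg U P2 PR).E fun b2 =>
      (V (b1.word w)).E fun z => (select fun u => G z (b1.2 u)).E fun u =>
        (W (b2.word w) (b2.2 u)).E fun z2 => ind (¬T2 (b2.word w) z2 (b2.2 u))) =
      (FinProb.pi P2).E fun c => PR.E fun r => (W c r).E fun z => ind (¬T2 c z r) := fun b1 => by
    rw [FinProb.E_comm]
    simp only [FinProb.E_comm (bookLaw Msg U P2 PR) (select _)]
    simp only [E_bookLaw_word_relay P2 PR w _ fun c r => (W c r).E fun z2 => ind (¬T2 c z2 r),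
      FinProb.E_const]
  simp only [h, FinProb.E_const]

end Scheme

/-! ### Union bound for joint decoding -/

section OneShot

variable {ι : Type*} [Fintype ι] [DecidableEq ι] {Msg : ι → Type*} [∀ i, Fintype (Msg i)]
  [∀ i, DecidableEq (Msg i)] {U : Type*} [Fintype U] [DecidableEq U] [Nonempty U]
  {C1 C2 : ι → Type*} [∀ i, Fintype (C1 i)] [∀ i, Fintype (C2 i)] {Q1 Q2 Z1 Z2 : Type*}
  [Fintype Q1] [Fintype Q2] [Fintype Z1] [Fintype Z2] {κ : Type*} [Fintype κ]

/-- `v` passes the tests `T1` and `T2` for some relay index. -/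
def Passes (T1 : (∀ i, C1 i) → Z1 → Q1 → Prop) (T2 : (∀ i, C2 i) → Z2 → Q2 → Prop)
    (b : Book Msg U C1 Q1 × Book Msg U C2 Q2) (z1 : Z1) (z2 : Z2) (v : ∀ i, Msg i) : Prop :=
  ∃ u, T1 (b.1.word v) z1 (b.1.2 u) ∧ T2 (b.2.word v) z2 (b.2.2 u)

/-- If `w` passes with the chosen index, failure requires another tuple that passes, and its index
either equals `u` or not. The two cases are kept apart because their codewords depend differently on
the outputs. -/
lemma ind_not_unique_le (T1 : κ → (∀ i, C1 i) → Z1 → Q1 → Prop)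
    (T2 : κ → (∀ i, C2 i) → Z2 → Q2 → Prop) (b : Book Msg U C1 Q1 × Book Msg U C2 Q2)
    (z1 : Z1) (u : U) (z2 : Z2) (w : ∀ i, Msg i) :
    ind (∃ k, ¬(Passes (T1 k) (T2 k) b z1 z2 w ∧ ∀ v, Passes (T1 k) (T2 k) b z1 z2 v → v = w)) ≤
      ∑ k, (ind (¬T1 k (b.1.word w) z1 (b.1.2 u)) + ind (¬T2 k (b.2.word w) z2 (b.2.2 u)) +
        ∑ v ∈ Finset.univ.erase w,
          (ind (T1 k (b.1.word v) z1 (b.1.2 u)) * ind (T2 k (b.2.word v) z2 (b.2.2 u)) +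
          ∑ u', ind (u ≠ u') * (ind (T1 k (b.1.word v) z1 (b.1.2 u')) *
            ind (T2 k (b.2.word v) z2 (b.2.2 u'))))) := by
  have hn : ∀ k (v : ∀ i, Msg i), 0 ≤
      ind (T1 k (b.1.word v) z1 (b.1.2 u)) * ind (T2 k (b.2.word v) z2 (b.2.2 u)) +
      ∑ u', ind (u ≠ u') * (ind (T1 k (b.1.word v) z1 (b.1.2 u')) *
        ind (T2 k (b.2.word v) z2 (b.2.2 u'))) := fun k v =>
    add_nonneg (mul_nonneg (ind_nonneg _) (ind_nonneg _)) (Finset.sum_nonneg fun u' _ =>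
      mul_nonneg (ind_nonneg _) (mul_nonneg (ind_nonneg _) (ind_nonneg _)))
  have hn2 : ∀ k, 0 ≤ (ind (¬T1 k (b.1.word w) z1 (b.1.2 u)) +
      ind (¬T2 k (b.2.word w) z2 (b.2.2 u)) +
        ∑ v ∈ Finset.univ.erase w,
          (ind (T1 k (b.1.word v) z1 (b.1.2 u)) * ind (T2 k (b.2.word v) z2 (b.2.2 u)) +
          ∑ u', ind (u ≠ u') * (ind (T1 k (b.1.word v) z1 (b.1.2 u')) *
            ind (T2 k (b.2.word v) z2 (b.2.2 u'))))) := fun k =>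
    add_nonneg (add_nonneg (ind_nonneg _) (ind_nonneg _)) (Finset.sum_nonneg fun v _ => hn k v)
  refine ind_le_of (Finset.sum_nonneg fun k _ => hn2 k) fun ⟨k, hk⟩ => ?_
  refine le_trans ?_ (Finset.single_le_sum (fun k _ => hn2 k) (Finset.mem_univ k))
  by_cases ht : T1 k (b.1.word w) z1 (b.1.2 u) ∧ T2 k (b.2.word w) z2 (b.2.2 u)
  · have h2 : ∃ v, Passes (T1 k) (T2 k) b z1 z2 v ∧ v ≠ w := by
      by_contra! h
      exact hk ⟨⟨u, ht⟩, h⟩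
    obtain ⟨v, ⟨u', hv1, hv2⟩, hvw⟩ := h2
    refine le_add_of_nonneg_of_le (add_nonneg (ind_nonneg _) (ind_nonneg _)) ?_
    refine le_trans ?_ (Finset.single_le_sum (fun v _ => hn k v)
      (Finset.mem_erase.2 ⟨hvw, Finset.mem_univ v⟩))
    by_cases huu : u = u'
    · subst huu
      rw [ind_of hv1, ind_of hv2, one_mul]
      exact le_add_of_nonneg_right (Finset.sum_nonneg fun u' _ =>
        mul_nonneg (ind_nonneg _) (mul_nonneg (ind_nonneg _) (ind_nonneg _)))
    · refine le_add_of_nonneg_of_le (mul_nonneg (ind_nonneg _) (ind_nonneg _)) ?_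
      refine le_trans ?_ (Finset.single_le_sum (fun u' _ => mul_nonneg (ind_nonneg _)
        (mul_nonneg (ind_nonneg _) (ind_nonneg _))) (Finset.mem_univ u'))
      rw [ind_of huu, ind_of hv1, ind_of hv2]
      norm_num
  · have h0 := Finset.sum_nonneg (s := Finset.univ.erase w) fun v _ => hn k v
    rw [not_and_or] at ht
    rcases ht with ht | ht
    · rw [ind_of ht]
      linarith [ind_nonneg (¬T2 k (b.2.word w) z2 (b.2.2 u))]
    · rw [ind_of ht]
      linarith [ind_nonneg (¬T1 k (b.1.word w) z1 (b.1.2 u))]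

/-- The error probability of joint decoding with a random codebook. -/
theorem E_not_unique_le (P1 : ∀ i, FinProb (C1 i)) (P2 : ∀ i, FinProb (C2 i)) (PQ : FinProb Q1)
    (PR : FinProb Q2) (V : (∀ i, C1 i) → FinProb Z1) (G : Z1 → Q1 → Prop)
    (W : (∀ i, C2 i) → Q2 → FinProb Z2) (w : ∀ i, Msg i)
    (T1 : κ → (∀ i, C1 i) → Z1 → Q1 → Prop) (T2 : κ → (∀ i, C2 i) → Z2 → Q2 → Prop)
    (A1 A2 B1 B2 : κ → Finset ι → ℝ) (hA1 : ∀ k I, 0 ≤ A1 k I) (hA2 : ∀ k I, 0 ≤ A2 k I)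
    (hB1 : ∀ k I, 0 ≤ B1 k I) (hB2 : ∀ k I, 0 ≤ B2 k I) (N1 N2 : ℝ)
    (h1 : ∀ k I, I ≠ ∅ → ∀ c z q,
      (FinProb.pi P1).E (fun c' => ind (T1 k (I.piecewise c' c) z q)) ≤ A1 k I)
    (h2 : ∀ k I, I ≠ ∅ → ∀ c z q,
      (FinProb.pi P2).E (fun c' => ind (T2 k (I.piecewise c' c) z q)) ≤ A2 k I)
    (h3 : ∀ k I, I ≠ ∅ → ∀ c z,
      (FinProb.pi P1).E (fun c' => PQ.E fun q => ind (T1 k (I.piecewise c' c) z q)) ≤ B1 k I)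
    (h4 : ∀ k I, I ≠ ∅ → ∀ c z,
      (FinProb.pi P2).E (fun c' => PR.E fun q => ind (T2 k (I.piecewise c' c) z q)) ≤ B2 k I)
    (h5 : ∀ k, ((FinProb.pi P1).E fun c => (FinProb.pi fun _ : U => PQ).E fun q =>
      (V c).E fun z => (select fun u => G z (q u)).E fun u => ind (¬T1 k c z (q u))) ≤ N1)
    (h6 : ∀ k, ((FinProb.pi P2).E fun c => PR.E fun r => (W c r).E fun z =>
      ind (¬T2 k c z r)) ≤ N2) :
    ((bookLaw Msg U P1 PQ).prod (bookLaw Msg U P2 PR)).E (fun b => (run V G W w b).E fun ζ =>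
      ind (∃ k, ¬(Passes (T1 k) (T2 k) b ζ.1 ζ.2.2 w ∧
        ∀ v, Passes (T1 k) (T2 k) b ζ.1 ζ.2.2 v → v = w))) ≤
      ∑ k : κ, (N1 + N2 + ∑ I ∈ Finset.univ.erase ∅, (∏ i ∈ I, (Fintype.card (Msg i) : ℝ)) *
        (A1 k I * A2 k I + Fintype.card U * (B1 k I * B2 k I))) := by
  have hd : ∀ v ∈ Finset.univ.erase w, diff w v ≠ ∅ := fun v hv h => by
    refine (Finset.mem_erase.1 hv).1 (funext fun i => ?_)
    by_contra hne
    have : i ∈ diff w v := by simp [diff, hne]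
    simp [h] at this
  calc _ ≤ ((bookLaw Msg U P1 PQ).prod (bookLaw Msg U P2 PR)).E (fun b =>
        (run V G W w b).E fun ζ => _) :=
        FinProb.E_mono _ fun b => FinProb.E_mono _ fun ζ =>
          ind_not_unique_le T1 T2 b ζ.1 ζ.2.1 ζ.2.2 w
    _ ≤ ∑ k : κ, (N1 + N2 + ∑ v ∈ Finset.univ.erase w,
        (A1 k (diff w v) * A2 k (diff w v) +
          Fintype.card U * (B1 k (diff w v) * B2 k (diff w v)))) := by
      simp only [FinProb.E_sum, FinProb.E_add]
      refine Finset.sum_le_sum fun k _ => add_le_add (add_le_add ?_ ?_)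
        (Finset.sum_le_sum fun v hv => add_le_add ?_ ?_)
      · rw [E_true_slot1 P1 P2 PQ PR V G W w (T1 k)]
        exact h5 k
      · rw [E_true_slot2 P1 P2 PQ PR V G W w (T2 k)]
        exact h6 k
      · exact E_wrong_messages_le P1 P2 PQ PR V G W w v (T1 k) (T2 k) (hA1 _ _)
          (h1 k _ (hd v hv)) (h2 k _ (hd v hv))
      · rw [← nsmul_eq_mul, ← Finset.card_univ, ← Finset.sum_const]
        exact Finset.sum_le_sum fun u' _ =>
          E_wrong_messages_index_le P1 P2 PQ PR V G W w v (T1 k) (T2 k) (hB1 _ _) u'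
            (h3 k _ (hd v hv)) (h4 k _ (hd v hv))
    -- The bound depends on a wrong tuple only through the set of users that it gets wrong.
    _ ≤ _ := Finset.sum_le_sum fun k _ => by
      refine add_le_add le_rfl (sum_diff_le w
        (fun I => A1 k I * A2 k I + Fintype.card U * (B1 k I * B2 k I)) fun I => ?_)
      exact add_nonneg (mul_nonneg (hA1 _ _) (hA2 _ _))
        (mul_nonneg (Nat.cast_nonneg _) (mul_nonneg (hB1 _ _) (hB2 _ _)))

end OneShot

/-! ### Laws of random variables and disintegration -/

section Law

variable {Ω α γ δ : Type*} [Fintype Ω] [Fintype α] [Fintype γ] [Fintype δ]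

lemma FinProb.law_eq_E (J : FinProb Ω) {α : Type*} (X : Ω → α) (a : α) :
    law J.w X a = J.E fun ω => ind (X ω = a) := by
  simp [law, E, ind]

lemma FinProb.law_nonneg (J : FinProb Ω) {α : Type*} (X : Ω → α) (a : α) : 0 ≤ law J.w X a := by
  rw [J.law_eq_E]
  exact J.E_nonneg fun _ => ind_nonneg _

lemma FinProb.law_pos (J : FinProb Ω) {α : Type*} (X : Ω → α) {ω : Ω} (h : J.w ω ≠ 0) :
    0 < law J.w X (X ω) := by
  rw [J.law_eq_E]
  refine lt_of_lt_of_le ((J.nonneg ω).lt_of_ne' h) ?_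
  have := Finset.single_le_sum (f := fun ω' => J.w ω' * ind (X ω' = X ω))
    (fun i _ => mul_nonneg (J.nonneg i) (ind_nonneg _)) (Finset.mem_univ ω)
  simpa [FinProb.E, ind] using this

lemma FinProb.exists_of_law_ne_zero (J : FinProb Ω) {α : Type*} {X : Ω → α} {a : α}
    (h : law J.w X a ≠ 0) : ∃ ω, X ω = a ∧ J.w ω ≠ 0 := by
  classical
  obtain ⟨ω, _, hω⟩ := Finset.exists_ne_zero_of_sum_ne_zero h
  by_cases hX : X ω = a
  · exact ⟨ω, hX, by simpa [hX] using hω⟩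
  · simp [hX] at hω

lemma FinProb.sum_law (J : FinProb Ω) (X : Ω → α) (f : α → ℝ) :
    ∑ a, law J.w X a * f a = J.E fun ω => f (X ω) := J.E_map X f

lemma law_comp_injective {α γ : Type*} (P : Ω → ℝ) (X : Ω → α) {e : α → γ}
    (he : Function.Injective e) (a : α) : law P (fun ω => e (X ω)) (e a) = law P X a := by
  refine Finset.sum_congr rfl fun ω _ => ?_
  by_cases h : X ω = a
  · simp [h]
  · simp [h, he.ne h]

lemma FinProb.sum_law_pair (J : FinProb Ω) (X : Ω → α) {σ : Type*} (S : Ω → σ) (s : σ) :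
    ∑ x, law J.w (fun ω => (X ω, S ω)) (x, s) = law J.w S s := by
  classical
  simp only [law, Prod.mk.injEq]
  rw [Finset.sum_comm]
  refine Finset.sum_congr rfl fun ω _ => ?_
  by_cases h : S ω = s <;> simp [h]

/-- Disintegration of a joint law. -/
lemma FinProb.exists_kernel (J : FinProb (α × γ)) :
    ∃ κ : α → FinProb γ, J = (J.map Prod.fst).compProd κ := by
  classical
  have hm : ∀ a, law J.w Prod.fst a = ∑ b, J.w (a, b) := fun a => by
    rw [law, Fintype.sum_prod_type]
    rw [Finset.sum_eq_single a]
    · simp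
    · intro a' _ h
      simp [h]
    · simp
  have h0 : ∀ a b, law J.w Prod.fst a = 0 → J.w (a, b) = 0 := fun a b h => by
    rw [hm] at h
    exact (Finset.sum_eq_zero_iff_of_nonneg fun b _ => J.nonneg _).1 h b (Finset.mem_univ b)
  -- At points of mass zero the kernel is arbitrary; the second marginal serves as a default.
  refine ⟨fun a => if h : law J.w Prod.fst a = 0 then J.map Prod.snd else
    ⟨fun b => J.w (a, b) / law J.w Prod.fst a,
      fun b => div_nonneg (J.nonneg _) (J.law_nonneg _ _), by
        rw [← Finset.sum_div, ← hm, div_self h]⟩, ?_⟩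
  ext ⟨a, b⟩
  simp only [compProd, map]
  by_cases h : law J.w Prod.fst a = 0
  · simp [h, h0 a b h]
  · rw [dif_neg h]
    exact (mul_div_cancel₀ _ h).symm

end Law

/-! ### Divergence and mutual information as expectations -/

section Info

variable {Ω α σ γ δ : Type*} [Fintype Ω] [Fintype α] [Fintype γ] [Fintype δ]

/-- The log-likelihood ratio between the joint law of `X` and `S` and the product of `Q` and the
law of `S`. -/
def logRatio (J : FinProb Ω) (X : Ω → α) (S : Ω → σ) (Q : FinProb α) (x : α) (s : σ) : ℝ :=
  Real.logb 2 (law J.w (fun ω => (X ω, S ω)) (x, s) / (Q.w x * law J.w S s))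

/-- The relative entropy (in bits) between the joint law of `X` and `S` and the product of `Q`
and the law of `S`. -/
def divergence (J : FinProb Ω) (X : Ω → α) (S : Ω → σ) (Q : FinProb α) : ℝ :=
  J.E fun ω => logRatio J X S Q (X ω) (S ω)

/-- The mean of the absolute value of the log-likelihood ratio. -/
def absDivergence (J : FinProb Ω) (X : Ω → α) (S : Ω → σ) (Q : FinProb α) : ℝ :=
  J.E fun ω => |logRatio J X S Q (X ω) (S ω)|

lemma mutualInfo_eq_divergence (J : FinProb Ω) (X : Ω → α) (Y : Ω → γ) :
    mutualInfo J.w X Y = divergence J X Y (J.map X) := by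
  have := J.sum_law (fun ω => (X ω, Y ω)) fun p => logRatio J X Y (J.map X) p.1 p.2
  rw [Fintype.sum_prod_type] at this
  exact this

lemma mutualInfo_eq_E (J : FinProb Ω) (X : Ω → α) (Y : Ω → γ) :
    mutualInfo J.w X Y = J.E fun ω => Real.logb 2 (law J.w (fun ω => (X ω, Y ω)) (X ω, Y ω) /
      (law J.w X (X ω) * law J.w Y (Y ω))) :=
  mutualInfo_eq_divergence J X Y

lemma condMutualInfo_eq_E (J : FinProb Ω) (X : Ω → α) (Y : Ω → γ) (Z : Ω → δ) :
    condMutualInfo J.w X Y Z = J.E fun ω =>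
      Real.logb 2 (law J.w (fun ω => (X ω, Y ω, Z ω)) (X ω, Y ω, Z ω) * law J.w Z (Z ω) /
      (law J.w (fun ω => (X ω, Z ω)) (X ω, Z ω) * law J.w (fun ω => (Y ω, Z ω)) (Y ω, Z ω))) := by
  have := J.sum_law (fun ω => (X ω, Y ω, Z ω)) fun p =>
    Real.logb 2 (law J.w (fun ω => (X ω, Y ω, Z ω)) p * law J.w Z p.2.2 /
      (law J.w (fun ω => (X ω, Z ω)) (p.1, p.2.2) *
        law J.w (fun ω => (Y ω, Z ω)) (p.2.1, p.2.2)))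
  simp only [Fintype.sum_prod_type] at this
  exact this

lemma FinProb.E_congr (J : FinProb Ω) {f g : Ω → ℝ} (h : ∀ ω, J.w ω ≠ 0 → f ω = g ω) :
    J.E f = J.E g :=
  Finset.sum_congr rfl fun ω _ => by
    by_cases h0 : J.w ω = 0
    · simp [h0]
    · rw [h ω h0]

/-- Gibbs' inequality, from `log x ≤ x - 1` applied to the inverse likelihood ratio and summed. It
ensures that the quantization rate is nonnegative. -/
lemma mutualInfo_nonneg (J : FinProb Ω) (X : Ω → α) (Y : Ω → γ) : 0 ≤ mutualInfo J.w X Y := by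
  rw [mutualInfo]
  have h1 : ∀ x y, law J.w (fun ω => (X ω, Y ω)) (x, y) - law J.w X x * law J.w Y y ≤
      Real.log 2 * (law J.w (fun ω => (X ω, Y ω)) (x, y) *
        Real.logb 2 (law J.w (fun ω => (X ω, Y ω)) (x, y) / (law J.w X x * law J.w Y y))) := by
    intro x y
    set p := law J.w (fun ω => (X ω, Y ω)) (x, y) with hp
    have hpn : 0 ≤ p := J.law_nonneg _ _
    rcases hpn.eq_or_lt with h0 | h0
    · rw [← h0]
      simpa using mul_nonneg (J.law_nonneg X x) (J.law_nonneg Y y)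
    · obtain ⟨ω, hω, hw⟩ := J.exists_of_law_ne_zero h0.ne'
      obtain ⟨hx, hy⟩ := Prod.mk.inj hω
      have hX := J.law_pos X hw
      have hY := J.law_pos Y hw
      rw [hx] at hX
      rw [hy] at hY
      set q := law J.w X x * law J.w Y y with hq
      have hqp : 0 < q := mul_pos hX hY
      have h2 := Real.log_le_sub_one_of_pos (div_pos hqp h0)
      rw [Real.log_div hqp.ne' h0.ne'] at h2
      have hl2 : Real.log 2 ≠ 0 := (Real.log_pos one_lt_two).ne'
      rw [Real.logb, Real.log_div h0.ne' hqp.ne']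
      have h3 := mul_le_mul_of_nonneg_left h2 h0.le
      rw [show p * (q / p - 1) = q - p by field_simp] at h3
      calc p - q ≤ p * (Real.log p - Real.log q) := by linarith
        _ = _ := by field_simp
  have h2 : ∑ x, ∑ y, (law J.w (fun ω => (X ω, Y ω)) (x, y) - law J.w X x * law J.w Y y) = 0 := by
    simp only [Finset.sum_sub_distrib, ← Finset.mul_sum, ← Finset.sum_mul]
    rw [show ∑ y, law J.w Y y = 1 from (J.map Y).sum_one,
      show ∑ x, law J.w X x = 1 from (J.map X).sum_one, Finset.sum_comm]
    simp only [J.sum_law_pair X Y]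
    rw [show ∑ y, law J.w Y y = 1 from (J.map Y).sum_one]
    norm_num
  have h3 := Finset.sum_le_sum fun x (_ : x ∈ Finset.univ) =>
    Finset.sum_le_sum fun y (_ : y ∈ Finset.univ) => h1 x y
  rw [h2] at h3
  simp only [← Finset.mul_sum] at h3
  exact nonneg_of_mul_nonneg_right h3 (Real.log_pos one_lt_two)

end Info

/-! ### Probability that fresh codewords look typical -/

section Packing

variable {Ω Γ α σ A : Type*} [Fintype Ω] [Fintype Γ] [Fintype α] [Fintype A]

/-- Fresh letters `a t ∼ q` look jointly typical with side information `s t` with probability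
at most `2 ^ (-n (D - ε C))`, where `D` is the divergence between the true joint law and the
product law. -/
lemma E_fresh_typical_le (J : FinProb Ω) (g : Ω → Γ) (F : Γ → α) (S : Γ → σ) (q : FinProb A)
    (f : A → α) (hac : ∀ ω, J.w ω ≠ 0 → (q.map f).w (F (g ω)) ≠ 0) {n : ℕ} (ε : ℝ)
    (φ : Fin n → A → Γ) (s : Fin n → σ) (hF : ∀ t a, F (φ t a) = f a)
    (hS : ∀ t a, S (φ t a) = s t) :
    (FinProb.pi fun _ : Fin n => q).E
      (fun a => ind (IsTypical ε (law J.w g) fun t => φ t (a t))) ≤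
      (2 : ℝ) ^ (-(n * (divergence J (fun ω => F (g ω)) (fun ω => S (g ω)) (q.map f) -
        ε * absDivergence J (fun ω => F (g ω)) (fun ω => S (g ω)) (q.map f)))) := by
  set X := fun ω => F (g ω) with hX
  set T := fun ω => S (g ω) with hT
  let h : α → σ → ℝ := fun x s => law J.w (fun ω => (X ω, T ω)) (x, s) /
    ((q.map f).w x * law J.w T s)
  have hh : ∀ x s, 0 ≤ h x s := fun x s =>
    div_nonneg (J.law_nonneg _ _) (mul_nonneg ((q.map f).nonneg _) (J.law_nonneg _ _))
  have key := E_typical_le q (law J.w g) (fun γ => h (F γ) (S γ)) ε φ (fun γ => hh _ _)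
    (fun γ hγ => by
      obtain ⟨ω, rfl, hω⟩ := J.exists_of_law_ne_zero hγ
      exact div_pos (J.law_pos (fun ω => (X ω, T ω)) hω)
        (mul_pos (((q.map f).nonneg _).lt_of_ne' (hac ω hω)) (J.law_pos T hω)))
    (fun t => by
      simp only [hF, hS]
      rw [← q.E_map f fun x => h x (s t)]
      -- The likelihood ratio has mean one when the side information has positive probability. It is
      -- only bounded by one in general: letters with `q`-mass zero are lost, and a side letter of
      -- probability zero gives the quotient `0 / 0 = 0`.
      calc (q.map f).E (fun x => h x (s t))
          ≤ ∑ x, law J.w (fun ω => (X ω, T ω)) (x, s t) / law J.w T (s t) := by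
            refine Finset.sum_le_sum fun x _ => ?_
            by_cases h0 : (q.map f).w x = 0
            · rw [h0, zero_mul]
              exact div_nonneg (J.law_nonneg _ _) (J.law_nonneg _ _)
            · refine le_of_eq ?_
              simp only [h]
              rw [← mul_div_assoc, mul_div_mul_left _ _ h0]
        _ = law J.w T (s t) / law J.w T (s t) := by rw [← Finset.sum_div, J.sum_law_pair]
        _ ≤ 1 := div_self_le_one _)
  rw [J.sum_law g fun γ => Real.logb 2 (h (F γ) (S γ)),
    J.sum_law g fun γ => |Real.logb 2 (h (F γ) (S γ))|] at key
  exact key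

lemma FinProb.map_w_ne_zero (q : FinProb A) (f : A → α) {a : A} (h : q.w a ≠ 0) :
    (q.map f).w (f a) ≠ 0 := (q.law_pos f h).ne'

variable {X : Fin 2 → Type*} [∀ i, Fintype (X i)] {Y : Type*} {Q : Type*} [Fintype Q]

/-- Fresh codewords of the users in `I`. -/
lemma E_fresh_words_le (J : FinProb Ω) (g : Ω → Γ) (p : ∀ i, FinProb (X i)) (x : Ω → ∀ i, X i)
    (hx : ∀ ω, J.w ω ≠ 0 → (FinProb.pi p).w (x ω) ≠ 0) (I : Finset (Fin 2))
    (F : Γ → α) (S : Γ → σ) (f : (∀ i, X i) → α) (hf : ∀ ω, F (g ω) = f (x ω))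
    (mk : (∀ i, X i) → Y → Γ) (hF : ∀ a c s, F (mk (I.piecewise a c) s) = f a)
    (hS : ∀ a c s, S (mk (I.piecewise a c) s) = S (mk c s)) {n : ℕ} (ε : ℝ)
    (c : ∀ i, Fin n → X i) (s : Fin n → Y) :
    (FinProb.pi fun i => FinProb.pi fun _ : Fin n => p i).E
      (fun c' => ind (IsTypical ε (law J.w g) fun t =>
        mk (fun i => I.piecewise c' c i t) (s t))) ≤
      (2 : ℝ) ^ (-(n *
        (divergence J (fun ω => F (g ω)) (fun ω => S (g ω)) ((FinProb.pi p).map f) -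
        ε * absDivergence J (fun ω => F (g ω)) (fun ω => S (g ω)) ((FinProb.pi p).map f)))) := by
  have hpw : ∀ (c' : ∀ i, Fin n → X i) t, (fun i => I.piecewise c' c i t) =
      I.piecewise (fun i => c' i t) fun i => c i t := fun c' t => by
    funext i
    by_cases h : i ∈ I <;> simp [h]
  simp only [hpw]
  -- Transposing users and time gives i.i.d. letter tuples. Letters are drawn for all users;
  -- `piecewise` discards those of users outside `I`.
  rw [FinProb.E_pi_comm (fun i (_ : Fin n) => p i) fun a => ind (IsTypical ε (law J.w g) fun t =>
    mk (I.piecewise (a t) fun i => c i t) (s t))]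
  exact E_fresh_typical_le J g F S (FinProb.pi p) f
    (fun ω hω => by rw [hf]; exact FinProb.map_w_ne_zero _ f (hx ω hω)) ε
    (fun t a => mk (I.piecewise a fun i => c i t) (s t)) (fun t => S (mk (fun i => c i t) (s t)))
    (fun t a => hF _ _ _) fun t a => hS _ _ _

/-- Fresh codewords of the users in `I` and a fresh relay codeword. -/
lemma E_fresh_words_relay_le (J : FinProb Ω) (g : Ω → Γ) (p : ∀ i, FinProb (X i))
    (q : FinProb Q) (x : Ω → (∀ i, X i) × Q)
    (hx : ∀ ω, J.w ω ≠ 0 → ((FinProb.pi p).prod q).w (x ω) ≠ 0) (I : Finset (Fin 2))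
    (F : Γ → α) (S : Γ → σ) (f : (∀ i, X i) × Q → α) (hf : ∀ ω, F (g ω) = f (x ω))
    (mk : (∀ i, X i) → Y → Q → Γ) (hF : ∀ a c s b, F (mk (I.piecewise a c) s b) = f (a, b))
    (b0 : Q) (hS : ∀ a c s b, S (mk (I.piecewise a c) s b) = S (mk c s b0)) {n : ℕ} (ε : ℝ)
    (c : ∀ i, Fin n → X i) (s : Fin n → Y) :
    (FinProb.pi fun i => FinProb.pi fun _ : Fin n => p i).E
      (fun c' => (FinProb.pi fun _ : Fin n => q).E fun b =>
        ind (IsTypical ε (law J.w g) fun t => mk (fun i => I.piecewise c' c i t) (s t) (b t))) ≤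
      (2 : ℝ) ^ (-(n *
        (divergence J (fun ω => F (g ω)) (fun ω => S (g ω)) (((FinProb.pi p).prod q).map f) -
        ε * absDivergence J (fun ω => F (g ω)) (fun ω => S (g ω))
          (((FinProb.pi p).prod q).map f)))) := by
  have hpw : ∀ (c' : ∀ i, Fin n → X i) t, (fun i => I.piecewise c' c i t) =
      I.piecewise (fun i => c' i t) fun i => c i t := fun c' t => by
    funext i
    by_cases h : i ∈ I <;> simp [h]
  simp only [hpw]
  rw [FinProb.E_pi_comm (fun i (_ : Fin n) => p i) fun a =>
    (FinProb.pi fun _ : Fin n => q).E fun b => ind (IsTypical ε (law J.w g) fun t =>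
      mk (I.piecewise (a t) fun i => c i t) (s t) (b t)),
    FinProb.E_pi_compProd (fun _ : Fin n => FinProb.pi p) (fun _ _ => q) fun a =>
      ind (IsTypical ε (law J.w g) fun t => mk (I.piecewise (a t).1 fun i => c i t) (s t) (a t).2)]
  exact E_fresh_typical_le J g F S ((FinProb.pi p).prod q) f
    (fun ω hω => by rw [hf]; exact FinProb.map_w_ne_zero _ f (hx ω hω)) ε
    (fun t a => mk (I.piecewise a.1 fun i => c i t) (s t) a.2)
    (fun t => S (mk (fun i => c i t) (s t) b0))
    (fun t a => hF _ _ _ _) fun t a => hS _ _ _ _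

end Packing

lemma ind_and (p q : Prop) : ind (p ∧ q) = ind p * ind q := by
  by_cases hp : p <;> by_cases hq : q <;> simp [ind, hp, hq]

lemma FinProb.prod_map_w {A B α : Type*} [Fintype A] [Fintype B] [Fintype α] (P : FinProb A)
    (Q : FinProb B) (f : A → α) (x : α) (b : B) :
    ((P.prod Q).map fun a => (f a.1, a.2)).w (x, b) = (P.map f).w x * Q.w b := by
  rw [w_eq_E, E_map]
  simp only [Prod.mk.injEq, ind_and]
  rw [P.E_prod_mul Q (fun a => ind (f a = x)) fun b' => ind (b' = b), w_eq_E, w_eq_E, E_map]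

lemma FinProb.nonempty {Ω : Type*} [Fintype Ω] (P : FinProb Ω) : Nonempty Ω :=
  let ⟨ω, _⟩ := P.exists_le_E fun _ => 0
  ⟨ω⟩

/-! ### Joint laws of the two slots and the error exponents -/

section Joint

variable {X1 X2 : Fin 2 → Type*} {XR YR YH : Type*} {Y1 Y2 : Fin 2 → Type*}
  [∀ i, Fintype (X1 i)] [∀ i, Fintype (X2 i)] [Fintype XR] [Fintype YR] [Fintype YH]
  [∀ k, Fintype (Y1 k)] [∀ k, Fintype (Y2 k)]
  (ch : Channel X1 X2 XR YR Y1 Y2) (d : InputDist X1 X2 XR YR YH)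

/-- The input laws of the sources in slot one. -/
def InputDist.src1 (i : Fin 2) : FinProb (X1 i) := FinProb.ofPMF (d.p1 i)

/-- The input laws of the sources in slot two. -/
def InputDist.src2 (i : Fin 2) : FinProb (X2 i) := FinProb.ofPMF (d.p2 i)

/-- The input law of the relay. -/
def InputDist.rel : FinProb XR := FinProb.ofPMF d.pR

lemma sum_joint1 (f : Slot1 X1 YR Y1 YH → ℝ) :
    ∑ ω, joint1 ch d ω * f ω = (FinProb.pi d.src1).E fun x =>
      (FinProb.ofPMF (ch.slot1 x)).E fun z => (FinProb.ofPMF (d.quant z.1)).E fun yh =>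
        f (x, z.1, z.2, yh) := by
  simp only [FinProb.E, Fintype.sum_prod_type, Finset.mul_sum, FinProb.pi, FinProb.ofPMF,
    InputDist.src1, joint1, mul_assoc]

lemma sum_joint2 (f : Slot2 X2 XR Y2 → ℝ) :
    ∑ ω, joint2 ch d ω * f ω = (FinProb.pi d.src2).E fun x => d.rel.E fun r =>
      (FinProb.ofPMF (ch.slot2 x r)).E fun y => f (x, r, y) := by
  simp only [FinProb.E, Fintype.sum_prod_type, Finset.mul_sum, FinProb.pi, FinProb.ofPMF,
    InputDist.src2, InputDist.rel, joint2, mul_assoc]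

/-- The joint law of slot one. -/
def law1 : FinProb (Slot1 X1 YR Y1 YH) where
  w := joint1 ch d
  nonneg ω := mul_nonneg (mul_nonneg (Finset.prod_nonneg fun _ _ => ENNReal.toReal_nonneg)
    ENNReal.toReal_nonneg) ENNReal.toReal_nonneg
  sum_one := by simpa using sum_joint1 ch d fun _ => 1

/-- The joint law of slot two. -/
def law2 : FinProb (Slot2 X2 XR Y2) where
  w := joint2 ch d
  nonneg ω := mul_nonneg (mul_nonneg (Finset.prod_nonneg fun _ _ => ENNReal.toReal_nonneg)
    ENNReal.toReal_nonneg) ENNReal.toReal_nonneg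
  sum_one := by simpa using sum_joint2 ch d fun _ => 1

lemma E_law1 (f : Slot1 X1 YR Y1 YH → ℝ) :
    (law1 ch d).E f = (FinProb.pi d.src1).E fun x =>
      (FinProb.ofPMF (ch.slot1 x)).E fun z => (FinProb.ofPMF (d.quant z.1)).E fun yh =>
        f (x, z.1, z.2, yh) :=
  sum_joint1 ch d f

lemma E_law2 (f : Slot2 X2 XR Y2 → ℝ) :
    (law2 ch d).E f = (FinProb.pi d.src2).E fun x => d.rel.E fun r =>
      (FinProb.ofPMF (ch.slot2 x r)).E fun y => f (x, r, y) :=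
  sum_joint2 ch d f

/-- The law of the quantized relay observation. -/
def quantLaw : FinProb YH := (law1 ch d).map fun ω => ω.2.2.2

lemma map_law1_src {α : Type*} [Fintype α] (f : (∀ i, X1 i) → α) :
    (law1 ch d).map (fun ω => f ω.1) = (FinProb.pi d.src1).map f :=
  FinProb.ext_E fun g => by simp only [FinProb.E_map, E_law1, FinProb.E_const]

lemma map_law2_src {α : Type*} [Fintype α] (f : (∀ i, X2 i) × XR → α) :
    (law2 ch d).map (fun ω => f (ω.1, ω.2.1)) = ((FinProb.pi d.src2).prod d.rel).map f :=
  FinProb.ext_E fun g => by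
    simp only [FinProb.E_map, E_law2, FinProb.E_const, FinProb.E_compProd]

lemma map_law2_src' {α : Type*} [Fintype α] (f : (∀ i, X2 i) → α) :
    (law2 ch d).map (fun ω => f ω.1) = (FinProb.pi d.src2).map f :=
  FinProb.ext_E fun g => by simp only [FinProb.E_map, E_law2, FinProb.E_const]

lemma law1_src_ne_zero {ω : Slot1 X1 YR Y1 YH} (h : (law1 ch d).w ω ≠ 0) :
    (FinProb.pi d.src1).w ω.1 ≠ 0 :=
  left_ne_zero_of_mul (left_ne_zero_of_mul h)

lemma law1_src_quant_ne_zero {ω : Slot1 X1 YR Y1 YH} (h : (law1 ch d).w ω ≠ 0) :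
    ((FinProb.pi d.src1).prod (quantLaw ch d)).w (ω.1, ω.2.2.2) ≠ 0 :=
  mul_ne_zero (law1_src_ne_zero ch d h)
    (FinProb.map_w_ne_zero (law1 ch d) (fun ω => ω.2.2.2) h)

lemma law2_src_rel_ne_zero {ω : Slot2 X2 XR Y2} (h : (law2 ch d).w ω ≠ 0) :
    ((FinProb.pi d.src2).prod d.rel).w (ω.1, ω.2.1) ≠ 0 :=
  left_ne_zero_of_mul h

lemma law2_src_ne_zero {ω : Slot2 X2 XR Y2} (h : (law2 ch d).w ω ≠ 0) :
    (FinProb.pi d.src2).w ω.1 ≠ 0 :=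
  left_ne_zero_of_mul (left_ne_zero_of_mul h)

/-- Given the relay observation, the quantized observation is independent of the rest. -/
lemma law_quant_eq {σ : Type*} (h : (∀ i, X1 i) × YR × (∀ k, Y1 k) → σ) (s : σ) (yR : YR)
    (hs : ∀ p, h p = s → p.2.1 = yR) (b : YH) :
    law (law1 ch d).w (fun ω => (h (ω.1, ω.2.1, ω.2.2.1), ω.2.2.2)) (s, b) =
      law (law1 ch d).w (fun ω => h (ω.1, ω.2.1, ω.2.2.1)) s *
        (FinProb.ofPMF (d.quant yR)).w b := by
  rw [FinProb.law_eq_E, FinProb.law_eq_E, E_law1, E_law1]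
  simp only [Prod.mk.injEq, ind_and, FinProb.E_const_mul, ← FinProb.w_eq_E, FinProb.E_const,
    ← FinProb.E_mul_const]
  congr 1; funext x; congr 1; funext z
  by_cases hz : h (x, z.1, z.2) = s
  · rw [hs _ hz]
  · simp [ind_of_not hz]

/-- Mutual information between the relay observation and its quantization. -/
abbrev quantInfo : ℝ := mutualInfo (joint1 ch d) (fun ω => ω.2.1) fun ω => ω.2.2.2

/-- By the chain rule the divergence is `I(X_i; X_j, Y_k) + I(Ŷ_R; X_i, X_j, Y_k)`. Since `Ŷ_R`
depends on the rest only through `Y_R`, the second term is `I(Y_R; Ŷ_R) - I(Ŷ_R; Y_R | X_i, X_j,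
Y_k)`. -/
lemma divergence_wrong_index_single (k i j : Fin 2) :
    divergence (law1 ch d) (fun ω => (ω.1 i, ω.2.2.2)) (fun ω => (ω.1 j, ω.2.2.1 k))
      (((FinProb.pi d.src1).prod (quantLaw ch d)).map fun a => (a.1 i, a.2)) =
    mutualInfo (joint1 ch d) (fun ω => ω.1 i) (fun ω => (ω.1 j, ω.2.2.1 k)) -
      condMutualInfo (joint1 ch d) (fun ω => ω.2.2.2) (fun ω => ω.2.1)
        (fun ω => (ω.1 i, ω.1 j, ω.2.2.1 k)) + quantInfo ch d := by
  have e : joint1 ch d = (law1 ch d).w := rfl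
  rw [quantInfo, e, mutualInfo_eq_E, mutualInfo_eq_E, condMutualInfo_eq_E, ← sub_eq_zero,
    divergence]
  set J := law1 ch d
  -- The identity holds pointwise for the log-likelihood ratios wherever the joint law is positive,
  -- so all expectations are merged into one that vanishes.
  simp only [sub_eq_add_neg, neg_eq_neg_one_mul (FinProb.E _ _), ← FinProb.E_const_mul,
    ← FinProb.E_add]
  refine (J.E_congr (g := fun _ => 0) fun ω hω => ?_).trans (J.E_const 0)
  obtain ⟨x, yR, y, yh⟩ := ω
  simp only [logRatio]
  have hQ : (((FinProb.pi d.src1).prod (quantLaw ch d)).map fun a => (a.1 i, a.2)).w (x i, yh) =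
      law J.w (fun ω => ω.1 i) (x i) * law J.w (fun ω => ω.2.2.2) yh := by
    rw [FinProb.prod_map_w _ _ fun a : ∀ i, X1 i => a i, ← map_law1_src ch d fun a => a i]
    rfl
  have h1 : law J.w (fun ω => ((ω.1 i, ω.2.2.2), ω.1 j, ω.2.2.1 k)) ((x i, yh), x j, y k) =
      law J.w (fun ω => (ω.2.2.2, ω.1 i, ω.1 j, ω.2.2.1 k)) (yh, x i, x j, y k) :=
    law_comp_injective J.w (fun ω => (ω.2.2.2, ω.1 i, ω.1 j, ω.2.2.1 k))
      (e := fun p => ((p.2.1, p.1), p.2.2.1, p.2.2.2))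
      (fun p q h => by simp only [Prod.mk.injEq] at h; ext <;> simp [h]) (yh, x i, x j, y k)
  have h2 : law J.w (fun ω => (ω.2.1, ω.2.2.2)) (yR, yh) =
      law J.w (fun ω => ω.2.1) yR * (FinProb.ofPMF (d.quant yR)).w yh :=
    law_quant_eq ch d (fun p => p.2.1) yR yR (fun _ h => h) yh
  have h3 : law J.w (fun ω => (ω.2.2.2, ω.2.1, ω.1 i, ω.1 j, ω.2.2.1 k))
      (yh, yR, x i, x j, y k) = law J.w (fun ω => (ω.2.1, ω.1 i, ω.1 j, ω.2.2.1 k))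
        (yR, x i, x j, y k) * (FinProb.ofPMF (d.quant yR)).w yh := by
    rw [← law_quant_eq ch d (fun p => (p.2.1, p.1 i, p.1 j, p.2.2 k)) (yR, x i, x j, y k) yR
      (fun _ h => (Prod.mk.inj h).1) yh]
    exact (law_comp_injective J.w (fun ω => (ω.2.2.2, ω.2.1, ω.1 i, ω.1 j, ω.2.2.1 k))
      (e := fun p => (p.2, p.1)) (fun p q h => by
        simp only [Prod.mk.injEq] at h; exact Prod.ext h.2 h.1) (yh, yR, x i, x j, y k)).symm
  rw [hQ, h1, h2, h3]
  have p1 := (J.law_pos (fun ω => ω.1 i) hω).ne'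
  have p2 := (J.law_pos (fun ω => ω.2.2.2) hω).ne'
  have p3 := (J.law_pos (fun ω => (ω.2.2.2, ω.1 i, ω.1 j, ω.2.2.1 k)) hω).ne'
  have p4 := (J.law_pos (fun ω => (ω.1 j, ω.2.2.1 k)) hω).ne'
  have p5 := (J.law_pos (fun ω => (ω.1 i, ω.1 j, ω.2.2.1 k)) hω).ne'
  have p6 := (J.law_pos (fun ω => (ω.2.1, ω.1 i, ω.1 j, ω.2.2.1 k)) hω).ne'
  have p7 := (J.law_pos (fun ω => ω.2.1) hω).ne'
  have p8 : (FinProb.ofPMF (d.quant yR)).w yh ≠ 0 := by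
    have := (J.law_pos (fun ω => (ω.2.1, ω.2.2.2)) hω).ne'
    rw [h2] at this
    exact right_ne_zero_of_mul this
  simp only at p1 p2 p3 p4 p5 p6 p7
  rw [Real.logb_div p3 (mul_ne_zero (mul_ne_zero p1 p2) p4), Real.logb_mul (mul_ne_zero p1 p2) p4,
    Real.logb_mul p1 p2, Real.logb_div p5 (mul_ne_zero p1 p4), Real.logb_mul p1 p4,
    Real.logb_div (mul_ne_zero (mul_ne_zero p6 p8) p5) (mul_ne_zero p3 p6),
    Real.logb_mul (mul_ne_zero p6 p8) p5, Real.logb_mul p6 p8, Real.logb_mul p3 p6,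
    Real.logb_div (mul_ne_zero p7 p8) (mul_ne_zero p7 p2), Real.logb_mul p7 p8,
    Real.logb_mul p7 p2]
  ring

/-- The chain rule alone suffices: the first information compares the joint law with the product of
the laws of `(X_1, X_2, Ŷ_R)` and `Y_k`, the second splits `Ŷ_R` from the sources. -/
lemma divergence_wrong_index_both (k : Fin 2) :
    divergence (law1 ch d) (fun ω => (ω.1 0, ω.1 1, ω.2.2.2)) (fun ω => ω.2.2.1 k)
      (((FinProb.pi d.src1).prod (quantLaw ch d)).map fun a => (a.1 0, a.1 1, a.2)) =
    mutualInfo (joint1 ch d) (fun ω => (ω.1 0, ω.1 1, ω.2.2.2)) (fun ω => ω.2.2.1 k) +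
      mutualInfo (joint1 ch d) (fun ω => (ω.1 0, ω.1 1)) (fun ω => ω.2.2.2) := by
  have e : joint1 ch d = (law1 ch d).w := rfl
  rw [e, mutualInfo_eq_E, mutualInfo_eq_E, ← sub_eq_zero, divergence]
  set J := law1 ch d
  simp only [sub_eq_add_neg, neg_eq_neg_one_mul (FinProb.E _ _), ← FinProb.E_const_mul,
    ← FinProb.E_add]
  refine (J.E_congr (g := fun _ => 0) fun ω hω => ?_).trans (J.E_const 0)
  obtain ⟨x, yR, y, yh⟩ := ω
  simp only [logRatio]
  have hQ : (((FinProb.pi d.src1).prod (quantLaw ch d)).map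
      fun a => (a.1 0, a.1 1, a.2)).w (x 0, x 1, yh) =
      law J.w (fun ω => (ω.1 0, ω.1 1)) (x 0, x 1) * law J.w (fun ω => ω.2.2.2) yh := by
    have h := FinProb.prod_map_w (FinProb.pi d.src1) (quantLaw ch d)
      (fun a : ∀ i, X1 i => (a 0, a 1)) (x 0, x 1) yh
    rw [← map_law1_src ch d fun a => (a 0, a 1)] at h
    refine Eq.trans ?_ h
    exact law_comp_injective _
      (fun a : (∀ i, X1 i) × YH => ((a.1 0, a.1 1), a.2))
      (e := fun p => (p.1.1, p.1.2, p.2))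
      (fun p q h => by simp only [Prod.mk.injEq] at h; ext <;> simp [h]) ((x 0, x 1), yh)
  have h1 : law J.w (fun ω => ((ω.1 0, ω.1 1), ω.2.2.2)) ((x 0, x 1), yh) =
      law J.w (fun ω => (ω.1 0, ω.1 1, ω.2.2.2)) (x 0, x 1, yh) :=
    law_comp_injective J.w (fun ω => (ω.1 0, ω.1 1, ω.2.2.2))
      (e := fun p => ((p.1, p.2.1), p.2.2))
      (fun p q h => by simp only [Prod.mk.injEq] at h; ext <;> simp [h]) (x 0, x 1, yh)
  rw [hQ, h1]
  have p1 := (J.law_pos (fun ω => (ω.1 0, ω.1 1)) hω).ne'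
  have p2 := (J.law_pos (fun ω => ω.2.2.2) hω).ne'
  have p3 := (J.law_pos (fun ω => ((ω.1 0, ω.1 1, ω.2.2.2), ω.2.2.1 k)) hω).ne'
  have p4 := (J.law_pos (fun ω => ω.2.2.1 k) hω).ne'
  have p5 := (J.law_pos (fun ω => (ω.1 0, ω.1 1, ω.2.2.2)) hω).ne'
  simp only at p1 p2 p3 p4 p5
  rw [Real.logb_div p3 (mul_ne_zero (mul_ne_zero p1 p2) p4), Real.logb_mul (mul_ne_zero p1 p2) p4,
    Real.logb_mul p1 p2, Real.logb_div p3 (mul_ne_zero p5 p4), Real.logb_mul p5 p4,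
    Real.logb_div p5 (mul_ne_zero p1 p2), Real.logb_mul p1 p2]
  ring

/-- The test of destination `k` in slot one. -/
def Test1 (ε : ℝ) {n : ℕ} (k : Fin 2) (c : ∀ i, Fin n → X1 i) (z : Fin n → YR × (∀ k, Y1 k))
    (q : Fin n → YH) : Prop :=
  IsTypical ε (law (joint1 ch d) fun ω => (ω.1, ω.2.2.1 k, ω.2.2.2))
    fun t => ((fun i => c i t), (z t).2 k, q t)

/-- The test of destination `k` in slot two. -/
def Test2 (ε : ℝ) {m : ℕ} (k : Fin 2) (c : ∀ i, Fin m → X2 i) (z : Fin m → ∀ k, Y2 k)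
    (r : Fin m → XR) : Prop :=
  IsTypical ε (law (joint2 ch d) fun ω => (ω.1, ω.2.1, ω.2.2 k))
    fun t => ((fun i => c i t), r t, z t k)

/-- Error exponents `a1`, `a2` (relay index chosen by the relay) and `b1`, `b2` (another index)
of the two slots for wrong messages of the users in `I`, with their sensitivities to `ε`. -/
structure IsExponents (k : Fin 2) (I : Finset (Fin 2)) (a1 a1' a2 a2' b1 b1' b2 b2' : ℝ) :
    Prop where
  right1 : ∀ (n : ℕ) (ε : ℝ) (c : ∀ i, Fin n → X1 i) z q,
    (FinProb.pi fun i => FinProb.pi fun _ : Fin n => d.src1 i).E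
      (fun c' => ind (Test1 ch d ε k (I.piecewise c' c) z q)) ≤
      (2 : ℝ) ^ (-(n * (a1 - ε * a1')))
  right2 : ∀ (m : ℕ) (ε : ℝ) (c : ∀ i, Fin m → X2 i) z q,
    (FinProb.pi fun i => FinProb.pi fun _ : Fin m => d.src2 i).E
      (fun c' => ind (Test2 ch d ε k (I.piecewise c' c) z q)) ≤
      (2 : ℝ) ^ (-(m * (a2 - ε * a2')))
  wrong1 : ∀ (n : ℕ) (ε : ℝ) (c : ∀ i, Fin n → X1 i) z,
    (FinProb.pi fun i => FinProb.pi fun _ : Fin n => d.src1 i).E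
      (fun c' => (FinProb.pi fun _ : Fin n => quantLaw ch d).E fun q =>
        ind (Test1 ch d ε k (I.piecewise c' c) z q)) ≤
      (2 : ℝ) ^ (-(n * (b1 - ε * b1')))
  wrong2 : ∀ (m : ℕ) (ε : ℝ) (c : ∀ i, Fin m → X2 i) z,
    (FinProb.pi fun i => FinProb.pi fun _ : Fin m => d.src2 i).E
      (fun c' => (FinProb.pi fun _ : Fin m => d.rel).E fun q =>
        ind (Test2 ch d ε k (I.piecewise c' c) z q)) ≤
      (2 : ℝ) ^ (-(m * (b2 - ε * b2')))

/-- With the relay's own index only the letter of user `i` is fresh; with another index the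
quantization letter in slot one and the relay letter in slot two are fresh too. The surplus `β
I(Y_R; Ŷ_R)` in the second case reflects that a fresh quantization codeword is independent of
everything else. -/
lemma exists_exponents_single (β : ℝ) (k : Fin 2) {i j : Fin 2} (hij : i ≠ j) :
    ∃ a1 a1' a2 a2' b1 b1' b2 b2' : ℝ, IsExponents ch d k {i} a1 a1' a2 a2' b1 b1' b2 b2' ∧
      β * a1 + (1 - β) * a2 = boundA ch d β k i j ∧
      β * b1 + (1 - β) * b2 = boundB ch d β k i j + β * quantInfo ch d := by
  obtain ⟨b0⟩ := (quantLaw ch d).nonempty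
  obtain ⟨r0⟩ := d.rel.nonempty
  have h1 := fun (n : ℕ) (ε : ℝ) (c : ∀ i, Fin n → X1 i)
      (z : Fin n → YR × (∀ k, Y1 k)) (q : Fin n → YH) =>
      E_fresh_words_le (law1 ch d) (fun ω => (ω.1, ω.2.2.1 k, ω.2.2.2)) d.src1
      (fun ω => ω.1) (fun ω hω => law1_src_ne_zero ch d hω) {i} (fun γ => γ.1 i)
      (fun γ => (γ.1 j, γ.2.1, γ.2.2)) (fun a => a i) (fun ω => rfl) (fun x s => (x, s.1, s.2))
      (fun a c s => by simp) (fun a c s => by simp [hij.symm]) ε c (fun t => ((z t).2 k, q t))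
  have h2 := fun (m : ℕ) (ε : ℝ) (c : ∀ i, Fin m → X2 i) (z : Fin m → ∀ k, Y2 k) (q : Fin m → XR) =>
      E_fresh_words_le (law2 ch d) (fun ω => (ω.1, ω.2.1, ω.2.2 k)) d.src2
      (fun ω => ω.1) (fun ω hω => law2_src_ne_zero ch d hω) {i} (fun γ => γ.1 i)
      (fun γ => (γ.1 j, γ.2.1, γ.2.2)) (fun a => a i) (fun ω => rfl) (fun x s => (x, s.1, s.2))
      (fun a c s => by simp) (fun a c s => by simp [hij.symm]) ε c (fun t => (q t, z t k))
  have h3 := fun (n : ℕ) (ε : ℝ) (c : ∀ i, Fin n → X1 i) (z : Fin n → YR × (∀ k, Y1 k)) =>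
      E_fresh_words_relay_le (law1 ch d) (fun ω => (ω.1, ω.2.2.1 k, ω.2.2.2)) d.src1
      (quantLaw ch d) (fun ω => (ω.1, ω.2.2.2)) (fun ω hω => law1_src_quant_ne_zero ch d hω) {i}
      (fun γ => (γ.1 i, γ.2.2)) (fun γ => (γ.1 j, γ.2.1)) (fun a => (a.1 i, a.2)) (fun ω => rfl)
      (fun x s b => (x, s, b)) (fun a c s b => by simp) b0
      (fun a c s b => by simp [hij.symm]) ε c (fun t => (z t).2 k)
  have h4 := fun (m : ℕ) (ε : ℝ) (c : ∀ i, Fin m → X2 i) (z : Fin m → ∀ k, Y2 k) =>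
      E_fresh_words_relay_le (law2 ch d) (fun ω => (ω.1, ω.2.1, ω.2.2 k)) d.src2
      d.rel (fun ω => (ω.1, ω.2.1)) (fun ω hω => law2_src_rel_ne_zero ch d hω) {i}
      (fun γ => (γ.1 i, γ.2.1)) (fun γ => (γ.1 j, γ.2.2)) (fun a => (a.1 i, a.2)) (fun ω => rfl)
      (fun x s b => (x, b, s)) (fun a c s b => by simp) r0
      (fun a c s b => by simp [hij.symm]) ε c (fun t => z t k)
  refine ⟨_, _, _, _, _, _, _, _, ⟨h1, h2, h3, h4⟩, ?_, ?_⟩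
  · rw [boundA, show joint1 ch d = (law1 ch d).w from rfl,
      show joint2 ch d = (law2 ch d).w from rfl, mutualInfo_eq_divergence,
      mutualInfo_eq_divergence, map_law1_src ch d fun a => a i, map_law2_src' ch d fun a => a i]
  · rw [divergence_wrong_index_single, boundB, show joint2 ch d = (law2 ch d).w from rfl,
      mutualInfo_eq_divergence _ _ fun ω : Slot2 X2 XR Y2 => (ω.1 j, ω.2.2 k),
      map_law2_src ch d fun a => (a.1 i, a.2)]
    ring

lemma exists_exponents_both (β : ℝ) (k : Fin 2) :
    ∃ a1 a1' a2 a2' b1 b1' b2 b2' : ℝ,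
      IsExponents ch d k Finset.univ a1 a1' a2 a2' b1 b1' b2 b2' ∧
      β * a1 + (1 - β) * a2 = boundC ch d β k ∧
      β * b1 + (1 - β) * b2 = boundD ch d β k + β * quantInfo ch d := by
  obtain ⟨b0⟩ := (quantLaw ch d).nonempty
  obtain ⟨r0⟩ := d.rel.nonempty
  have h1 := fun (n : ℕ) (ε : ℝ) (c : ∀ i, Fin n → X1 i)
      (z : Fin n → YR × (∀ k, Y1 k)) (q : Fin n → YH) =>
      E_fresh_words_le (law1 ch d) (fun ω => (ω.1, ω.2.2.1 k, ω.2.2.2)) d.src1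
      (fun ω => ω.1) (fun ω hω => law1_src_ne_zero ch d hω) Finset.univ
      (fun γ => (γ.1 0, γ.1 1)) (fun γ => (γ.2.1, γ.2.2)) (fun a => (a 0, a 1)) (fun ω => rfl)
      (fun x s => (x, s.1, s.2))
      (fun a c s => by simp) (fun a c s => by simp) ε c (fun t => ((z t).2 k, q t))
  have h2 := fun (m : ℕ) (ε : ℝ) (c : ∀ i, Fin m → X2 i) (z : Fin m → ∀ k, Y2 k) (q : Fin m → XR) =>
      E_fresh_words_le (law2 ch d) (fun ω => (ω.1, ω.2.1, ω.2.2 k)) d.src2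
      (fun ω => ω.1) (fun ω hω => law2_src_ne_zero ch d hω) Finset.univ
      (fun γ => (γ.1 0, γ.1 1)) (fun γ => (γ.2.1, γ.2.2)) (fun a => (a 0, a 1)) (fun ω => rfl)
      (fun x s => (x, s.1, s.2))
      (fun a c s => by simp) (fun a c s => by simp) ε c (fun t => (q t, z t k))
  have h3 := fun (n : ℕ) (ε : ℝ) (c : ∀ i, Fin n → X1 i) (z : Fin n → YR × (∀ k, Y1 k)) =>
      E_fresh_words_relay_le (law1 ch d) (fun ω => (ω.1, ω.2.2.1 k, ω.2.2.2)) d.src1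
      (quantLaw ch d) (fun ω => (ω.1, ω.2.2.2)) (fun ω hω => law1_src_quant_ne_zero ch d hω)
      Finset.univ (fun γ => (γ.1 0, γ.1 1, γ.2.2)) (fun γ => γ.2.1)
      (fun a => (a.1 0, a.1 1, a.2)) (fun ω => rfl)
      (fun x s b => (x, s, b)) (fun a c s b => by simp) b0
      (fun a c s b => by simp) ε c (fun t => (z t).2 k)
  have h4 := fun (m : ℕ) (ε : ℝ) (c : ∀ i, Fin m → X2 i) (z : Fin m → ∀ k, Y2 k) =>
      E_fresh_words_relay_le (law2 ch d) (fun ω => (ω.1, ω.2.1, ω.2.2 k)) d.src2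
      d.rel (fun ω => (ω.1, ω.2.1)) (fun ω hω => law2_src_rel_ne_zero ch d hω) Finset.univ
      (fun γ => (γ.1 0, γ.1 1, γ.2.1)) (fun γ => γ.2.2) (fun a => (a.1 0, a.1 1, a.2))
      (fun ω => rfl) (fun x s b => (x, b, s)) (fun a c s b => by simp) r0
      (fun a c s b => by simp) ε c (fun t => z t k)
  refine ⟨_, _, _, _, _, _, _, _, ⟨h1, h2, h3, h4⟩, ?_, ?_⟩
  · rw [boundC, show joint1 ch d = (law1 ch d).w from rfl,
      show joint2 ch d = (law2 ch d).w from rfl, mutualInfo_eq_divergence,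
      mutualInfo_eq_divergence, map_law1_src ch d fun a => (a 0, a 1),
      map_law2_src' ch d fun a => (a 0, a 1)]
  · rw [divergence_wrong_index_both, boundD, show joint2 ch d = (law2 ch d).w from rfl,
      mutualInfo_eq_divergence _ _ fun ω : Slot2 X2 XR Y2 => ω.2.2 k,
      map_law2_src ch d fun a => (a.1 0, a.1 1, a.2)]
    ring

end Joint

/-! ### Conditional typicality -/

section Kernel

variable {Λ Γ : Type*} [Fintype Λ] [Fintype Γ]

/-- The constant in the bound for the probability of a sequence that is not typical. -/
def typConst (p : Γ → ℝ) (δ : ℝ) : ℝ := ∑ γ, 2 / (δ ^ 2 * p γ)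

lemma typConst_nonneg {p : Γ → ℝ} (δ : ℝ) (hp : ∀ γ, 0 ≤ p γ) : 0 ≤ typConst p δ :=
  Finset.sum_nonneg fun γ _ => div_nonneg zero_le_two (mul_nonneg (sq_nonneg _) (hp γ))

/-- The output of a memoryless channel whose input is typical is typical with high
probability. -/
lemma E_not_typical_kernel_le (p : FinProb Λ) (ν : Λ → FinProb Γ) (p' : FinProb Γ)
    (hp' : ∀ f, p'.E f = p.E fun l => (ν l).E f) {n : ℕ} (hn : 0 < n) {ε' ε : ℝ} (h1 : ε' ≤ 1)
    (hε : ε' < ε) {s : Fin n → Λ} (hs : IsTypical ε' p.w s) :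
    (FinProb.pi fun t => ν (s t)).E (fun x => ind (¬IsTypical ε p'.w x)) ≤
      typConst p'.w (ε - ε') / n := by
  refine E_not_typical_le hn _ p'.nonneg h1 hε fun γ => ?_
  -- Averaging the output probabilities of `γ` along a typical input puts the expected count of `γ`
  -- within the same relative tolerance `ε'`.
  have h := hs.abs_sum_sub_le fun l => (ν l).w γ
  have e : ∑ l, p.w l * (ν l).w γ = p'.w γ := by
    rw [p'.w_eq_E, hp']
    simp only [← FinProb.w_eq_E]
    rfl
  simp only [abs_of_nonneg ((ν _).nonneg γ), e] at h
  exact h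

/-- An i.i.d. sequence is typical with high probability. -/
lemma E_not_typical_iid_le (p : FinProb Γ) {n : ℕ} (hn : 0 < n) {ε : ℝ} (hε : 0 < ε) :
    (FinProb.pi fun _ : Fin n => p).E (fun x => ind (¬IsTypical ε p.w x)) ≤
      typConst p.w ε / n := by
  have := E_not_typical_le hn (fun _ : Fin n => p) p.nonneg (zero_le_one' ℝ) hε fun γ => by simp
  rwa [sub_zero] at this

/-- The relay selects a good index unless there is none. -/
lemma select_E_le {U : Type*} [Fintype U] [Nonempty U] (G : U → Prop) (f : U → ℝ) {η : ℝ}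
    (hη : 0 ≤ η) (hf : ∀ u, f u ≤ 1) (hG : ∀ u, G u → f u ≤ η) :
    (select G).E f ≤ η + ind (∀ u, ¬G u) := by
  by_cases h : ∃ u, G u
  · refine le_add_of_le_of_nonneg ?_ (ind_nonneg _)
    rw [← (select G).E_const η]
    refine Finset.sum_le_sum fun u _ => ?_
    by_cases hu : G u
    · exact mul_le_mul_of_nonneg_left (hG u hu) ((select G).nonneg u)
    · simp [select_eq_zero hu h]
  · push Not at h
    rw [ind_of h]
    exact ((select G).E_le_const hf).trans (by linarith)

end Kernel

/-! ### The transmitted codewords: covering and the Markov lemma -/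

section Truth

variable {X1 X2 : Fin 2 → Type*} {XR YR YH : Type*} {Y1 Y2 : Fin 2 → Type*}
  [∀ i, Fintype (X1 i)] [∀ i, Fintype (X2 i)] [Fintype XR] [Fintype YR] [Fintype YH]
  [∀ k, Fintype (Y1 k)] [∀ k, Fintype (Y2 k)]
  (ch : Channel X1 X2 XR YR Y1 Y2) (d : InputDist X1 X2 XR YR YH)

/-- The channel of slot one, used `n` times. -/
def chan1 (n : ℕ) (c : ∀ i, Fin n → X1 i) : FinProb (Fin n → YR × (∀ k, Y1 k)) :=
  FinProb.pi fun t => FinProb.ofPMF (ch.slot1 fun i => c i t)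

/-- The channel of slot two, used `m` times. -/
def chan2 (m : ℕ) (c : ∀ i, Fin m → X2 i) (r : Fin m → XR) : FinProb (Fin m → ∀ k, Y2 k) :=
  FinProb.pi fun t => FinProb.ofPMF (ch.slot2 (fun i => c i t) (r t))

/-- The i.i.d. law of sequences. -/
abbrev iid {Γ : Type*} [Fintype Γ] (n : ℕ) (p : FinProb Γ) : FinProb (Fin n → Γ) :=
  FinProb.pi fun _ => p

/-- The transmitted codewords pass the test of slot two. -/
lemma E_not_Test2_le {ε : ℝ} (hε : 0 < ε) (k : Fin 2) {m : ℕ} (hm : 0 < m) :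
    ((FinProb.pi fun i => iid m (d.src2 i)).E fun c => (iid m d.rel).E fun r =>
      (chan2 ch m c r).E fun z => ind (¬Test2 ch d ε k c z r)) ≤
      typConst (law (joint2 ch d) fun ω => (ω.1, ω.2.1, ω.2.2 k)) ε / m := by
  let g : ((∀ i, X2 i) × XR) × (∀ k, Y2 k) → (∀ i, X2 i) × XR × Y2 k :=
    fun y => (y.1.1, y.1.2, y.2 k)
  let p := law (joint2 ch d) fun ω => (ω.1, ω.2.1, ω.2.2 k)
  let J := ((FinProb.pi d.src2).prod d.rel).compProd fun y => FinProb.ofPMF (ch.slot2 y.1 y.2)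
  -- Transposing users and time and merging the three random stages turns the transmission into one
  -- i.i.d. sequence with letter law `J`.
  have e1 := FinProb.E_pi_comm (fun i (_ : Fin m) => d.src2 i) fun a => (iid m d.rel).E fun r =>
    (FinProb.pi fun t => FinProb.ofPMF (ch.slot2 (a t) (r t))).E fun z =>
      ind (¬IsTypical ε p fun t => (a t, r t, z t k))
  have e2 := FinProb.E_pi_compProd (fun _ : Fin m => FinProb.pi d.src2) (fun _ _ => d.rel)
    fun y => (FinProb.pi fun t => FinProb.ofPMF (ch.slot2 (y t).1 (y t).2)).E fun z =>
      ind (¬IsTypical ε p fun t => ((y t).1, (y t).2, z t k))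
  have e3 := FinProb.E_pi_compProd (fun _ : Fin m => (FinProb.pi d.src2).prod d.rel)
    (fun _ y => FinProb.ofPMF (ch.slot2 y.1 y.2)) fun y => ind (¬IsTypical ε p fun t => g (y t))
  have e4 := FinProb.E_map (FinProb.pi fun _ : Fin m => J) (fun y t => g (y t))
    fun x => ind (¬IsTypical ε p x)
  rw [FinProb.map_pi (fun _ : Fin m => J) fun _ => g] at e4
  have e5 : J.map g = (law2 ch d).map fun ω => (ω.1, ω.2.1, ω.2.2 k) :=
    FinProb.ext_E fun f => by simp only [FinProb.E_map, J, FinProb.E_compProd, E_law2, g]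
  refine le_of_eq_of_le (e1.trans (e2.trans (e3.trans e4.symm))) ?_
  rw [e5]
  exact E_not_typical_iid_le ((law2 ch d).map fun ω => (ω.1, ω.2.1, ω.2.2 k)) hm hε

/-- The law of the relay observation. -/
def obsLaw : FinProb YR := (law1 ch d).map fun ω => ω.2.1

/-- The conditional law of the inputs and of the outputs at the destinations, given the relay
observation. -/
lemma exists_backward_channel : ∃ κ : YR → FinProb ((∀ i, X1 i) × (∀ k, Y1 k)),
    ((FinProb.pi d.src1).compProd fun x => FinProb.ofPMF (ch.slot1 x)).map
      (fun p => (p.2.1, p.1, p.2.2)) = (obsLaw ch d).compProd κ := by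
  obtain ⟨κ, hκ⟩ := (((FinProb.pi d.src1).compProd fun x => FinProb.ofPMF (ch.slot1 x)).map
      (fun p => (p.2.1, p.1, p.2.2))).exists_kernel
  refine ⟨κ, hκ.trans ?_⟩
  congr 1
  exact FinProb.ext_E fun f => by
    simp only [obsLaw, FinProb.E_map, FinProb.E_compProd, E_law1, FinProb.E_const]

/-- The relay observation and its quantization. -/
abbrev quantPair : (Slot1 X1 YR Y1 YH) → YR × YH := fun ω => (ω.2.1, ω.2.2.2)

/-- Joint typicality of a relay observation and a quantization codeword. -/
def Quantizes (ε : ℝ) {n : ℕ} (y : Fin n → YR) (q : Fin n → YH) : Prop :=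
  IsTypical ε (law (joint1 ch d) quantPair) fun t => (y t, q t)

lemma map_quantPair :
    (law1 ch d).map quantPair = (obsLaw ch d).compProd fun y => FinProb.ofPMF (d.quant y) :=
  FinProb.ext_E fun f => by
    simp only [obsLaw, FinProb.E_map, FinProb.E_compProd, E_law1, FinProb.E_const]

/-- A codeword that quantizes the relay observation is jointly typical with the inputs and the
outputs at the destinations. -/
lemma E_backward_not_typical_le {κ : YR → FinProb ((∀ i, X1 i) × (∀ k, Y1 k))}
    (hκ : ((FinProb.pi d.src1).compProd fun x => FinProb.ofPMF (ch.slot1 x)).map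
      (fun p => (p.2.1, p.1, p.2.2)) = (obsLaw ch d).compProd κ) {ε' ε : ℝ} (h1 : ε' ≤ 1)
    (hε : ε' < ε) (k : Fin 2) {n : ℕ} (hn : 0 < n) {y : Fin n → YR} {q : Fin n → YH}
    (h : Quantizes ch d ε' y q) :
    (FinProb.pi fun t => κ (y t)).E (fun e => ind (¬IsTypical ε
      (law (joint1 ch d) fun ω => (ω.1, ω.2.2.1 k, ω.2.2.2))
        fun t => ((e t).1, (e t).2 k, q t))) ≤
      typConst (law (joint1 ch d) fun ω => (ω.1, ω.2.2.1 k, ω.2.2.2)) (ε - ε') / n := by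
  let p := law (joint1 ch d) fun ω => (ω.1, ω.2.2.1 k, ω.2.2.2)
  have e1 := FinProb.E_map (FinProb.pi fun t => κ (y t)) (fun e t => ((e t).1, (e t).2 k, q t))
    fun x => ind (¬IsTypical ε p x)
  rw [FinProb.map_pi (fun t => κ (y t)) fun t e => (e.1, e.2 k, q t)] at e1
  rw [← e1]
  -- The Markov chain enters here: the tested triple arises from the pair of observation and
  -- quantization by a kernel that reads the observation only and copies the quantized letter.
  -- Conditional typicality then applies to the typical pair `(y, q)`.
  have key : ∀ f, ((law1 ch d).map fun ω => (ω.1, ω.2.2.1 k, ω.2.2.2)).E f =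
      ((law1 ch d).map quantPair).E fun l =>
        ((κ l.1).map fun e => (e.1, e.2 k, l.2)).E f := fun f => ?_
  · exact E_not_typical_kernel_le ((law1 ch d).map quantPair)
      (fun l => (κ l.1).map fun e => (e.1, e.2 k, l.2))
      ((law1 ch d).map fun ω => (ω.1, ω.2.2.1 k, ω.2.2.2)) key hn h1 hε
      (s := fun t => (y t, q t)) h
  rw [map_quantPair, FinProb.E_compProd]
  simp only [FinProb.E_map]
  have e2 : ∀ y, ((FinProb.ofPMF (d.quant y)).E fun b => (κ y).E fun e => f (e.1, e.2 k, b)) =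
      (κ y).E fun e => (FinProb.ofPMF (d.quant y)).E fun b => f (e.1, e.2 k, b) := fun y =>
    FinProb.E_comm _ _ _
  simp only [e2]
  have e3 := FinProb.E_compProd (obsLaw ch d) κ fun p =>
    (FinProb.ofPMF (d.quant p.1)).E fun b => f (p.2.1, p.2.2 k, b)
  rw [← hκ, FinProb.E_map, FinProb.E_compProd] at e3
  rw [← e3, E_law1]

/-- The probability that a random codeword quantizes `y`. -/
def coverProb (ε : ℝ) {n : ℕ} (y : Fin n → YR) : ℝ :=
  (iid n (quantLaw ch d)).E fun q => ind (Quantizes ch d ε y q)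

/-- The transmitted codewords and the quantization codeword pass the test of slot one. -/
lemma E_not_Test1_le {U : Type*} [Fintype U] [DecidableEq U] [Nonempty U] {ε' ε : ℝ}
    (h1 : ε' ≤ 1) (hε : ε' < ε) (k : Fin 2) {n : ℕ} (hn : 0 < n) :
    ((FinProb.pi fun i => iid n (d.src1 i)).E fun c =>
      (FinProb.pi fun _ : U => iid n (quantLaw ch d)).E fun q => (chan1 ch n c).E fun z =>
        (select fun u => Quantizes ch d ε' (fun t => (z t).1) (q u)).E fun u =>
          ind (¬Test1 ch d ε k c z (q u))) ≤
      typConst (law (joint1 ch d) fun ω => (ω.1, ω.2.2.1 k, ω.2.2.2)) (ε - ε') / n +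
        (iid n (obsLaw ch d)).E fun y => (1 - coverProb ch d ε' y) ^ Fintype.card U := by
  obtain ⟨κ, hκ⟩ := exists_backward_channel ch d
  let p := law (joint1 ch d) fun ω => (ω.1, ω.2.2.1 k, ω.2.2.2)
  let ρ : (∀ i, X1 i) × YR × (∀ k, Y1 k) → YR × (∀ i, X1 i) × (∀ k, Y1 k) :=
    fun p => (p.2.1, p.1, p.2.2)
  let J := (FinProb.pi d.src1).compProd fun x => FinProb.ofPMF (ch.slot1 x)
  let f : (Fin n → YR) → (Fin n → (∀ i, X1 i) × (∀ k, Y1 k)) → (U → Fin n → YH) → ℝ :=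
    fun y e q => (select fun u => Quantizes ch d ε' y (q u)).E fun u =>
      ind (¬IsTypical ε p fun t => ((e t).1, (e t).2 k, q u t))
  -- For fixed quantization codewords, slot one is generated backwards: first the relay observation,
  -- i.i.d., then inputs and destination outputs through `κ`. The relay's choice uses only the
  -- former.
  have key : ∀ q, ((FinProb.pi fun i => iid n (d.src1 i)).E fun c => (chan1 ch n c).E fun z =>
      f (fun t => (z t).1) (fun t => ((fun i => c i t), (z t).2)) q) =
      (iid n (obsLaw ch d)).E fun y => (FinProb.pi fun t => κ (y t)).E fun e => f y e q := by
    intro q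
    have e1 := FinProb.E_pi_comm (fun i (_ : Fin n) => d.src1 i) fun a =>
      (FinProb.pi fun t => FinProb.ofPMF (ch.slot1 (a t))).E fun z =>
        f (fun t => (z t).1) (fun t => (a t, (z t).2)) q
    have e2 := FinProb.E_pi_compProd (fun _ : Fin n => FinProb.pi d.src1)
      (fun _ x => FinProb.ofPMF (ch.slot1 x)) fun y =>
        f (fun t => (ρ (y t)).1) (fun t => (ρ (y t)).2) q
    have e3 := FinProb.E_map (iid n J) (fun y t => ρ (y t))
      fun x => f (fun t => (x t).1) (fun t => (x t).2) q
    rw [FinProb.map_pi (fun _ : Fin n => J) fun _ => ρ] at e3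
    have e4 := FinProb.E_pi_compProd (fun _ : Fin n => obsLaw ch d) (fun _ => κ)
      fun x => f (fun t => (x t).1) (fun t => (x t).2) q
    rw [hκ] at e3
    exact e1.trans (e2.trans (e3.symm.trans e4.symm))
  rw [FinProb.E_comm]
  refine le_of_eq_of_le (congrArg _ (funext key)) ?_
  set η := typConst p (ε - ε') / n with hη
  have hη0 : 0 ≤ η := div_nonneg (typConst_nonneg _ fun γ => (law1 ch d).law_nonneg _ γ)
    (Nat.cast_nonneg n)
  have h2 : ∀ q y, ((FinProb.pi fun t => κ (y t)).E fun e => f y e q) ≤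
      η + ind (∀ u, ¬Quantizes ch d ε' y (q u)) := fun q y => by
    simp only [f]
    rw [FinProb.E_comm]
    exact select_E_le _ _ hη0 (fun u => FinProb.E_le_const _ fun e => ind_le_one _)
      fun u hu => E_backward_not_typical_le ch d hκ h1 hε k hn hu
  refine (FinProb.E_mono _ fun q => FinProb.E_mono _ (h2 q)).trans ?_
  rw [FinProb.E_comm]
  simp only [FinProb.E_add, FinProb.E_const]
  refine add_le_add le_rfl (FinProb.E_mono _ fun y => le_of_eq ?_)
  -- The codewords are independent, so the probability that none of them quantizes `y` is a power.
  simp only [ind_forall]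
  rw [FinProb.E_pi_prod (fun _ : U => iid n (quantLaw ch d))
    fun _ q => ind (¬Quantizes ch d ε' y q)]
  simp only [FinProb.E_ind_not]
  rw [Finset.prod_const, Finset.card_univ]
  rfl

/-- The mean absolute log-likelihood ratio between the relay observation and its
quantization. -/
def quantAbs : ℝ := ∑ γ : YR × YH, law (joint1 ch d) quantPair γ *
  |Real.logb 2 (law (joint1 ch d) quantPair γ / (law (joint1 ch d) (fun ω => ω.2.1) γ.1 *
    law (joint1 ch d) (fun ω => ω.2.2.2) γ.2))|

/-- A typical relay observation is quantized by a random codeword with probability about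
`2 ^ (-n I(Y_R; Ŷ_R))`. -/
lemma le_coverProb {ε : ℝ} (hε0 : 0 < ε) (hε1 : ε ≤ 1) {n : ℕ} (hn : 0 < n)
    (hn2 : typConst (law (joint1 ch d) quantPair) (ε / 2) / n ≤ 1 / 2) {y : Fin n → YR}
    (hy : IsTypical (ε / 2) (obsLaw ch d).w y) :
    (2 : ℝ)⁻¹ * (2 : ℝ) ^ (-(n * (quantInfo ch d + ε * quantAbs ch d))) ≤
      coverProb ch d ε y := by
  let κ : Fin n → FinProb YH := fun t => FinProb.ofPMF (d.quant (y t))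
  let P := (law1 ch d).map quantPair
  have e0 := E_not_typical_kernel_le (obsLaw ch d)
    (fun l => (FinProb.ofPMF (d.quant l)).map fun b => (l, b)) P
    (fun f => by rw [show P = _ from map_quantPair ch d, FinProb.E_compProd]
                 simp only [FinProb.E_map]) hn (by linarith)
    (show ε / 2 < ε by linarith) hy
  have e1 := FinProb.E_map (FinProb.pi κ) (fun b t => (y t, b t))
    fun x => ind (¬IsTypical ε P.w x)
  rw [FinProb.map_pi κ fun t b => (y t, b)] at e1
  rw [e1, show ε - ε / 2 = ε / 2 by ring, FinProb.E_ind_not] at e0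
  -- A codeword generated from `y` by the test channel is jointly typical with probability at least
  -- one half. Passing to the codeword law, which does not depend on `y`, costs the likelihood
  -- ratio, about `2 ^ (n I(Y_R; Ŷ_R))`.
  have h2 : (1 : ℝ) / 2 ≤ (FinProb.pi κ).E fun b => ind (IsTypical ε P.w fun t => (y t, b t)) := by
    have := e0.trans hn2
    linarith
  let g : YR × YH → ℝ := fun γ => law (joint1 ch d) quantPair γ /
    (law (joint1 ch d) (fun ω => ω.2.1) γ.1 * law (joint1 ch d) (fun ω => ω.2.2.2) γ.2)
  have hpos : ∀ γ, P.w γ ≠ 0 → 0 < law (joint1 ch d) quantPair γ ∧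
      0 < law (joint1 ch d) (fun ω => ω.2.1) γ.1 ∧
      0 < law (joint1 ch d) (fun ω => ω.2.2.2) γ.2 := fun γ hγ => by
    obtain ⟨ω, rfl, hω⟩ := (law1 ch d).exists_of_law_ne_zero hγ
    exact ⟨(law1 ch d).law_pos quantPair hω, (law1 ch d).law_pos (fun ω => ω.2.1) hω,
      (law1 ch d).law_pos (fun ω => ω.2.2.2) hω⟩
  have h3 := E_typical_le_mul (quantLaw ch d) κ P.w g ε (fun t b => (y t, b))
    (fun γ hγ => div_pos (hpos γ hγ).1 (mul_pos (hpos γ hγ).2.1 (hpos γ hγ).2.2))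
    (fun t b hb => by
      obtain ⟨-, p2, p3⟩ := hpos _ hb
      have e : law (joint1 ch d) quantPair (y t, b) =
          law (joint1 ch d) (fun ω => ω.2.1) (y t) * (κ t).w b :=
        law_quant_eq ch d (fun p => p.2.1) (y t) (y t) (fun _ h => h) b
      change _ = law (joint1 ch d) quantPair (y t, b) /
        (law (joint1 ch d) (fun ω => ω.2.1) (y t) * law (joint1 ch d) (fun ω => ω.2.2.2) b) *
          law (joint1 ch d) (fun ω => ω.2.2.2) b
      rw [e]
      have := p2.ne'
      have := p3.ne'
      field_simp)
  have e5 : ∑ γ, P.w γ * Real.logb 2 (g γ) = quantInfo ch d := by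
    rw [Fintype.sum_prod_type]
    rfl
  rw [e5] at h3
  have h4 := h2.trans h3
  rw [Real.rpow_neg zero_le_two, ← mul_inv, ← one_div, div_le_iff₀ (by positivity)]
  change (1 : ℝ) / 2 ≤ 2 ^ (n * (quantInfo ch d + ε * quantAbs ch d)) * coverProb ch d ε y at h4
  linarith

/-- The probability that no codeword quantizes the relay observation. -/
lemma E_not_covered_le {ε : ℝ} (hε0 : 0 < ε) (hε1 : ε ≤ 1) {n : ℕ} (hn : 0 < n)
    (hn2 : typConst (law (joint1 ch d) quantPair) (ε / 2) / n ≤ 1 / 2) (N : ℕ) :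
    ((iid n (obsLaw ch d)).E fun y => (1 - coverProb ch d ε y) ^ N) ≤
      typConst (obsLaw ch d).w (ε / 2) / n + Real.exp (-(N * ((2 : ℝ)⁻¹ *
        (2 : ℝ) ^ (-(n * (quantInfo ch d + ε * quantAbs ch d)))))) := by
  have hc0 : ∀ y : Fin n → YR, 0 ≤ coverProb ch d ε y := fun y =>
    FinProb.E_nonneg _ fun _ => ind_nonneg _
  have hc1 : ∀ y : Fin n → YR, coverProb ch d ε y ≤ 1 := fun y =>
    FinProb.E_le_const _ fun _ => ind_le_one _
  set K := (2 : ℝ)⁻¹ * (2 : ℝ) ^ (-(n * (quantInfo ch d + ε * quantAbs ch d))) with hK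
  have h : ∀ y : Fin n → YR, (1 - coverProb ch d ε y) ^ N ≤
      ind (¬IsTypical (ε / 2) (obsLaw ch d).w y) + Real.exp (-(N * K)) := fun y => by
    by_cases hy : IsTypical (ε / 2) (obsLaw ch d).w y
    · rw [ind_of_not (not_not.2 hy), zero_add]
      have h1 := le_coverProb ch d hε0 hε1 hn hn2 hy
      calc (1 - coverProb ch d ε y) ^ N ≤ Real.exp (-K) ^ N := by
            refine pow_le_pow_left₀ (by linarith [hc1 y]) ?_ N
            have := Real.one_sub_le_exp_neg K
            linarith
        _ = _ := by rw [← Real.exp_nat_mul]; congr 1; ring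
    · rw [ind_of hy]
      have := pow_le_one₀ (n := N) (by linarith [hc1 y]) (by linarith [hc0 y] :
        1 - coverProb ch d ε y ≤ 1)
      linarith [Real.exp_pos (-(N * K))]
  refine (FinProb.E_mono _ h).trans ?_
  rw [FinProb.E_add, FinProb.E_const]
  exact add_le_add (E_not_typical_iid_le _ hn (by linarith)) le_rfl

end Truth

/-! ### From the abstract random scheme to codebooks of the channel -/

section Link

variable {X1 X2 : Fin 2 → Type*} {XR YR YH : Type*} {Y1 Y2 : Fin 2 → Type*}
  [∀ i, Fintype (X1 i)] [∀ i, Fintype (X2 i)] [Fintype XR] [Fintype YR] [Fintype YH]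
  [∀ k, Fintype (Y1 k)] [∀ k, Fintype (Y2 k)]
  (ch : Channel X1 X2 XR YR Y1 Y2) (d : InputDist X1 X2 XR YR YH)

lemma FinProb.ofPMF_map {A B : Type*} [Fintype A] [Fintype B] (p : PMF A) (f : A → B) :
    ofPMF (p.map f) = (ofPMF p).map f := by
  classical
  ext b
  simp only [ofPMF, map, law, PMF.map_apply, tsum_fintype]
  rw [ENNReal.toReal_sum fun a _ => by split_ifs <;> simp [p.apply_ne_top]]
  refine Finset.sum_congr rfl fun a _ => ?_
  by_cases h : f a = b
  · simp [h]
  · simp [h, Ne.symm h]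

lemma ofPMF_relayIndex (ε : ℝ) {M : Fin 2 → ℕ} {MU n m : ℕ} [NeZero MU]
    (cb : GQFCodebook X1 X2 XR YH M MU n m) (y : Fin n → YR) :
    FinProb.ofPMF (relayIndex ch d ε cb y) =
      select fun u => Quantizes ch d ε y (cb.cwQ u) := by
  classical
  ext u
  by_cases h : (Finset.univ.filter (IsQuantization ch d ε cb y)).Nonempty
  · have h' : (Finset.univ.filter fun u => Quantizes ch d ε y (cb.cwQ u)).Nonempty := h
    rw [relayIndex, dif_pos h, select, dif_pos h']
    simp only [FinProb.ofPMF, FinProb.uniformOn, PMF.uniformOfFinset_apply, Finset.mem_filter,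
      Finset.mem_univ, true_and]
    by_cases hu : IsQuantization ch d ε cb y u
    · rw [if_pos hu, if_pos (show Quantizes ch d ε y (cb.cwQ u) from hu), ENNReal.toReal_inv,
        ENNReal.toReal_natCast]
      rfl
    · rw [if_neg hu, if_neg (show ¬Quantizes ch d ε y (cb.cwQ u) from hu), ENNReal.toReal_zero]
  · have h' : ¬(Finset.univ.filter fun u => Quantizes ch d ε y (cb.cwQ u)).Nonempty := h
    rw [relayIndex, dif_neg h, select, dif_neg h']
    simp [FinProb.ofPMF, FinProb.uniformOn, PMF.uniformOfFintype_apply]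

/-- The codebook of the scheme that consists of the given codewords. -/
def toCodebook {M : Fin 2 → ℕ} {MU n m : ℕ}
    (b : Book (fun i => Fin (M i)) (Fin MU) (fun i => Fin n → X1 i) (Fin n → YH) ×
      Book (fun i => Fin (M i)) (Fin MU) (fun i => Fin m → X2 i) (Fin m → XR)) :
    GQFCodebook X1 X2 XR YH M MU n m := ⟨b.1.1, b.2.1, b.1.2, b.2.2⟩

lemma E_chan1 {n : ℕ} (c : ∀ i, Fin n → X1 i) (f : (Fin n → YR × (∀ k, Y1 k)) → ℝ) :
    (chan1 ch n c).E f = ∑ yR : Fin n → YR, ∑ y1 : (∀ k, Fin n → Y1 k),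
      (∏ t, (ch.slot1 (fun i => c i t) (yR t, fun k => y1 k t)).toReal) *
        f fun t => (yR t, fun k => y1 k t) := by
  let e : (Fin n → YR × (∀ k, Y1 k)) ≃ (Fin n → YR) × (∀ k, Fin n → Y1 k) :=
    ⟨fun z => (fun t => (z t).1, fun k t => (z t).2 k), fun p t => (p.1 t, fun k => p.2 k t),
      fun _ => rfl, fun _ => rfl⟩
  rw [FinProb.E, ← e.symm.sum_comp, Fintype.sum_prod_type]
  rfl

lemma E_chan2 {m : ℕ} (c : ∀ i, Fin m → X2 i) (r : Fin m → XR)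
    (f : (Fin m → ∀ k, Y2 k) → ℝ) :
    (chan2 ch m c r).E f = ∑ y2 : (∀ k, Fin m → Y2 k),
      (∏ t, (ch.slot2 (fun i => c i t) (r t) (fun k => y2 k t)).toReal) *
        f fun t k => y2 k t := by
  let e : (Fin m → ∀ k, Y2 k) ≃ (∀ k, Fin m → Y2 k) :=
    ⟨fun z k t => z t k, fun p t k => p k t, fun _ => rfl, fun _ => rfl⟩
  rw [FinProb.E, ← e.symm.sum_comp]
  rfl

/-- The error probability of the scheme in terms of the tests of the destinations. -/
lemma errorProb_toCodebook_le (ε' ε : ℝ) {M : Fin 2 → ℕ} {MU n m : ℕ} [NeZero MU]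
    (b : Book (fun i => Fin (M i)) (Fin MU) (fun i => Fin n → X1 i) (Fin n → YH) ×
      Book (fun i => Fin (M i)) (Fin MU) (fun i => Fin m → X2 i) (Fin m → XR)) :
    errorProb ch ((toCodebook b).toRandCode ch d ε' ε) ≤
      ∑ w : (∀ i, Fin (M i)), (∏ i, (M i : ℝ)⁻¹) *
        (run (chan1 ch n) (fun z q => Quantizes ch d ε' (fun t => (z t).1) q) (chan2 ch m) w b).E
          fun ζ => ind (∃ k, ¬(Passes (Test1 ch d ε k) (Test2 ch d ε k) b ζ.1 ζ.2.2 w ∧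
            ∀ v, Passes (Test1 ch d ε k) (Test2 ch d ε k) b ζ.1 ζ.2.2 v → v = w)) := by
  classical
  rw [errorProb]
  refine Finset.sum_le_sum fun w _ => mul_le_mul_of_nonneg_left ?_
    (Finset.prod_nonneg fun i _ => by positivity)
  rw [E_run _ _ _ _ _ fun z _ z2 => ind (∃ k, ¬(Passes (Test1 ch d ε k) (Test2 ch d ε k) b z z2 w ∧
            ∀ v, Passes (Test1 ch d ε k) (Test2 ch d ε k) b z z2 v → v = w)), E_chan1]
  refine Finset.sum_le_sum fun yR _ => Finset.sum_le_sum fun y1 _ =>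
    mul_le_mul_of_nonneg_left ?_ (Finset.prod_nonneg fun t _ => ENNReal.toReal_nonneg)
  let H : (Fin m → XR) → ℝ := fun xR => ∑ y2 : (∀ k, Fin m → Y2 k),
    (∏ t, (ch.slot2 (fun i => b.2.word w i t) (xR t) (fun k => y2 k t)).toReal) *
    (if ∃ k, ((toCodebook b).toRandCode ch d ε' ε).dec k (y1 k) (y2 k) ≠ some w then 1 else 0)
  have e1 : (∑ xR : Fin m → XR, (((toCodebook b).toRandCode ch d ε' ε).relay yR xR).toReal *
      H xR) = (select fun u => Quantizes ch d ε' yR (b.1.2 u)).E fun u => H (b.2.2 u) := by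
    have := FinProb.ofPMF_map (relayIndex ch d ε' (toCodebook b) yR) (toCodebook b).cwR
    rw [ofPMF_relayIndex] at this
    have e2 := congrArg (fun P => FinProb.E P H) this
    simp only [FinProb.E_map] at e2
    exact e2
  refine e1.le.trans (FinProb.E_mono _ fun u => ?_)
  rw [E_chan2]
  refine Finset.sum_le_sum fun y2 _ => mul_le_mul_of_nonneg_left ?_
    (Finset.prod_nonneg fun t _ => ENNReal.toReal_nonneg)
  split_ifs with h
  · obtain ⟨k, hk⟩ := h
    rw [ind_of]
    refine ⟨k, fun ⟨h1, h2⟩ => hk ?_⟩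
    have h3 : ∃! v, IsCandidate ch d ε (toCodebook b) k (y1 k) (y2 k) v := ⟨w, h1, h2⟩
    simp only [GQFCodebook.toRandCode]
    rw [dif_pos h3, h3.unique h3.choose_spec.1 h1]
  · exact ind_nonneg _

/-- Some codebook has an error probability at most the bound for random codebooks. -/
lemma exists_codebook_le {a1 a1' a2 a2' b1 b1' b2 b2' : Fin 2 → Finset (Fin 2) → ℝ}
    (hexp : ∀ k I, I ≠ ∅ → IsExponents ch d k I (a1 k I) (a1' k I) (a2 k I) (a2' k I)
      (b1 k I) (b1' k I) (b2 k I) (b2' k I)) {ε' ε : ℝ} (hε0 : 0 < ε') (hε : ε' < ε)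
    (hε1 : ε < 1) {M : Fin 2 → ℕ} [∀ i, NeZero (M i)] {MU n m : ℕ} [NeZero MU] (hn : 0 < n)
    (hm : 0 < m) (hn2 : typConst (law (joint1 ch d) quantPair) (ε' / 2) / n ≤ 1 / 2) :
    ∃ cb : GQFCodebook X1 X2 XR YH M MU n m, errorProb ch (cb.toRandCode ch d ε' ε) ≤
      ∑ k : Fin 2, (((∑ k : Fin 2,
        typConst (law (joint1 ch d) fun ω => (ω.1, ω.2.2.1 k, ω.2.2.2)) (ε - ε')) / n +
        (typConst (obsLaw ch d).w (ε' / 2) / n + Real.exp (-(MU * ((2 : ℝ)⁻¹ *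
        (2 : ℝ) ^ (-(n * (quantInfo ch d + ε' * quantAbs ch d)))))))) +
        (∑ k : Fin 2, typConst (law (joint2 ch d) fun ω => (ω.1, ω.2.1, ω.2.2 k)) ε) / m +
        ∑ I ∈ Finset.univ.erase ∅, (∏ i ∈ I, (M i : ℝ)) *
          ((2 : ℝ) ^ (-(n * (a1 k I - ε * a1' k I))) * (2 : ℝ) ^ (-(m * (a2 k I - ε * a2' k I))) +
          MU * ((2 : ℝ) ^ (-(n * (b1 k I - ε * b1' k I))) *
            (2 : ℝ) ^ (-(m * (b2 k I - ε * b2' k I)))))) := by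
  set B := ∑ k : Fin 2, (((∑ k : Fin 2,
        typConst (law (joint1 ch d) fun ω => (ω.1, ω.2.2.1 k, ω.2.2.2)) (ε - ε')) / n +
        (typConst (obsLaw ch d).w (ε' / 2) / n + Real.exp (-(MU * ((2 : ℝ)⁻¹ *
        (2 : ℝ) ^ (-(n * (quantInfo ch d + ε' * quantAbs ch d)))))))) +
        (∑ k : Fin 2, typConst (law (joint2 ch d) fun ω => (ω.1, ω.2.1, ω.2.2 k)) ε) / m +
        ∑ I ∈ Finset.univ.erase ∅, (∏ i ∈ I, (M i : ℝ)) *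
          ((2 : ℝ) ^ (-(n * (a1 k I - ε * a1' k I))) * (2 : ℝ) ^ (-(m * (a2 k I - ε * a2' k I))) +
          MU * ((2 : ℝ) ^ (-(n * (b1 k I - ε * b1' k I))) *
            (2 : ℝ) ^ (-(m * (b2 k I - ε * b2' k I)))))) with hB
  let P := (bookLaw (fun i => Fin (M i)) (Fin MU) (fun i => iid n (d.src1 i))
      (iid n (quantLaw ch d))).prod
    (bookLaw (fun i => Fin (M i)) (Fin MU) (fun i => iid m (d.src2 i)) (iid m d.rel))
  have hw : ∀ w : (∀ i, Fin (M i)), P.E (fun b =>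
      (run (chan1 ch n) (fun z q => Quantizes ch d ε' (fun t => (z t).1) q) (chan2 ch m) w b).E
          fun ζ => ind (∃ k, ¬(Passes (Test1 ch d ε k) (Test2 ch d ε k) b ζ.1 ζ.2.2 w ∧
            ∀ v, Passes (Test1 ch d ε k) (Test2 ch d ε k) b ζ.1 ζ.2.2 v → v = w))) ≤ B := by
    intro w
    have key := E_not_unique_le (U := Fin MU) (fun i => iid n (d.src1 i))
      (fun i => iid m (d.src2 i)) (iid n (quantLaw ch d)) (iid m d.rel) (chan1 ch n)
      (fun z q => Quantizes ch d ε' (fun t => (z t).1) q) (chan2 ch m) w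
      (Test1 ch d ε) (Test2 ch d ε)
      (fun k I => (2 : ℝ) ^ (-(n * (a1 k I - ε * a1' k I))))
      (fun k I => (2 : ℝ) ^ (-(m * (a2 k I - ε * a2' k I))))
      (fun k I => (2 : ℝ) ^ (-(n * (b1 k I - ε * b1' k I))))
      (fun k I => (2 : ℝ) ^ (-(m * (b2 k I - ε * b2' k I))))
      (fun _ _ => by positivity) (fun _ _ => by positivity) (fun _ _ => by positivity)
      (fun _ _ => by positivity)
      ((∑ k : Fin 2,
        typConst (law (joint1 ch d) fun ω => (ω.1, ω.2.2.1 k, ω.2.2.2)) (ε - ε')) / n +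
        (typConst (obsLaw ch d).w (ε' / 2) / n + Real.exp (-(MU * ((2 : ℝ)⁻¹ *
        (2 : ℝ) ^ (-(n * (quantInfo ch d + ε' * quantAbs ch d))))))))
      ((∑ k : Fin 2, typConst (law (joint2 ch d) fun ω => (ω.1, ω.2.1, ω.2.2 k)) ε) / m)
      (fun k I hI => (hexp k I hI).right1 n ε) (fun k I hI => (hexp k I hI).right2 m ε)
      (fun k I hI => (hexp k I hI).wrong1 n ε) (fun k I hI => (hexp k I hI).wrong2 m ε)
      (fun k => by
        refine (E_not_Test1_le ch d (U := Fin MU) (hε.trans hε1).le hε k hn).trans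
          (add_le_add ?_ ?_)
        · refine div_le_div_of_nonneg_right ?_ (Nat.cast_nonneg n)
          exact Finset.single_le_sum (f := fun k => typConst
            (law (joint1 ch d) fun ω => (ω.1, ω.2.2.1 k, ω.2.2.2)) (ε - ε'))
            (fun k _ => typConst_nonneg _ fun γ => (law1 ch d).law_nonneg _ γ) (Finset.mem_univ k)
        · rw [Fintype.card_fin]
          exact E_not_covered_le ch d hε0 (hε.trans hε1).le hn hn2 MU)
      (fun k => by
        refine (E_not_Test2_le ch d (hε0.trans hε) k hm).trans ?_
        refine div_le_div_of_nonneg_right ?_ (Nat.cast_nonneg m)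
        exact Finset.single_le_sum (f := fun k => typConst
            (law (joint2 ch d) fun ω => (ω.1, ω.2.1, ω.2.2 k)) ε)
            (fun k _ => typConst_nonneg _ fun γ => (law2 ch d).law_nonneg _ γ) (Finset.mem_univ k))
    simp only [Fintype.card_fin] at key
    exact key
  -- The bound `B` holds for every message pair, so it holds for the average over messages, and some
  -- codebook is no worse than the mean.
  obtain ⟨b, hb⟩ := P.exists_le_E fun b =>
    errorProb ch ((toCodebook b).toRandCode ch d ε' ε)
  refine ⟨toCodebook b, hb.trans ((P.E_mono fun b => errorProb_toCodebook_le ch d ε' ε b).trans ?_)⟩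
  rw [FinProb.E_sum]
  simp only [FinProb.E_const_mul]
  calc _ ≤ ∑ w : (∀ i, Fin (M i)), (∏ i, (M i : ℝ)⁻¹) * B :=
        Finset.sum_le_sum fun w _ => mul_le_mul_of_nonneg_left (hw w)
          (Finset.prod_nonneg fun i _ => by positivity)
    _ = B := by
      rw [Finset.sum_const, Finset.card_univ, Fintype.card_pi, nsmul_eq_mul, ← mul_assoc,
        Nat.cast_prod, ← Finset.prod_mul_distrib]
      simp only [Fintype.card_fin]
      rw [Finset.prod_eq_one fun i _ => mul_inv_cancel₀ (Nat.cast_ne_zero.2 (NeZero.ne (M i))),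
        one_mul]

end Link

/-! ### Removing the randomness of the relay -/

section Derandomization

variable {X1 X2 : Fin 2 → Type*} {XR YR : Type*} {Y1 Y2 : Fin 2 → Type*}
  [Fintype XR] [Fintype YR] [∀ k, Fintype (Y1 k)] [∀ k, Fintype (Y2 k)]

open Classical in
/-- The part of the error probability with relay observation `yR` and relay codeword `xR`. -/
def errorAt (ch : Channel X1 X2 XR YR Y1 Y2) {M : Fin 2 → ℕ} {n m : ℕ}
    (c : RandCode X1 X2 XR YR Y1 Y2 M n m) (yR : Fin n → YR) (xR : Fin m → XR) : ℝ :=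
  ∑ w : (∀ i, Fin (M i)), (∏ i, (M i : ℝ)⁻¹) * ∑ y1 : (∀ k, Fin n → Y1 k),
    (∏ t, (ch.slot1 (fun i => c.enc1 i (w i) t) (yR t, fun k => y1 k t)).toReal) *
      ∑ y2 : (∀ k, Fin m → Y2 k),
        (∏ t, (ch.slot2 (fun i => c.enc2 i (w i) t) (xR t) (fun k => y2 k t)).toReal) *
        (if ∃ k, c.dec k (y1 k) (y2 k) ≠ some w then 1 else 0)

lemma errorProb_eq_sum_errorAt (ch : Channel X1 X2 XR YR Y1 Y2) {M : Fin 2 → ℕ} {n m : ℕ}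
    (c : RandCode X1 X2 XR YR Y1 Y2 M n m) :
    errorProb ch c = ∑ yR, (FinProb.ofPMF (c.relay yR)).E (errorAt ch c yR) := by
  classical
  simp only [errorProb, FinProb.E, FinProb.ofPMF, errorAt, Finset.mul_sum]
  rw [Finset.sum_comm]
  refine Finset.sum_congr rfl fun yR _ => ?_
  rw [Finset.sum_comm (s := (Finset.univ : Finset (Fin m → XR)))]
  refine Finset.sum_congr rfl fun w _ => ?_
  rw [Finset.sum_comm (s := (Finset.univ : Finset (Fin m → XR)))]
  refine Finset.sum_congr rfl fun y1 _ => Finset.sum_congr rfl fun xR _ =>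
    Finset.sum_congr rfl fun y2 _ => by ring

lemma errorProb_nonneg (ch : Channel X1 X2 XR YR Y1 Y2) {M : Fin 2 → ℕ} {n m : ℕ}
    (c : RandCode X1 X2 XR YR Y1 Y2 M n m) : 0 ≤ errorProb ch c := by
  rw [errorProb_eq_sum_errorAt]
  refine Finset.sum_nonneg fun yR _ => FinProb.E_nonneg _ fun xR => ?_
  refine Finset.sum_nonneg fun w _ => mul_nonneg (Finset.prod_nonneg fun i _ => by positivity)
    (Finset.sum_nonneg fun _ _ => mul_nonneg
      (Finset.prod_nonneg fun _ _ => ENNReal.toReal_nonneg) (Finset.sum_nonneg fun _ _ =>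
        mul_nonneg (Finset.prod_nonneg fun _ _ => ENNReal.toReal_nonneg)
          (by split_ifs <;> norm_num)))

/-- Randomization at the relay and declared failures do not help. -/
lemma exists_code_errorProb_le (ch : Channel X1 X2 XR YR Y1 Y2) {M : Fin 2 → ℕ}
    [∀ i, NeZero (M i)] {n m : ℕ} (c : RandCode X1 X2 XR YR Y1 Y2 M n m) :
    ∃ c' : Code X1 X2 XR YR Y1 Y2 M n m, errorProb ch c'.toRandCode ≤ errorProb ch c := by
  classical
  -- For fixed encoders and decoders the error probability is a sum over relay observations of
  -- averages over relay words, so the best word can be taken separately for each observation.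
  choose r hr using fun yR => (FinProb.ofPMF (c.relay yR)).exists_le_E (errorAt ch c yR)
  refine ⟨⟨c.enc1, c.enc2, r, fun k y z => (c.dec k y z).getD fun i => 0⟩, ?_⟩
  rw [errorProb_eq_sum_errorAt, errorProb_eq_sum_errorAt]
  refine Finset.sum_le_sum fun yR _ => le_trans ?_ (hr yR)
  have e : ∀ (x : Fin m → XR) (f : (Fin m → XR) → ℝ),
      (FinProb.ofPMF (PMF.pure x)).E f = f x := fun x f => by
    simp [FinProb.E, FinProb.ofPMF, PMF.pure_apply, apply_ite ENNReal.toReal]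
  refine (e _ _).trans_le ?_
  refine Finset.sum_le_sum fun w _ => mul_le_mul_of_nonneg_left ?_
    (Finset.prod_nonneg fun i _ => by positivity)
  refine Finset.sum_le_sum fun y1 _ => mul_le_mul_of_nonneg_left ?_
    (Finset.prod_nonneg fun t _ => ENNReal.toReal_nonneg)
  refine Finset.sum_le_sum fun y2 _ => mul_le_mul_of_nonneg_left ?_
    (Finset.prod_nonneg fun t _ => ENNReal.toReal_nonneg)
  -- A declared failure is already an error, so replacing it by the message `0` cannot increase the
  -- error.
  by_cases h : ∃ k, c.dec k (y1 k) (y2 k) ≠ some w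
  · rw [if_pos h]
    split_ifs <;> norm_num
  · rw [if_neg h, if_neg]
    push Not at h
    rintro ⟨k, hk⟩
    exact hk (by simp [Code.toRandCode, h k])

end Derandomization

/-! ### Exponential rates along the block length -/

section Asymptotics

lemma tendsto_two_rpow_mul_atTop {r : ℕ → ℝ} {r0 : ℝ} (hr : Tendsto r atTop (𝓝 r0))
    (h0 : 0 < r0) : Tendsto (fun l : ℕ => (2 : ℝ) ^ ((l : ℝ) * r l)) atTop atTop :=
  (tendsto_rpow_atTop_of_base_gt_one 2 one_lt_two).comp
    ((tendsto_natCast_atTop_atTop (R := ℝ)).atTop_mul_pos h0 hr)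

lemma tendsto_two_rpow_mul_zero {r : ℕ → ℝ} {r0 : ℝ} (hr : Tendsto r atTop (𝓝 r0))
    (h0 : r0 < 0) : Tendsto (fun l : ℕ => (2 : ℝ) ^ ((l : ℝ) * r l)) atTop (𝓝 0) :=
  (tendsto_rpow_atBot_of_base_gt_one 2 one_lt_two).comp
    ((tendsto_natCast_atTop_atTop (R := ℝ)).atTop_mul_neg h0 hr)

lemma le_size (r : ℝ) (l : ℕ) : (2 : ℝ) ^ ((l : ℝ) * r) ≤ size r l := Nat.le_ceil _

/-- For `r ≥ 0` the power is at least one, so rounding up costs at most a factor of two. -/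
lemma size_le {r : ℝ} (hr : 0 ≤ r) (l : ℕ) : (size r l : ℝ) ≤ 2 * (2 : ℝ) ^ ((l : ℝ) * r) := by
  have h1 := (Nat.ceil_lt_add_one (a := (2 : ℝ) ^ ((l : ℝ) * r)) (by positivity)).le
  have h2 : 1 ≤ (2 : ℝ) ^ ((l : ℝ) * r) := Real.one_le_rpow one_le_two (by positivity)
  rw [size]
  linarith

lemma prod_size_le {R : Fin 2 → ℝ} (hR : ∀ i, 0 ≤ R i) (I : Finset (Fin 2)) (l : ℕ) :
    ∏ i ∈ I, (size (R i) l : ℝ) ≤ 2 ^ I.card * (2 : ℝ) ^ ((l : ℝ) * ∑ i ∈ I, R i) := by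
  refine (Finset.prod_le_prod (fun i _ => Nat.cast_nonneg _) fun i _ =>
    size_le (hR i) l).trans_eq ?_
  rw [Finset.prod_mul_distrib, Finset.prod_const, Finset.mul_sum, Real.rpow_sum_of_pos two_pos]

variable {β : ℝ} {n m : ℕ → ℕ}

lemma IsSlotSplit.tendsto_snd (h : IsSlotSplit β n m) :
    Tendsto (fun l => (m l : ℝ) / l) atTop (𝓝 (1 - β)) := by
  refine (h.2.const_sub 1).congr' ?_
  filter_upwards [eventually_gt_atTop 0] with l hl
  have h1 : ((n l : ℝ) + m l) = l := by exact_mod_cast h.1 l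
  have hl' : (l : ℝ) ≠ 0 := by positivity
  field_simp
  linarith

lemma IsSlotSplit.mul_div_fst (h : IsSlotSplit β n m) (l : ℕ) :
    (l : ℝ) * ((n l : ℝ) / l) = n l := by
  -- At `l = 0` the quotient is zero by convention, and so is `n 0`.
  rcases Nat.eq_zero_or_pos l with rfl | hl
  · have := h.1 0
    simp [show n 0 = 0 by omega]
  · have hl' : (l : ℝ) ≠ 0 := by positivity
    field_simp

lemma IsSlotSplit.mul_div_snd (h : IsSlotSplit β n m) (l : ℕ) :
    (l : ℝ) * ((m l : ℝ) / l) = m l := by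
  rcases Nat.eq_zero_or_pos l with rfl | hl
  · have := h.1 0
    simp [show m 0 = 0 by omega]
  · have hl' : (l : ℝ) ≠ 0 := by positivity
    field_simp

lemma IsSlotSplit.tendsto_fst_atTop (h : IsSlotSplit β n m) (hβ : 0 < β) :
    Tendsto (fun l => (n l : ℝ)) atTop atTop := by
  simpa only [h.mul_div_fst] using
    (tendsto_natCast_atTop_atTop (R := ℝ)).atTop_mul_pos hβ h.2

lemma IsSlotSplit.tendsto_snd_atTop (h : IsSlotSplit β n m) (hβ : β < 1) :
    Tendsto (fun l => (m l : ℝ)) atTop atTop := by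
  simpa only [h.mul_div_snd] using
    (tendsto_natCast_atTop_atTop (R := ℝ)).atTop_mul_pos (sub_pos.2 hβ) h.tendsto_snd

/-- A rate below the weighted error exponents of the two slots. -/
lemma IsSlotSplit.tendsto_rate (h : IsSlotSplit β n m) {r x y : ℝ}
    (hr : r < β * x + (1 - β) * y) :
    Tendsto (fun l : ℕ => (2 : ℝ) ^ ((l : ℝ) * r) *
      ((2 : ℝ) ^ (-(n l * x)) * (2 : ℝ) ^ (-(m l * y)))) atTop (𝓝 0) := by
  have h1 : Tendsto (fun l => r - (n l : ℝ) / l * x - (m l : ℝ) / l * y) atTop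
      (𝓝 (r - β * x - (1 - β) * y)) :=
    ((h.2.mul_const x).const_sub r).sub (h.tendsto_snd.mul_const y)
  refine (tendsto_two_rpow_mul_zero h1 (by linarith)).congr fun l => ?_
  rw [← Real.rpow_add two_pos, ← Real.rpow_add two_pos]
  congr 1
  rw [← h.mul_div_fst l, ← h.mul_div_snd l]
  rcases Nat.eq_zero_or_pos l with rfl | hl
  · simp
  · have hl' : (l : ℝ) ≠ 0 := by positivity
    field_simp
    ring

/-- Strict inequalities survive small positive slacks; in filter form, finitely many of them are met
at once. -/
lemma eventually_lt_of_continuous {f : ℝ → ℝ} (hf : Continuous f) {x : ℝ} (h : x < f 0) :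
    ∀ᶠ ε in 𝓝[>] (0 : ℝ), x < f ε :=
  ((hf.tendsto 0).eventually (lt_mem_nhds h)).filter_mono nhdsWithin_le_nhds

end Asymptotics

/-! ### Choice of parameters and conclusion -/

section Main

variable {X1 X2 : Fin 2 → Type*} {XR YR YH : Type*} {Y1 Y2 : Fin 2 → Type*}
  [∀ i, Fintype (X1 i)] [∀ i, Fintype (X2 i)] [Fintype XR] [Fintype YR] [Fintype YH]
  [∀ k, Fintype (Y1 k)] [∀ k, Fintype (Y2 k)]
  (ch : Channel X1 X2 XR YR Y1 Y2) (d : InputDist X1 X2 XR YR YH)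

/-- In the rate region, all rates are below the error exponents. -/
lemma exists_exponents (β : ℝ) (R : Fin 2 → ℝ)
    (hind : ∀ i j : Fin 2, i ≠ j → R i <
      min (min (boundA ch d β 0 i j) (boundA ch d β 1 i j))
        (min (boundB ch d β 0 i j) (boundB ch d β 1 i j)))
    (hsum : R 0 + R 1 < min (min (boundC ch d β 0) (boundC ch d β 1))
      (min (boundD ch d β 0) (boundD ch d β 1))) (k : Fin 2) (I : Finset (Fin 2)) (hI : I ≠ ∅) :
    ∃ a1 a1' a2 a2' b1 b1' b2 b2' : ℝ, IsExponents ch d k I a1 a1' a2 a2' b1 b1' b2 b2' ∧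
      ∑ i ∈ I, R i < β * a1 + (1 - β) * a2 ∧
      ∑ i ∈ I, R i + β * quantInfo ch d < β * b1 + (1 - β) * b2 := by
  have hk : k = 0 ∨ k = 1 := by omega
  have hcases : (∃ i j : Fin 2, i ≠ j ∧ I = {i}) ∨ I = Finset.univ := by
    revert I; decide
  rcases hcases with ⟨i, j, hij, rfl⟩ | rfl
  · obtain ⟨a1, a1', a2, a2', b1, b1', b2, b2', h, hA, hB⟩ := exists_exponents_single ch d β k hij
    have := hind i j hij
    simp only [lt_min_iff] at this
    refine ⟨a1, a1', a2, a2', b1, b1', b2, b2', h, ?_, ?_⟩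
    · rw [hA, Finset.sum_singleton]
      rcases hk with rfl | rfl <;> tauto
    · rw [hB, Finset.sum_singleton, add_lt_add_iff_right]
      rcases hk with rfl | rfl <;> tauto
  · obtain ⟨a1, a1', a2, a2', b1, b1', b2, b2', h, hA, hB⟩ := exists_exponents_both ch d β k
    simp only [lt_min_iff] at hsum
    refine ⟨a1, a1', a2, a2', b1, b1', b2, b2', h, ?_, ?_⟩
    · rw [hA, Fin.sum_univ_two]
      rcases hk with rfl | rfl <;> tauto
    · rw [hB, Fin.sum_univ_two, add_lt_add_iff_right]
      rcases hk with rfl | rfl <;> tauto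

lemma achievableByGQF {β : ℝ} (hβ0 : 0 < β) (hβ1 : β < 1) {R : Fin 2 → ℝ} (hR : ∀ i, 0 ≤ R i)
    (hind : ∀ i j : Fin 2, i ≠ j → R i <
      min (min (boundA ch d β 0 i j) (boundA ch d β 1 i j))
        (min (boundB ch d β 0 i j) (boundB ch d β 1 i j)))
    (hsum : R 0 + R 1 < min (min (boundC ch d β 0) (boundC ch d β 1))
      (min (boundD ch d β 0) (boundD ch d β 1))) : AchievableByGQF ch d β R := by
  -- The exponents are extended by zero to `I = ∅` so that they can be chosen as functions of all
  -- `k` and `I`.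
  have hex : ∀ k I, ∃ a1 a1' a2 a2' b1 b1' b2 b2' : ℝ, I ≠ ∅ →
      IsExponents ch d k I a1 a1' a2 a2' b1 b1' b2 b2' ∧
      ∑ i ∈ I, R i < β * a1 + (1 - β) * a2 ∧
      ∑ i ∈ I, R i + β * quantInfo ch d < β * b1 + (1 - β) * b2 := fun k I => by
    by_cases hI : I = ∅
    · exact ⟨0, 0, 0, 0, 0, 0, 0, 0, fun h => absurd hI h⟩
    · obtain ⟨a1, a1', a2, a2', b1, b1', b2, b2', h⟩ := exists_exponents ch d β R hind hsum k I hI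
      exact ⟨a1, a1', a2, a2', b1, b1', b2, b2', fun _ => h⟩
  choose a1 a1' a2 a2' b1 b1' b2 b2' hex using hex
  have hI0 : 0 ≤ quantInfo ch d := mutualInfo_nonneg (law1 ch d) _ _
  -- The excess `δ` of the quantization rate over `β I(Y_R; Ŷ_R)` makes covering succeed and stays
  -- below the slack in the bounds for wrong indices. It is fixed before `ε`, whose size depends on
  -- it.
  obtain ⟨δ, hδ, hδ0⟩ : ∃ δ : ℝ, (∀ k I, I ≠ ∅ →
      ∑ i ∈ I, R i + β * quantInfo ch d < β * b1 k I + (1 - β) * b2 k I - δ) ∧ 0 < δ := by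
    refine (Eventually.and ?_ self_mem_nhdsWithin : ∀ᶠ δ in 𝓝[>] (0 : ℝ), _ ∧ _).exists
    refine eventually_all.2 fun k => eventually_all.2 fun I => ?_
    by_cases hI : I = ∅
    · exact Eventually.of_forall fun _ h => absurd hI h
    · filter_upwards [eventually_lt_of_continuous (f := fun δ => β * b1 k I + (1 - β) * b2 k I - δ)
        (by fun_prop) (by simpa using (hex k I hI).2.2)] with δ hδ _ using hδ
  set RU := β * quantInfo ch d + δ with hRU
  have hRU0 : 0 ≤ RU := by positivity
  -- The quantization parameter will be `ε' = ε / 2`, so the covering condition is stated with `ε /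
  -- 2` and the packing conditions with `ε`.
  obtain ⟨ε, ⟨hε1, hεU, hεI⟩, hε0⟩ : ∃ ε : ℝ, (ε < 1 ∧
      0 < RU - β * (quantInfo ch d + ε / 2 * quantAbs ch d) ∧ ∀ k I, I ≠ ∅ →
      (∑ i ∈ I, R i < β * (a1 k I - ε * a1' k I) + (1 - β) * (a2 k I - ε * a2' k I) ∧
      ∑ i ∈ I, R i + RU < β * (b1 k I - ε * b1' k I) + (1 - β) * (b2 k I - ε * b2' k I))) ∧
      0 < ε := by
    refine (Eventually.and ?_ self_mem_nhdsWithin : ∀ᶠ ε in 𝓝[>] (0 : ℝ), _ ∧ _).exists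
    refine Eventually.and ?_ (Eventually.and ?_ ?_)
    · exact (gt_mem_nhds one_pos).filter_mono nhdsWithin_le_nhds
    · exact eventually_lt_of_continuous
        (f := fun ε => RU - β * (quantInfo ch d + ε / 2 * quantAbs ch d)) (by fun_prop)
        (by simp [hRU, hδ0])
    · refine eventually_all.2 fun k => eventually_all.2 fun I => ?_
      by_cases hI : I = ∅
      · exact Eventually.of_forall fun _ h => absurd hI h
      · filter_upwards [eventually_lt_of_continuous
          (f := fun ε => β * (a1 k I - ε * a1' k I) + (1 - β) * (a2 k I - ε * a2' k I))
          (by fun_prop) (by simpa using (hex k I hI).2.1), eventually_lt_of_continuous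
          (x := ∑ i ∈ I, R i + RU)
          (f := fun ε => β * (b1 k I - ε * b1' k I) + (1 - β) * (b2 k I - ε * b2' k I))
          (by fun_prop) (by have := hδ k I hI; simp; linarith)] with ε h1 h2 _ using ⟨h1, h2⟩
  refine ⟨RU, ε / 2, ε, hRU0, by linarith, by linarith, hε1, fun n m hnm => ?_⟩
  have hn := hnm.tendsto_fst_atTop hβ0
  have hm := hnm.tendsto_snd_atTop hβ1
  set K1 := ∑ k : Fin 2,
    typConst (law (joint1 ch d) fun ω => (ω.1, ω.2.2.1 k, ω.2.2.2)) (ε - ε / 2) with hK1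
  set K2 := typConst (obsLaw ch d).w (ε / 2 / 2) with hK2
  set K3 := ∑ k : Fin 2, typConst (law (joint2 ch d) fun ω => (ω.1, ω.2.1, ω.2.2 k)) ε with hK3
  let B : ℕ → ℝ := fun l => ∑ k : Fin 2, ((K1 / n l +
        (K2 / n l + Real.exp (-((size RU l : ℕ) * ((2 : ℝ)⁻¹ *
        (2 : ℝ) ^ (-(n l * (quantInfo ch d + ε / 2 * quantAbs ch d)))))))) + K3 / m l +
        ∑ I ∈ Finset.univ.erase ∅, (∏ i ∈ I, (size (R i) l : ℝ)) *
          ((2 : ℝ) ^ (-(n l * (a1 k I - ε * a1' k I))) *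
            (2 : ℝ) ^ (-(m l * (a2 k I - ε * a2' k I))) +
          (size RU l : ℕ) * ((2 : ℝ) ^ (-(n l * (b1 k I - ε * b1' k I))) *
            (2 : ℝ) ^ (-(m l * (b2 k I - ε * b2' k I))))))
  have hB : Tendsto B atTop (𝓝 0) := by
    -- The number of indices outgrows the inverse of the covering probability exponentially, by
    -- `hεU`, so the exponent tends to minus infinity.
    have hexp : Tendsto (fun l => Real.exp (-((size RU l : ℕ) * ((2 : ℝ)⁻¹ *
        (2 : ℝ) ^ (-(n l * (quantInfo ch d + ε / 2 * quantAbs ch d))))))) atTop (𝓝 0) := by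
      refine Real.tendsto_exp_atBot.comp (tendsto_neg_atTop_atBot.comp ?_)
      have h1 : Tendsto (fun l => RU - (n l : ℝ) / l * (quantInfo ch d + ε / 2 * quantAbs ch d))
          atTop (𝓝 (RU - β * (quantInfo ch d + ε / 2 * quantAbs ch d))) :=
        (hnm.2.mul_const _).const_sub RU
      refine tendsto_atTop_mono (fun l => ?_)
        ((tendsto_two_rpow_mul_atTop h1 hεU).const_mul_atTop (inv_pos.2 (two_pos (α := ℝ))))
      have h2 := le_size RU l
      rw [mul_sub, ← mul_assoc, hnm.mul_div_fst, sub_eq_add_neg, Real.rpow_add two_pos,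
        mul_left_comm]
      exact mul_le_mul_of_nonneg_right h2 (by positivity)
    have hterm : ∀ k, ∀ I ∈ Finset.univ.erase (∅ : Finset (Fin 2)),
        Tendsto (fun l => (∏ i ∈ I, (size (R i) l : ℝ)) *
          ((2 : ℝ) ^ (-(n l * (a1 k I - ε * a1' k I))) *
            (2 : ℝ) ^ (-(m l * (a2 k I - ε * a2' k I))) +
          (size RU l : ℕ) * ((2 : ℝ) ^ (-(n l * (b1 k I - ε * b1' k I))) *
            (2 : ℝ) ^ (-(m l * (b2 k I - ε * b2' k I)))))) atTop (𝓝 0) := fun k I hI => by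
      obtain ⟨hA, hB⟩ := hεI k I (Finset.mem_erase.1 hI).1
      have h1 := ((hnm.tendsto_rate hA).const_mul ((2 : ℝ) ^ I.card)).add
        ((hnm.tendsto_rate hB).const_mul ((2 : ℝ) ^ I.card * 2))
      simp only [mul_zero, add_zero] at h1
      refine squeeze_zero (fun l => by positivity) (fun l => ?_) h1
      have h2 := prod_size_le hR I l
      have h3 := size_le hRU0 l
      set P := (2 : ℝ) ^ (-(n l * (a1 k I - ε * a1' k I))) *
            (2 : ℝ) ^ (-(m l * (a2 k I - ε * a2' k I)))
      set Q := (2 : ℝ) ^ (-(n l * (b1 k I - ε * b1' k I))) *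
            (2 : ℝ) ^ (-(m l * (b2 k I - ε * b2' k I)))
      have hP : 0 ≤ P := by positivity
      have hQ : 0 ≤ Q := by positivity
      rw [mul_add ((l : ℝ)), Real.rpow_add two_pos]
      calc _ ≤ (2 ^ I.card * (2 : ℝ) ^ ((l : ℝ) * ∑ i ∈ I, R i)) *
            (P + 2 * (2 : ℝ) ^ ((l : ℝ) * RU) * Q) :=
            mul_le_mul h2 (add_le_add le_rfl (mul_le_mul_of_nonneg_right h3 hQ))
              (by positivity) (by positivity)
        _ = _ := by ring
    have h := tendsto_finsetSum (Finset.univ : Finset (Fin 2)) fun k _ =>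
      (((hn.const_div_atTop K1).add ((hn.const_div_atTop K2).add hexp)).add
        (hm.const_div_atTop K3)).add (tendsto_finsetSum _ (hterm k))
    simp only [add_zero, Finset.sum_const_zero] at h
    exact h
  have hcb : ∀ l, ∃ cb : GQFCodebook X1 X2 XR YH (fun i => size (R i) l) (size RU l) (n l) (m l),
      (0 < n l ∧ 0 < m l ∧ typConst (law (joint1 ch d) quantPair) (ε / 2 / 2) / n l ≤ 1 / 2) →
        errorProb ch (cb.toRandCode ch d (ε / 2) ε) ≤ B l := fun l => by
    by_cases hl : 0 < n l ∧ 0 < m l ∧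
        typConst (law (joint1 ch d) quantPair) (ε / 2 / 2) / n l ≤ 1 / 2
    · obtain ⟨cb, h⟩ := exists_codebook_le ch d (fun k I hI => (hex k I hI).1)
        (half_pos hε0) (half_lt_self hε0) hε1 (M := fun i => size (R i) l) (MU := size RU l)
        hl.1 hl.2.1 hl.2.2
      exact ⟨cb, fun _ => h⟩
    -- The bound may be unavailable for finitely many `l`; any constant codebook will do there.
    · have x1 := fun i => (d.src1 i).nonempty.some
      have x2 := fun i => (d.src2 i).nonempty.some
      obtain ⟨b⟩ := (quantLaw ch d).nonempty
      obtain ⟨r⟩ := d.rel.nonempty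
      exact ⟨⟨fun i _ _ => x1 i, fun i _ _ => x2 i, fun _ _ => b, fun _ _ => r⟩,
        fun h => absurd h hl⟩
  choose cb hcb using hcb
  refine ⟨cb, squeeze_zero' (Eventually.of_forall fun l => errorProb_nonneg ch _) ?_ hB⟩
  have h1 := (hn.const_div_atTop (typConst (law (joint1 ch d) quantPair) (ε / 2 / 2))).eventually
    (Iic_mem_nhds (show (0 : ℝ) < 1 / 2 by norm_num))
  filter_upwards [h1, hn.eventually_gt_atTop 0, hm.eventually_gt_atTop 0] with l h2 h3 h4
  exact hcb l ⟨by exact_mod_cast h3, by exact_mod_cast h4, h2⟩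

lemma AchievableByGQF.achievable {ch : Channel X1 X2 XR YR Y1 Y2} {d : InputDist X1 X2 XR YR YH}
    {β : ℝ} {R : Fin 2 → ℝ} (h : AchievableByGQF ch d β R) : Achievable ch β R := by
  obtain ⟨RU, ε', ε, -, -, -, -, h⟩ := h
  intro n m hnm
  obtain ⟨cb, hcb⟩ := h n m hnm
  choose c hc using fun l => exists_code_errorProb_le ch ((cb l).toRandCode ch d ε' ε)
  exact ⟨c, squeeze_zero (fun l => errorProb_nonneg ch _) hc hcb⟩

end Main

end HDcMACr

end

theorem theorem2
    {X1 X2 : Fin 2 → Type*} {XR YR YH : Type*} {Y1 Y2 : Fin 2 → Type*}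
    [∀ i, Fintype (X1 i)] [∀ i, Fintype (X2 i)] [Fintype XR] [Fintype YR] [Fintype YH]
    [∀ k, Fintype (Y1 k)] [∀ k, Fintype (Y2 k)]
    (ch : HDcMACr.Channel X1 X2 XR YR Y1 Y2)
    (d : HDcMACr.InputDist X1 X2 XR YR YH)
    (β : ℝ) (hβ0 : 0 < β) (hβ1 : β < 1)
    (R : Fin 2 → ℝ) (hR : ∀ i, 0 ≤ R i)
    (hind : ∀ i j : Fin 2, i ≠ j → R i <
      min (min (HDcMACr.boundA ch d β 0 i j) (HDcMACr.boundA ch d β 1 i j))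
        (min (HDcMACr.boundB ch d β 0 i j) (HDcMACr.boundB ch d β 1 i j)))
    (hsum : R 0 + R 1 <
      min (min (HDcMACr.boundC ch d β 0) (HDcMACr.boundC ch d β 1))
        (min (HDcMACr.boundD ch d β 0) (HDcMACr.boundD ch d β 1))) :
    HDcMACr.AchievableByGQF ch d β R ∧ HDcMACr.Achievable ch β R := by
  have h := HDcMACr.achievableByGQF ch d hβ0 hβ1 hR hind hsum
  exact ⟨h, h.achievable⟩
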